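/- An infinite time Turing machine has three one-way infinite tapes (input, scratch, output) whose cells hold $0$ or $1$, one head that reads the three cells at its current position, and a finite program with finitely many states, among them three distinct states *start*, *limit* and *halt*. Reals are infinite binary sequences $x\in 2^\omega$. On input $x$ the computation begins with $x$ on the input tape, zeros on the other two tapes, and the head on the left-most cell in the *start* state. At a successor stage the program's instruction for the current state and the three bits read is carried out: write a bit in each of the three cells, move the head one cell left or right or not at all (a head on the left-most cell that is told to move left stays there), and switch to a new state. At a limit ordinal stage the head is on the left-most cell, the state is *limit*, and each cell holds the $\limsup$ of its earlier values. The computation halts if the *halt* state is reached at some ordinal stage; its output is then the content of the output tape at the first such stage. Identify $n\in\mathbb N$ with the real consisting of $n$ ones followed by zeros, and identify a program with its Gödel number, the natural number coding its instruction table under the standard primitive recursive coding of finite lists and tuples. For reals $x,y$ let $\langle x,y\rangle$ be the real with $x$ on the even places and $y$ on the odd places. A partial function $f$ from reals to reals is *infinite time computable* if there is a program $p$ such that, for all reals $x,y$, $f(x)=y$ if and only if $p$ on input $x$ halts with output $y$. A set $A$ of reals is *decidable* if its characteristic function (value $1$ on $A$, value $0$ off $A$) is infinite time computable, and *semi-decidable*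 if the partial function with domain $A$ and constant value $1$ is infinite time computable. **Theorem.** The halting problems $$h=\{p \mid \text{program } p \text{ halts on input } 0\},\qquad H=\{\langle p,x\rangle \mid \text{program } p \text{ halts on input } x\},$$ where $p$ ranges over programs and $x$ over reals, are both semi-decidable, and neither of them is decidable. -/

import Mathlib

/-! Infinite time Turing machines: three tapes (input, scratch, output), one head, ordinal time. -/

namespace ITTM

/-- Cantor space `2^ω`; its members, the infinite binary sequences, are called reals. -/
abbrev Cantor : Type := ℕ → Bool

/-- The natural number `n` as a real: `n` ones followed by zeros. -/
def ofNat (n : ℕ) : Cantor := fun i => decide (i < n)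

/-- The pair `⟨x, y⟩` of two reals: `x` on the even places and `y` on the odd places. -/
def pair (x y : Cantor) : Cantor := fun i => if i % 2 = 0 then x (i / 2) else y (i / 2)

/-- The contents of the three cells (input, scratch, output) under the head. -/
abbrev Symbols : Type := Bool × Bool × Bool

/-- A head movement. -/
inductive Move : Type
  | left
  | stay
  | right

/-- One cell to the left, to the right, or not at all; a head on the left-most cell stays there
when it is told to move left. -/
def Move.apply : Move → ℕ → ℕ
  | .left, i => i - 1
  | .stay, i => i
  | .right, i => i + 1

/-- A number for a head movement, used in the Gödel numbering of programs. -/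
def Move.code : Move → ℕ
  | .left => 0
  | .stay => 1
  | .right => 2

/-- A program with `extra + 3` states. State `0` is the start state, state `1` the limit state and
state `2` the halt state. In state `q`, reading `s`, the program switches to the state
`(instr q s).1`, writes `(instr q s).2.1` on the three cells and moves by `(instr q s).2.2`.
(The instructions at the halt state are irrelevant.) -/
structure Program : Type where
  /-- the number of states other than start, limit and halt -/
  extra : ℕ
  /-- the instructions -/
  instr : Fin (extra + 3) → Symbols → Fin (extra + 3) × Symbols × Move

namespace Program

variable (p : Program)

/-- The set of states of a program. -/
abbrev State : Type := Fin (p.extra + 3)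

/-- The start state. -/
def start : p.State := ⟨0, by omega⟩

/-- The limit state. -/
def limit : p.State := ⟨1, by omega⟩

/-- The halt state. -/
def halt : p.State := ⟨2, by omega⟩

/-- A complete machine configuration. -/
@[ext] structure Config : Type where
  /-- the current state -/
  state : p.State
  /-- the position of the head; `0` is the left-most cell -/
  head : ℕ
  /-- the input tape -/
  input : Cantor
  /-- the scratch tape -/
  scratch : Cantor
  /-- the output tape -/
  output : Cantor

variable {p}

/-- The three symbols under the head. -/
def Config.read (c : p.Config) : Symbols := (c.input c.head, c.scratch c.head, c.output c.head)

/-- One successor step of computation. -/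
def Config.step (c : p.Config) : p.Config where
  state := (p.instr c.state c.read).1
  head := (p.instr c.state c.read).2.2.apply c.head
  input := Function.update c.input c.head (p.instr c.state c.read).2.1.1
  scratch := Function.update c.scratch c.head (p.instr c.state c.read).2.1.2.1
  output := Function.update c.output c.head (p.instr c.state c.read).2.1.2.2

open Classical in
/-- The limsup, cell by cell, of the tapes `t β` for `β < l`, where `l` is a limit ordinal:
a cell shows `1` if and only if it showed `1` at stages unbounded in `l`. -/
noncomputable def limsupTape (l : Ordinal.{0}) (t : ∀ β, β < l → Cantor) : Cantor :=
  fun i => decide (∀ β < l, ∃ γ, ∃ hγ : γ < l, β ≤ γ ∧ t γ hγ i = true)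

variable (p)

/-- The initial configuration on input `x`. -/
def initial (x : Cantor) : p.Config where
  state := p.start
  head := 0
  input := x
  scratch := ofNat 0
  output := ofNat 0

/-- The configuration at a limit stage `l`, given the configurations at all earlier stages. -/
noncomputable def limitConfig (l : Ordinal.{0}) (c : ∀ β, β < l → p.Config) : p.Config where
  state := p.limit
  head := 0
  input := limsupTape l fun β hβ => (c β hβ).input
  scratch := limsupTape l fun β hβ => (c β hβ).scratch
  output := limsupTape l fun β hβ => (c β hβ).output

/-- The configuration of `p` on input `x` at stage `α`. It is meaningful up to the first stage at
which the halt state is reached; later values are never used. -/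
noncomputable def config (x : Cantor) (α : Ordinal.{0}) : p.Config :=
  Ordinal.limitRecOn α (p.initial x) (fun _ c => c.step) (fun l _ c => p.limitConfig l c)

theorem config_zero (x : Cantor) : p.config x 0 = p.initial x :=
  Ordinal.limitRecOn_zero ..

theorem config_succ (x : Cantor) (α : Ordinal.{0}) :
    p.config x (α + 1) = (p.config x α).step :=
  Ordinal.limitRecOn_add_one ..

theorem config_limit (x : Cantor) (l : Ordinal.{0}) (hl : Order.IsSuccLimit l) :
    p.config x l = p.limitConfig l fun β _ => p.config x β :=
  Ordinal.limitRecOn_limit _ _ _ _ hl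

/-- The halt state is reached for the first time at stage `α`. -/
def HaltsAt (x : Cantor) (α : Ordinal.{0}) : Prop :=
  (p.config x α).state = p.halt ∧ ∀ β < α, (p.config x β).state ≠ p.halt

/-- Program `p` halts on input `x`. -/
def Halts (x : Cantor) : Prop := ∃ α, p.HaltsAt x α

/-- The computation of `p` on input `x` yields output `y`: it halts, and `y` is on the output tape
when it does. -/
def Yields (x y : Cantor) : Prop := ∃ α, p.HaltsAt x α ∧ (p.config x α).output = y

/-- The eight instructions for the state `q`, as a list of numbers and bits. -/
def row (q : p.State) : List (ℕ × Symbols × ℕ) :=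
  [(false, false, false), (false, false, true), (false, true, false), (false, true, true),
    (true, false, false), (true, false, true), (true, true, false), (true, true, true)].map
    fun s => (((p.instr q s).1 : ℕ), (p.instr q s).2.1, (p.instr q s).2.2.code)

/-- The whole program as a finite table with one row for each state. -/
def table : List (List (ℕ × Symbols × ℕ)) := List.ofFn p.row

/-- The Gödel number of a program: the number that codes its table under the standard primitive
recursive coding of finite lists and tuples. -/
def code : ℕ := Encodable.encode p.table

theorem code_injective : Function.Injective code := by
  intro p q h
  have h := Encodable.encode_injective h
  obtain ⟨m, f⟩ := p
  obtain ⟨n, g⟩ := q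
  have hl := congrArg List.length h
  simp only [table, List.length_ofFn, add_left_inj] at hl
  subst hl
  have hr := List.ofFn_injective h
  congr
  funext i s
  have hm : Function.Injective Move.code := by
    intro a b
    cases a <;> cases b <;> simp [Move.code]
  have hi := congrFun hr i
  simp only [row, List.map_cons, List.map_nil, List.cons.injEq, Prod.mk.injEq, hm.eq_iff,
    Fin.val_inj] at hi
  ext1
  · rcases s with ⟨_ | _, _ | _, _ | _⟩ <;> simp [hi]
  · rcases s with ⟨_ | _, _ | _, _ | _⟩ <;> ext1 <;> simp [hi]

end Program

/-- A partial function on the reals is (infinite time) computable if some program yields `y` on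
input `x` exactly when `f x = y`. -/
def IsComputable (f : Cantor →. Cantor) : Prop := ∃ p : Program, ∀ x y, y ∈ f x ↔ p.Yields x y

open Classical in
/-- The characteristic function of a set of reals, with the values `1` and `0`. -/
noncomputable def characteristic (A : Set Cantor) : Cantor → Cantor :=
  fun x => if x ∈ A then ofNat 1 else ofNat 0

/-- The function of affirmative values: its domain is `A` and its constant value is `1`. -/
def affirmative (A : Set Cantor) : Cantor →. Cantor := fun x => ⟨x ∈ A, fun _ => ofNat 1⟩

/-- `A` is (infinite time) decidable. -/
def IsDecidable (A : Set Cantor) : Prop := IsComputable (characteristic A : Cantor →. Cantor)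

/-- `A` is (infinite time) semi-decidable. -/
def IsSemiDecidable (A : Set Cantor) : Prop := IsComputable (affirmative A)

/-- The boldface halting problem. -/
def boldHalting : Set Cantor :=
  {z | ∃ (p : Program) (x : Cantor), z = pair (ofNat p.code) x ∧ p.Halts x}

/-- The lightface halting problem. -/
def lightHalting : Set Cantor :=
  {z | ∃ p : Program, z = ofNat p.code ∧ p.Halts (ofNat 0)}

end ITTM

/-! Semi-decidability rests on a universal machine and undecidability on a diagonal argument. Most
of the work goes into the universal machine, which is built in three layers.

A cellular automaton on blocks of cells, in which a block sees the first block, its two neighbours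
and itself, is run by a machine. One sweep of the head over the tape takes `ω` stages and rewrites
every block once, so until the flag is raised the machine at stage `ω · α` shows the automaton at
stage `α`. During a sweep a cell shows only its old or its new content, and it finally keeps the new
one. Hence the limit of one sweep is right, and at limits of sweeps the intermediate stages do not
disturb the limsup (`recurs_normal_iff`). `Rule.yields_iff` and `TrackRule.exists_program` sum this
up.

Such an automaton carries a finite control with stacks whose tops lie in the first block, and three
simulated tapes. Alternating ticks make limits recognizable. At a limit the control and the stacks
are worthless and are set up again from a back-up track that never changes; the simulated tapes hold
the right limsup, again by `recurs_normal_iff`, because each simulated step takes finitely many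
stages and shows only old or new bits. The result is `flag_iff_accepts`.

The control evaluates a partial recursive `Code`, compiled to a stack machine, which computes an
instruction from the state, the symbols read and the index of the program. This gives
`exists_universal`: one machine simulates every program of a computable sequence, and on request it
ignores computations that halt with a `1` on the first output cell. Applied to the decoding of Gödel
numbers it semi-decides both halting problems.

For undecidability, let `d` decide `A`, where a primitive recursive `w` reduces halting on input `0`
to `A`. By hard-wiring inputs (`exists_prefixed`), some machine `P` halts on the numeral `n` iff `d`
rejects the word of "run program `n` on input `n`". Running `P` on its own number yields a program
that halts on `0` iff it does not (`not_isDecidable`). -/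

namespace ITTM

open Order

/-! ### Limsups of bits and normal functions -/

/-- The bit `b` shows `1` at stages unbounded in `l`. -/
def Recurs (l : Ordinal.{0}) (b : Ordinal.{0} → Bool) : Prop :=
  ∀ β < l, ∃ γ < l, β ≤ γ ∧ b γ = true

open Classical in
theorem limsupTape_apply (l : Ordinal.{0}) (X : Ordinal.{0} → Cantor) (i : ℕ) :
    Program.limsupTape l (fun β _ => X β) i = decide (Recurs l fun β => X β i) := by
  simp only [Program.limsupTape, Recurs, exists_prop]
  exact decide_eq_decide.2 Iff.rfl

theorem Recurs.of_eventually_true {l : Ordinal.{0}} {b : Ordinal.{0} → Bool} {β : Ordinal.{0}}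
    (hβ : β < l) (h : ∀ γ, β ≤ γ → γ < l → b γ = true) : Recurs l b := fun δ hδ =>
  ⟨max β δ, max_lt hβ hδ, le_max_right _ _, h _ (le_max_left _ _) (max_lt hβ hδ)⟩

theorem not_recurs_of_eventually_false {l : Ordinal.{0}} {b : Ordinal.{0} → Bool} {β : Ordinal.{0}}
    (hβ : β < l) (h : ∀ γ, β ≤ γ → γ < l → b γ = false) : ¬ Recurs l b := fun H => by
  obtain ⟨γ, h1, h2, h3⟩ := H β hβ
  simp [h γ h2 h1] at h3

open Classical in
theorem decide_recurs_of_eventually {l : Ordinal.{0}} {b : Ordinal.{0} → Bool} {β : Ordinal.{0}}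
    {v : Bool} (hβ : β < l) (h : ∀ γ, β ≤ γ → γ < l → b γ = v) : decide (Recurs l b) = v := by
  cases v
  · simpa using not_recurs_of_eventually_false hβ h
  · simpa using Recurs.of_eventually_true hβ h

/-- A normal function cuts the stages below its value at a limit into intervals. -/
theorem exists_interval {τ : Ordinal.{0} → Ordinal.{0}} (hτ : IsNormal τ) {l β T : Ordinal.{0}}
    (hβ : τ β ≤ T) (hT : T < τ l) :
    ∃ α, β ≤ α ∧ α < l ∧ τ α ≤ T ∧ T < τ (α + 1) := by
  have h0 : τ ⊥ ≤ T := (hτ.monotone bot_le).trans hβ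
  obtain ⟨α, h1, h2⟩ := hτ.exists_map_le_lt_map_succ h0
  rw [succ_eq_add_one] at h2
  refine ⟨α, ?_, hτ.strictMono.lt_iff_lt.1 (h1.trans_lt hT), h1, h2⟩
  exact lt_add_one_iff.1 (hτ.strictMono.lt_iff_lt.1 (hβ.trans_lt h2))

/-- A bit that follows another one along a normal function has the same limsup at limits. -/
theorem recurs_normal_iff {τ : Ordinal.{0} → Ordinal.{0}} (hτ : IsNormal τ) {l : Ordinal.{0}}
    (hl : IsSuccLimit l) {a b : Ordinal.{0} → Bool} (h : ∀ α < l, b (τ α) = a α)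
    (h' : ∀ α < l, ∀ T, τ α ≤ T → T < τ (α + 1) → b T = a α ∨ b T = a (α + 1)) :
    Recurs (τ l) b ↔ Recurs l a := by
  constructor
  -- A `1` of `b` in the interval that begins at `τ α` is a `1` of `a` at `α` or `α + 1`, both below
  -- `l`. The converse holds because the values `τ α` are cofinal in `τ l`.
  · intro H β hβ
    obtain ⟨T, h1, h2, h3⟩ := H (τ β) (hτ.strictMono hβ)
    obtain ⟨α, h4, h5, h6, h7⟩ := exists_interval hτ h2 h1
    rcases h' α h5 T h6 h7 with h8 | h8
    · exact ⟨α, h5, h4, by rw [← h8, h3]⟩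
    · exact ⟨α + 1, hl.add_one_lt h5, h4.trans (le_add_of_nonneg_right zero_le_one),
        by rw [← h8, h3]⟩
  · intro H β hβ
    obtain ⟨α, h1, h2⟩ := (hτ.lt_iff_exists_lt hl).1 hβ
    obtain ⟨γ, h3, h4, h5⟩ := H α h1
    exact ⟨τ γ, hτ.strictMono h3, h2.le.trans (hτ.monotone h4), by rw [h γ h3, h5]⟩

/-! ### Finite runs with invariants -/

theorem iterate_of_succ {C : Type*} {step : C → C} {c : Ordinal.{0} → C}
    (hc : ∀ α, c (α + 1) = step (c α)) (T : Ordinal.{0}) (n : ℕ) :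
    c (T + n) = step^[n] (c T) := by
  induction n with
  | zero => simp
  | succ n ih => rw [Nat.cast_succ, ← add_assoc, hc, ih, Function.iterate_succ_apply']

theorem exists_nat_of_lt_add_omega0 {T S : Ordinal.{0}} (h1 : T ≤ S)
    (h2 : S < T + Ordinal.omega0) : ∃ n : ℕ, S = T + n := by
  have := Ordinal.sub_lt_of_lt_add h2 Ordinal.omega0_pos
  obtain ⟨n, hn⟩ := Ordinal.lt_omega0.1 this
  exact ⟨n, by rw [← hn, Ordinal.add_sub_cancel_of_le h1]⟩

theorem exists_nat_of_lt_add_nat {T S : Ordinal.{0}} {m : ℕ} (h1 : T ≤ S)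
    (h2 : S < T + m) : ∃ n < m, S = T + (n : ℕ) := by
  obtain ⟨n, rfl⟩ := exists_nat_of_lt_add_omega0 h1
    (h2.trans ((add_lt_add_iff_left T).2 (Ordinal.natCast_lt_omega0 m)))
  exact ⟨n, by simpa using h2, rfl⟩

/-- In exactly `n` steps `c` becomes `c'`, and all configurations on the way, the first and the
last one included, satisfy `I`. -/
def Reach {C : Type*} (step : C → C) (I : C → Prop) (n : ℕ) (c c' : C) : Prop :=
  step^[n] c = c' ∧ ∀ m ≤ n, I (step^[m] c)

namespace Reach

variable {C : Type*} {step : C → C} {I : C → Prop} {n m : ℕ} {c c' c'' : C}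

theorem refl (h : I c) : Reach step I 0 c c := ⟨rfl, fun m hm => by simpa [Nat.le_zero.1 hm]⟩

theorem first (h : Reach step I n c c') : I c := h.2 0 (Nat.zero_le n)

theorem last (h : Reach step I n c c') : I c' := h.1 ▸ h.2 n le_rfl

theorem single (h : step c = c') (h1 : I c) (h2 : I c') : Reach step I 1 c c' := by
  refine ⟨h, fun m hm => ?_⟩
  interval_cases m
  · exact h1
  · simpa [h] using h2

theorem trans (h : Reach step I n c c') (h' : Reach step I m c' c'') :
    Reach step I (n + m) c c'' := by
  refine ⟨by rw [add_comm, Function.iterate_add_apply, h.1, h'.1], fun k hk => ?_⟩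
  rcases le_total k n with hkn | hkn
  · exact h.2 k hkn
  · obtain ⟨j, rfl⟩ := Nat.exists_eq_add_of_le hkn
    rw [add_comm, Function.iterate_add_apply, h.1]
    exact h'.2 j (by omega)

theorem head (h : step c = c') (h1 : I c) (h' : Reach step I n c' c'') :
    Reach step I (n + 1) c c'' :=
  Nat.add_comm 1 n ▸ (single h h1 h'.first).trans h'

/-- An infinite chain of runs with stronger and stronger invariants. -/
theorem chain {I : ℕ → C → Prop} {k : ℕ → ℕ} {c : ℕ → C}
    (hI : ∀ i d, I (i + 1) d → I i d) (hk : ∀ i, 0 < k i)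
    (h : ∀ i, Reach step (I i) (k i) (c i) (c (i + 1))) (i : ℕ) :
    ∃ N, (i = 0 → N = 0) ∧ ∀ m ≥ N, I i (step^[m] (c 0)) := by
  set N : ℕ → ℕ := fun i => ∑ j ∈ Finset.range i, k j with hN
  have hmono : ∀ i j d, i ≤ j → I j d → I i d := fun i j d hij => by
    induction hij with
    | refl => exact id
    | step _ ih => exact fun hd => ih (hI _ _ hd)
  have hc : ∀ i, step^[N i] (c 0) = c i := fun i => by
    induction i with
    | zero => simp [hN]
    | succ i ih =>
      have : N (i + 1) = k i + N i := by simp [hN, Finset.sum_range_succ, add_comm]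
      rw [this, Function.iterate_add_apply, ih, (h i).1]
  have key : ∀ j m, N i ≤ m → m ≤ N (i + j) → I i (step^[m] (c 0)) := fun j => by
    induction j with
    | zero =>
      intro m h1 h2
      obtain rfl : m = N i := le_antisymm h2 h1
      rw [hc]
      exact (h i).first
    | succ j ih =>
      intro m h1 h2
      rcases le_total m (N (i + j)) with h3 | h3
      · exact ih m h1 h3
      · obtain ⟨d, rfl⟩ := Nat.exists_eq_add_of_le h3
        have : N (i + (j + 1)) = N (i + j) + k (i + j) := by
          simp [hN, Finset.sum_range_succ, ← add_assoc]
        rw [add_comm, Function.iterate_add_apply, hc]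
        exact hmono _ _ _ (Nat.le_add_right i j) ((h (i + j)).2 d (by omega))
  -- All runs have positive length, so the partial sums exceed every `m` and `key` applies beyond
  -- any bound.
  have hNge : ∀ j, j ≤ N j := fun j => by
    induction j with
    | zero => simp
    | succ j ih =>
      have : N (j + 1) = N j + k j := by simp [hN, Finset.sum_range_succ]
      have := hk j
      omega
  refine ⟨N i, fun h => by simp [hN, h], fun m hm => key m m hm ?_⟩
  exact (hNge m).trans (Finset.sum_le_sum_of_subset (by simp))

end Reach

/-! ### Block automata and one sweep of the machine that runs them -/

/-- A block of `B` consecutive cells: the bits on the input tape and on the scratch tape. -/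
abbrev Blk (B : ℕ) : Type := Fin B → Bool × Bool

/-- A local rule of a cellular automaton on blocks. The new content of a block depends on whether
it is the first one, and on the contents of the first block, its left neighbour, itself and its
right neighbour. -/
abbrev Rule (B : ℕ) : Type := Bool → Blk B → Blk B → Blk B → Blk B → Blk B

namespace Rule

variable {B : ℕ} (f : Rule B)

/-- One step of the automaton. -/
def step (X : ℕ → Blk B) : ℕ → Blk B :=
  fun i => f (decide (i = 0)) (X 0) (X (i - 1)) (X i) (X (i + 1))

open Classical in
/-- The transfinite run of the automaton. -/
noncomputable def run (X : ℕ → Blk B) (α : Ordinal.{0}) : ℕ → Blk B :=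
  Ordinal.limitRecOn α X (fun _ Y => f.step Y) fun l _ Y i j =>
    (decide (∀ β < l, ∃ γ, ∃ hγ : γ < l, β ≤ γ ∧ (Y γ hγ i j).1 = true),
      decide (∀ β < l, ∃ γ, ∃ hγ : γ < l, β ≤ γ ∧ (Y γ hγ i j).2 = true))

theorem run_zero (X : ℕ → Blk B) : f.run X 0 = X := Ordinal.limitRecOn_zero ..

theorem run_succ (X : ℕ → Blk B) (α : Ordinal.{0}) : f.run X (α + 1) = f.step (f.run X α) :=
  Ordinal.limitRecOn_add_one ..

open Classical in
theorem run_limit (X : ℕ → Blk B) {l : Ordinal.{0}} (hl : IsSuccLimit l) :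
    f.run X l = fun i j => (decide (Recurs l fun β => (f.run X β i j).1),
      decide (Recurs l fun β => (f.run X β i j).2)) := by
  rw [run, Ordinal.limitRecOn_limit _ _ _ _ hl]
  simp only [Recurs, exists_prop]
  rfl

/-- What the head remembers at the beginning of a block: nothing if it is the first one, and
otherwise the old contents of the first block and of the preceding one. -/
abbrev Memory (B : ℕ) : Type := Option (Blk B × Blk B)

/-- The states of the machine that runs the automaton, other than the three special ones: it reads
two blocks, moves back, and writes a block. -/
abbrev PassState (B : ℕ) : Type :=
  (Memory B × Fin (2 * B + 1) × Blk (2 * B)) ⊕ (Memory B × Fin (2 * B + 1) × Blk (2 * B)) ⊕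
    (Memory B × Fin (B + 1) × Blk B)

/-- The states of the machine that runs the automaton. -/
abbrev FullState (B : ℕ) : Type := Fin 3 ⊕ PassState B

abbrev reading (q : Memory B) (k : Fin (2 * B + 1)) (b : Blk (2 * B)) : FullState B :=
  .inr (.inl (q, k, b))

abbrev rewinding (q : Memory B) (k : Fin (2 * B + 1)) (b : Blk (2 * B)) : FullState B :=
  .inr (.inr (.inl (q, k, b)))

abbrev writing (q : Memory B) (k : Fin (B + 1)) (b : Blk B) : FullState B :=
  .inr (.inr (.inr (q, k, b)))

abbrev beginPass : FullState B := reading none 0 fun _ => (false, false)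

def firstHalf (b : Blk (2 * B)) : Blk B := fun j => b ⟨j, by omega⟩

def secondHalf (b : Blk (2 * B)) : Blk B := fun j => b ⟨B + j, by omega⟩

/-- The instructions of the machine that runs the automaton. -/
def instr : FullState B → Symbols → FullState B × Symbols × Move
  -- The flag is the scratch bit of cell `0`, inspected in the start or limit state, hence once per
  -- sweep. Halting puts a single `1` on an output tape that is otherwise empty.
  | .inl _, s => if s.2.1 then (.inl 2, (s.1, s.2.1, true), .stay) else (beginPass, s, .stay)
  | .inr (.inl (q, k, b)), s =>
    if h : (k : ℕ) < 2 * B then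
      (reading q ⟨k + 1, by omega⟩ (Function.update b ⟨k, h⟩ (s.1, s.2.1)), s, .right)
    else (rewinding q (Fin.last _) b, s, .stay)
  | .inr (.inr (.inl (q, k, b))), s =>
    if (k : ℕ) = 0 then
      (writing (some ((q.map Prod.fst).getD (firstHalf b), firstHalf b)) 0
        (f q.isNone ((q.map Prod.fst).getD (firstHalf b)) ((q.map Prod.snd).getD (firstHalf b))
          (firstHalf b) (secondHalf b)), s, .stay)
    else (rewinding q ⟨k - 1, by omega⟩ b, s, .left)
  | .inr (.inr (.inr (q, k, b))), s =>
    if h : (k : ℕ) < B then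
      (writing q ⟨k + 1, by omega⟩ b, ((b ⟨k, h⟩).1, (b ⟨k, h⟩).2, s.2.2), .right)
    else (reading q 0 fun _ => (false, false), s, .stay)

/-- The numbering of the states. -/
noncomputable def stateEquiv (B : ℕ) : FullState B ≃ Fin (Fintype.card (PassState B) + 3) :=
  ((Equiv.sumCongr (Equiv.refl _) (Fintype.equivFin _)).trans finSumFinEquiv).trans
    (finCongr (add_comm _ _))

/-- The machine that runs the automaton. -/
noncomputable def program : Program where
  extra := Fintype.card (PassState B)
  instr q s := (f.instr ((stateEquiv B).symm q) s).map (stateEquiv B) id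

theorem stateEquiv_start : stateEquiv B (.inl 0) = f.program.start := by
  ext; simp [stateEquiv, Program.start]

theorem stateEquiv_limit : stateEquiv B (.inl 1) = f.program.limit := by
  ext; simp [stateEquiv, Program.limit]

theorem stateEquiv_halt : stateEquiv B (.inl 2) = f.program.halt := by
  ext; simp [stateEquiv, Program.halt]

/-- A configuration with an empty output tape. -/
noncomputable def cfg (s : FullState B) (h : ℕ) (T : ℕ → Bool × Bool) : f.program.Config where
  state := stateEquiv B s
  head := h
  input c := (T c).1
  scratch c := (T c).2
  output _ := false

theorem step_cfg {s s' : FullState B} {h h' : ℕ} {T T' : ℕ → Bool × Bool} {w : Bool × Bool}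
    {m : Move} (hi : f.instr s ((T h).1, (T h).2, false) = (s', (w.1, w.2, false), m))
    (hh : m.apply h = h') (hT : Function.update T h w = T') :
    (f.cfg s h T).step = f.cfg s' h' T' := by
  have : f.program.instr (f.cfg s h T).state (f.cfg s h T).read =
      (stateEquiv B s', (w.1, w.2, false), m) := by
    simp [program, cfg, Program.Config.read, hi]
  subst hh hT
  ext1
  · simp only [Program.Config.step, this]; rfl
  · simp only [Program.Config.step, this]; rfl
  all_goals
    funext c
    simp only [Program.Config.step, this]
    by_cases hc : c = h <;> simp [cfg, hc]

theorem step_cfg_keep {s s' : FullState B} {h h' : ℕ} {T : ℕ → Bool × Bool}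
    {m : Move} (hi : f.instr s ((T h).1, (T h).2, false) = (s', ((T h).1, (T h).2, false), m))
    (hh : m.apply h = h') : (f.cfg s h T).step = f.cfg s' h' T :=
  f.step_cfg hi hh (Function.update_eq_self _ _)

/-- The blocks as a single tape. -/
def flat [NeZero B] (X : ℕ → Blk B) (c : ℕ) : Bool × Bool :=
  X (c / B) ⟨c % B, Nat.mod_lt _ (NeZero.pos B)⟩

theorem flat_mul_add [NeZero B] (X : ℕ → Blk B) (i : ℕ) (j : Fin B) :
    flat X (i * B + j) = X i j := by
  have h1 : (i * B + j) / B = i := by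
    rw [mul_comm, Nat.mul_add_div (NeZero.pos B), Nat.div_eq_of_lt j.2, add_zero]
  have h2 : (i * B + j) % B = j := by
    rw [mul_comm, Nat.mul_add_mod, Nat.mod_eq_of_lt j.2]
  simp only [flat, h1, h2]

variable [NeZero B]

/-- The tape in the course of a pass: the new content on the first `m` cells. -/
def mixed (X : ℕ → Blk B) (m : ℕ) (c : ℕ) : Bool × Bool :=
  if c < m then flat (f.step X) c else flat X c

theorem update_mixed (X : ℕ → Blk B) (m : ℕ) :
    Function.update (f.mixed X m) m (flat (f.step X) m) = f.mixed X (m + 1) := by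
  funext c
  rcases lt_trichotomy c m with h | rfl | h
  · simp [mixed, h, h.ne, h.trans (Nat.lt_succ_self m)]
  · simp [mixed]
  · simp [mixed, h.ne', not_lt.2 h.le, not_lt.2 (Nat.succ_le_of_lt h)]

/-- The invariant in the course of a pass that has dealt with `i` blocks. -/
def PassInv (X : ℕ → Blk B) (i : ℕ) (c : f.program.Config) : Prop :=
  c.state ≠ f.program.halt ∧ c.output = (fun _ => false) ∧
    (∀ j, (c.input j, c.scratch j) = flat X j ∨ (c.input j, c.scratch j) = flat (f.step X) j) ∧
    ∀ j < i * B, (c.input j, c.scratch j) = flat (f.step X) j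

theorem passInv_cfg {X : ℕ → Blk B} {i m : ℕ} (him : i * B ≤ m) {s : FullState B}
    (hs : s ≠ .inl 2) (h : ℕ) : f.PassInv X i (f.cfg s h (f.mixed X m)) := by
  refine ⟨?_, rfl, fun j => ?_, fun j hj => ?_⟩
  · rw [← f.stateEquiv_halt]
    exact fun h => hs ((stateEquiv B).injective h)
  · by_cases hj : j < m
    · right; simp [cfg, mixed, hj]
    · left; simp [cfg, mixed, hj]
  · simp [cfg, mixed, hj.trans_le him]

theorem reach_reading (X : ℕ → Blk B) (i : ℕ) (q : Memory B) (k : ℕ) (hk : k < 2 * B + 1) :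
    Reach Program.Config.step (f.PassInv X i) k
      (f.cfg (reading q 0 fun _ => (false, false)) (i * B) (f.mixed X (i * B)))
      (f.cfg (reading q ⟨k, hk⟩ fun j => if (j : ℕ) < k then f.mixed X (i * B) (i * B + j) else
        (false, false)) (i * B + k) (f.mixed X (i * B))) := by
  induction k with
  | zero => simpa using Reach.refl (f.passInv_cfg le_rfl Sum.inr_ne_inl _)
  | succ k ih =>
    refine (ih (by omega)).trans (.single (f.step_cfg_keep (m := .right) ?_ rfl)
      (f.passInv_cfg le_rfl Sum.inr_ne_inl _) (f.passInv_cfg le_rfl Sum.inr_ne_inl _))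
    have hk' : k < 2 * B := by omega
    simp only [instr, hk', dite_true, Prod.mk.injEq, and_true, Sum.inr.injEq, Sum.inl.injEq,
      true_and]
    funext j
    rcases lt_trichotomy (j : ℕ) k with h | h | h
    · have : j ≠ ⟨k, hk'⟩ := fun e => by simp [e] at h
      simp [this, h, h.trans (Nat.lt_succ_self k)]
    · obtain rfl : j = ⟨k, hk'⟩ := Fin.ext h
      simp
    · have : j ≠ ⟨k, hk'⟩ := fun e => by simp [e] at h
      simp [this, not_lt.2 h.le, not_lt.2 (Nat.succ_le_of_lt h)]

theorem reach_rewinding (X : ℕ → Blk B) (i h : ℕ) (q : Memory B) (b : Blk (2 * B)) (k : ℕ)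
    (hk : k < 2 * B + 1) :
    Reach Program.Config.step (f.PassInv X i) k
      (f.cfg (rewinding q ⟨k, hk⟩ b) (h + k) (f.mixed X (i * B)))
      (f.cfg (rewinding q 0 b) h (f.mixed X (i * B))) := by
  induction k with
  | zero => simpa using Reach.refl (f.passInv_cfg le_rfl Sum.inr_ne_inl _)
  | succ k ih =>
    refine .head (f.step_cfg_keep (m := .left) ?_ ?_)
      (f.passInv_cfg le_rfl Sum.inr_ne_inl _) (ih (by omega))
    · simp [instr]
    · rfl

theorem reach_writing (X : ℕ → Blk B) (i : ℕ) (q : Memory B) (k : ℕ) (hk : k < B + 1) :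
    Reach Program.Config.step (f.PassInv X i) k
      (f.cfg (writing q 0 (f.step X i)) (i * B) (f.mixed X (i * B)))
      (f.cfg (writing q ⟨k, hk⟩ (f.step X i)) (i * B + k) (f.mixed X (i * B + k))) := by
  induction k with
  | zero => simpa using Reach.refl (f.passInv_cfg le_rfl Sum.inr_ne_inl _)
  | succ k ih =>
    have hk' : k < B := by omega
    refine (ih (by omega)).trans (.single
      (f.step_cfg (m := .right) (w := f.step X i ⟨k, hk'⟩) ?_ rfl ?_)
      (f.passInv_cfg (by omega) (by simp) _) (f.passInv_cfg (by omega) (by simp) _))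
    · simp [instr, hk']
    · rw [← add_assoc, ← update_mixed, ← flat_mul_add (f.step X) i ⟨k, hk'⟩]

/-- What the head remembers at the beginning of the block `i`. -/
def memory (X : ℕ → Blk B) (i : ℕ) : Memory B := if i = 0 then none else some (X 0, X (i - 1))

/-- The configuration at the beginning of the block `i`. -/
noncomputable def atBlock (X : ℕ → Blk B) (i : ℕ) : f.program.Config :=
  f.cfg (reading (memory X i) 0 fun _ => (false, false)) (i * B) (f.mixed X (i * B))

/-- The length is `2B` for reading, `2B` for rewinding, `B` for writing and one step for each of the
three changes of mode. The rule needs old contents while everything to the left of block `i` is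
already new: the right neighbour is read before block `i` is written, and the first block and the
left neighbour are remembered. -/
theorem reach_atBlock (X : ℕ → Blk B) (i : ℕ) :
    Reach Program.Config.step (f.PassInv X i) (2 * B + (2 * B + (B + 1 + 1) + 1))
      (f.atBlock X i) (f.atBlock X (i + 1)) := by
  have inv : ∀ {m s h}, i * B ≤ m → s ≠ .inl 2 → f.PassInv X i (f.cfg s h (f.mixed X m)) :=
    fun h1 h2 => f.passInv_cfg h1 h2 _
  set b : Blk (2 * B) := fun j => f.mixed X (i * B) (i * B + j) with hb
  have h1 : firstHalf b = X i := by
    funext j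
    simp [firstHalf, hb, mixed, flat_mul_add]
  have h2 : secondHalf b = X (i + 1) := by
    funext j
    have : i * B + (B + (j : ℕ)) = (i + 1) * B + j := by ring
    simp only [secondHalf, hb, mixed, this, flat_mul_add]
    rw [if_neg]
    rw [add_mul]; omega
  have hr := f.reach_reading X i (memory X i) (2 * B) (by omega)
  have hb' : (fun j : Fin (2 * B) => if (j : ℕ) < 2 * B then f.mixed X (i * B) (i * B + j) else
      (false, false)) = b := by
    funext j; simp [hb]
  rw [hb'] at hr
  refine hr.trans (.head (f.step_cfg_keep (m := .stay) (s' := rewinding (memory X i) (Fin.last _) b) ?_ rfl)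
    (inv le_rfl Sum.inr_ne_inl) (.trans (f.reach_rewinding X i (i * B) (memory X i) b (2 * B) (by omega))
    (.head (f.step_cfg_keep (m := .stay)
      (s' := writing (memory X (i + 1)) 0 (f.step X i)) ?_ rfl) (inv le_rfl Sum.inr_ne_inl)
    (.trans (f.reach_writing X i _ B (by omega)) (.single
      (c' := f.atBlock X (i + 1)) ?_
      (inv (by omega) (by simp)) (inv (by rw [add_mul]; omega) (by simp)))))))
  · simp [instr]
  · by_cases hi : i = 0
    · subst hi; simp [instr, h1, h2, memory, step]
    · simp [instr, h1, h2, memory, step, hi]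
  · have hi : i * B + B = (i + 1) * B := by ring
    rw [hi]
    exact f.step_cfg_keep (m := .stay) (by simp [instr]) rfl

end Rule

/-! ### The transfinite run of a block automaton on a machine -/

namespace Rule

variable {B : ℕ} (f : Rule B) [NeZero B]

theorem flat_zero (X : ℕ → Blk B) : flat X 0 = X 0 0 := by
  simpa using flat_mul_add X 0 0

theorem mixed_zero (X : ℕ → Blk B) : f.mixed X 0 = flat X := by
  funext c; simp [mixed]

/-- Chaining the runs over single blocks shows that the first `i` blocks are final after finitely
many steps. This is what makes the limit at the end of the sweep equal to the new configuration. -/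
theorem passInv_iterate (X : ℕ → Blk B) (hX : (X 0 0).2 = false) {s : Fin 3} (hs : s ≠ 2)
    (i : ℕ) : ∃ N, (i = 0 → N = 0) ∧
      ∀ m ≥ N, f.PassInv X i (Program.Config.step^[m] (f.cfg (.inl s) 0 (flat X))) := by
  have hs' : (.inl s : FullState B) ≠ .inl 2 := fun h => hs (Sum.inl_injective h)
  have h0 : (f.cfg (.inl s) 0 (flat X)).step = f.atBlock X 0 := by
    rw [atBlock, zero_mul, mixed_zero]
    exact f.step_cfg_keep (m := .stay) (by simp [instr, memory, flat_zero, hX]) rfl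
  have hi := f.passInv_cfg (X := X) (m := 0) (i := 0) (by simp) hs' 0
  rw [mixed_zero] at hi
  have := Reach.chain (step := Program.Config.step) (I := f.PassInv X)
    -- The first run has one more step, which leaves the start or limit state.
    (k := fun i => 2 * B + (2 * B + (B + 1 + 1) + 1) + if i = 0 then 1 else 0)
    (c := fun i => if i = 0 then f.cfg (.inl s) 0 (flat X) else f.atBlock X i)
    (fun i c h => ⟨h.1, h.2.1, h.2.2.1, fun j hj => h.2.2.2 j (by rw [add_mul]; omega)⟩)
    (fun i => by omega) (fun i => ?_) i
  · simpa using this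
  · rcases i with _ | i
    · exact .head h0 hi (f.reach_atBlock X 0)
    · simpa using f.reach_atBlock X (i + 1)

theorem PassInv.state_ne {f : Rule B} {X : ℕ → Blk B} {i : ℕ} {c : f.program.Config}
    (h : f.PassInv X i c) : c.state ≠ f.program.halt := h.1

variable {z : Cantor} {X : ℕ → Blk B} (hX : flat X = fun c => (z c, false))

/-- At the beginning of a pass the machine shows the configuration of the automaton. -/
def Shows (z : Cantor) (X : ℕ → Blk B) (α : Ordinal.{0}) : Prop :=
  f.program.config z (Ordinal.omega0 * α) =
    f.cfg (.inl (if α = 0 then 0 else 1)) 0 (flat (f.run X α))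

variable {f} in
theorem Shows.passInv {α : Ordinal.{0}} (h : f.Shows z X α)
    (hα : (f.run X α 0 0).2 = false) (i : ℕ) : ∃ N : ℕ, (i = 0 → N = 0) ∧ ∀ m ≥ N,
      f.PassInv (f.run X α) i (f.program.config z (Ordinal.omega0 * α + (m : ℕ))) := by
  obtain ⟨N, h1, h2⟩ := f.passInv_iterate (f.run X α) hα (s := if α = 0 then 0 else 1)
    (by split_ifs <;> decide) i
  refine ⟨N, h1, fun m hm => ?_⟩
  rw [iterate_of_succ (step := Program.Config.step) (fun α => f.program.config_succ z α), h]
  exact h2 m hm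

variable {f} in
theorem Shows.passInv_of_lt {α T : Ordinal.{0}} (h : f.Shows z X α)
    (hα : (f.run X α 0 0).2 = false) (h1 : Ordinal.omega0 * α ≤ T)
    (h2 : T < Ordinal.omega0 * (α + 1)) :
    f.PassInv (f.run X α) 0 (f.program.config z T) := by
  rw [← succ_eq_add_one, Ordinal.mul_succ] at h2
  obtain ⟨n, rfl⟩ := exists_nat_of_lt_add_omega0 h1 h2
  obtain ⟨N, h3, h4⟩ := h.passInv hα 0
  exact h4 n (by simp [h3 rfl])

theorem isNormal_omega0_mul : IsNormal (fun α : Ordinal.{0} => Ordinal.omega0 * α) :=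
  Ordinal.isNormal_mul_right Ordinal.omega0_pos

theorem isSuccLimit_omega0_mul {α : Ordinal.{0}} (h : α ≠ 0) :
    IsSuccLimit (Ordinal.omega0 * α) :=
  ⟨fun hm => mul_ne_zero Ordinal.omega0_ne_zero h (isMin_iff_eq_bot.1 hm),
    Ordinal.isSuccPrelimit_iff_omega0_dvd.2 (dvd_mul_right _ _)⟩

/-- To show the configuration at a later stage it suffices to get the limits of the tapes right. -/
theorem shows_of_limit {α : Ordinal.{0}} (h : α ≠ 0)
    (h1 : ∀ c, (Program.limsupTape (Ordinal.omega0 * α)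
      fun β _ => (f.program.config z β).input) c = (flat (f.run X α) c).1)
    (h2 : ∀ c, (Program.limsupTape (Ordinal.omega0 * α)
      fun β _ => (f.program.config z β).scratch) c = (flat (f.run X α) c).2)
    (h3 : ∀ c, (Program.limsupTape (Ordinal.omega0 * α)
      fun β _ => (f.program.config z β).output) c = false) : f.Shows z X α := by
  rw [Shows, f.program.config_limit z _ (isSuccLimit_omega0_mul h), if_neg h]
  ext1
  · exact f.stateEquiv_limit.symm
  · rfl
  · exact funext h1
  · exact funext h2
  · exact funext h3

-- Induction on `α`. At successors each cell is eventually constant with its new content. At limits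
-- `recurs_normal_iff` applies to the normal function `α ↦ ω · α`, since within a sweep a cell shows
-- its old or its new content.
include hX in
theorem shows_of_forall_lt {α : Ordinal.{0}} (h : ∀ β < α, (f.run X β 0 0).2 = false) :
    f.Shows z X α := by
  induction α using Ordinal.limitRecOn with
  | zero =>
    rw [Shows, mul_zero, Program.config_zero, run_zero, if_pos rfl, hX, Program.initial,
      ← stateEquiv_start]
    rfl
  | add_one α ih =>
    have ih := ih fun β hβ => h β (hβ.trans (lt_add_one α))
    have hα := h α (lt_add_one α)
    have ev : ∀ i, ∃ β < Ordinal.omega0 * (α + 1), ∀ γ, β ≤ γ → γ < Ordinal.omega0 * (α + 1) →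
        f.PassInv (f.run X α) i (f.program.config z γ) := fun i => by
      obtain ⟨N, -, hN⟩ := ih.passInv hα i
      have e : Ordinal.omega0 * (α + 1) = Ordinal.omega0 * α + Ordinal.omega0 := by
        rw [← succ_eq_add_one, Ordinal.mul_succ]
      refine ⟨Ordinal.omega0 * α + (N : ℕ), ?_, fun γ h1 h2 => ?_⟩
      · rw [e, add_lt_add_iff_left]; exact Ordinal.natCast_lt_omega0 N
      · rw [e] at h2
        obtain ⟨n, rfl⟩ := exists_nat_of_lt_add_omega0 (le_self_add.trans h1) h2
        exact hN n (by simpa using h1)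
    have hne : α + 1 ≠ 0 := by simp
    refine f.shows_of_limit hne (fun c => ?_) (fun c => ?_) fun c => ?_
    -- As `B ≥ 1`, the cell `c` lies in the first `c + 1` blocks.
    · obtain ⟨β, h1, h2⟩ := ev (c + 1)
      rw [limsupTape_apply _ fun β => (f.program.config z β).input]
      refine decide_recurs_of_eventually h1 fun γ h3 h4 => ?_
      have := (h2 γ h3 h4).2.2.2 c (by nlinarith [NeZero.pos B])
      rw [run_succ, ← this]
    · obtain ⟨β, h1, h2⟩ := ev (c + 1)
      rw [limsupTape_apply _ fun β => (f.program.config z β).scratch]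
      refine decide_recurs_of_eventually h1 fun γ h3 h4 => ?_
      have := (h2 γ h3 h4).2.2.2 c (by nlinarith [NeZero.pos B])
      rw [run_succ, ← this]
    · obtain ⟨β, h1, h2⟩ := ev 0
      rw [limsupTape_apply _ fun β => (f.program.config z β).output]
      refine decide_recurs_of_eventually h1 fun γ h3 h4 => ?_
      rw [(h2 γ h3 h4).2.1]
  | limit l hl ih =>
    have ih : ∀ β < l, f.Shows z X β := fun β hβ => ih β hβ fun γ hγ => h γ (hγ.trans hβ)
    have hne : l ≠ 0 := hl.ne_bot
    have inv : ∀ α < l, ∀ T, Ordinal.omega0 * α ≤ T → T < Ordinal.omega0 * (α + 1) →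
        f.PassInv (f.run X α) 0 (f.program.config z T) :=
      fun α hα T h1 h2 => (ih α hα).passInv_of_lt (h α hα) h1 h2
    refine f.shows_of_limit hne (fun c => ?_) (fun c => ?_) fun c => ?_
    · rw [limsupTape_apply _ fun β => (f.program.config z β).input, flat, run_limit _ _ hl]
      refine decide_eq_decide.2 (recurs_normal_iff isNormal_omega0_mul hl
        (fun α hα => by rw [ih α hα]; rfl) fun α hα T h1 h2 => ?_)
      rw [run_succ]
      exact ((inv α hα T h1 h2).2.2.1 c).imp (congrArg Prod.fst) (congrArg Prod.fst)
    · rw [limsupTape_apply _ fun β => (f.program.config z β).scratch, flat, run_limit _ _ hl]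
      refine decide_eq_decide.2 (recurs_normal_iff isNormal_omega0_mul hl
        (fun α hα => by rw [ih α hα]; rfl) fun α hα T h1 h2 => ?_)
      rw [run_succ]
      exact ((inv α hα T h1 h2).2.2.1 c).imp (congrArg Prod.snd) (congrArg Prod.snd)
    · rw [limsupTape_apply _ fun β => (f.program.config z β).output]
      refine decide_recurs_of_eventually (β := 0)
        (isSuccLimit_omega0_mul hne).bot_lt fun T _ hT => ?_
      obtain ⟨α, -, h2, h3, h4⟩ := exists_interval isNormal_omega0_mul (β := 0) (by simp) hT
      rw [(inv α h2 T h3 h4).2.1]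

include hX in
theorem state_ne_halt_of_lt {α T : Ordinal.{0}} (h : ∀ β < α, (f.run X β 0 0).2 = false)
    (hT : T < Ordinal.omega0 * α) : (f.program.config z T).state ≠ f.program.halt := by
  obtain ⟨β, -, h2, h3, h4⟩ := exists_interval isNormal_omega0_mul (β := 0) (by simp) hT
  exact ((f.shows_of_forall_lt hX fun γ hγ => h γ (hγ.trans h2)).passInv_of_lt
    (h β h2) h3 h4).state_ne

theorem _root_.ITTM.Program.HaltsAt.unique {p : Program} {x : Cantor} {α β : Ordinal.{0}} (h : p.HaltsAt x α)
    (h' : p.HaltsAt x β) : α = β := by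
  rcases lt_trichotomy α β with hl | rfl | hl
  · exact absurd h.1 (h'.2 _ hl)
  · rfl
  · exact absurd h'.1 (h.2 _ hl)

theorem haltsAt_of_first {α : Ordinal.{0}} (hX : flat X = fun c => (z c, false))
    (h : ∀ β < α, (f.run X β 0 0).2 = false) (hα : (f.run X α 0 0).2 = true) :
    f.program.HaltsAt z (Ordinal.omega0 * α + 1) ∧
      (f.program.config z (Ordinal.omega0 * α + 1)).output = ofNat 1 := by
  have hs := f.shows_of_forall_lt hX h
  set s : Fin 3 := if α = 0 then 0 else 1 with hsdef
  have hs2 : s ≠ 2 := by rw [hsdef]; split_ifs <;> decide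
  have hi : f.program.instr (f.program.config z (Ordinal.omega0 * α)).state
      (f.program.config z (Ordinal.omega0 * α)).read = (stateEquiv B (.inl 2),
        ((f.run X α 0 0).1, true, true), .stay) := by
    rw [hs]
    simp [program, cfg, Program.Config.read, flat_zero, hα, instr]
  refine ⟨⟨?_, fun β hβ => ?_⟩, ?_⟩
  · rw [f.program.config_succ, Program.Config.step, hi]
    exact f.stateEquiv_halt
  · rcases (lt_add_one_iff.1 hβ).lt_or_eq with hβ | rfl
    · exact f.state_ne_halt_of_lt hX h hβ
    · rw [hs, ← f.stateEquiv_halt]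
      exact fun h => hs2 (Sum.inl_injective ((stateEquiv B).injective h))
  · rw [f.program.config_succ, Program.Config.step, hi, hs]
    funext c
    by_cases hc : c = 0 <;> simp [cfg, ofNat, hc]

/-- The machine halts if and only if the flag of the automaton is raised at some stage, and then
its output is `1`. -/
theorem yields_iff (hX : flat X = fun c => (z c, false)) (y : Cantor) :
    f.program.Yields z y ↔ (∃ α, (f.run X α 0 0).2 = true) ∧ y = ofNat 1 := by
  by_cases H : ∃ α, (f.run X α 0 0).2 = true
  · obtain ⟨α, hα, hmin⟩ := WellFounded.has_min (wellFounded_lt (α := Ordinal.{0}))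
      {α | (f.run X α 0 0).2 = true} H
    obtain ⟨h1, h2⟩ := f.haltsAt_of_first hX
      (fun β hβ => by simpa using fun h => hmin β h hβ) hα
    constructor
    · rintro ⟨β, h3, rfl⟩
      obtain rfl := h1.unique h3
      exact ⟨H, h2⟩
    · rintro ⟨-, rfl⟩
      exact ⟨_, h1, h2⟩
  · refine ⟨?_, fun h => absurd h.1 H⟩
    rintro ⟨T, ⟨h1, -⟩, -⟩
    -- Every stage `T` lies below the beginning of some sweep, because `T < T + 1 ≤ ω · (T + 1)`.
    refine absurd h1 (f.state_ne_halt_of_lt hX (α := T + 1) (fun β _ => ?_) ?_)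
    · simpa using fun h => H ⟨β, h⟩
    · exact (lt_add_one T).trans_le (isNormal_omega0_mul.strictMono.le_apply)

end Rule

/-! ### Rules on tracks, with the input as a stream -/

/-- A local rule on finitely many tracks, with access to two bits of a stream. -/
abbrev TrackRule (T : Type) : Type :=
  Bool → Bool × Bool → (T → Bool) → (T → Bool) → (T → Bool) → (T → Bool) → T → Bool

/-- The sequence `Y` is the transfinite run of the rule, with the stream bits `r`. -/
structure TrackRule.IsRun {T : Type} (ρ : TrackRule T) (r : Ordinal.{0} → Bool × Bool)
    (Y : Ordinal.{0} → ℕ → T → Bool) : Prop where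
  zero : ∀ i t, Y 0 i t = false
  succ : ∀ α i, Y (α + 1) i =
    ρ (decide (i = 0)) (r α) (Y α 0) (Y α (i - 1)) (Y α i) (Y α (i + 1))
  limit : ∀ l, IsSuccLimit l → ∀ i t, Y l i t = true ↔ Recurs l fun β => Y β i t

/-- Every rule on tracks is carried out by a machine; in each step the stream, which is initially
the input, moves on by `c ≤ 2` bits. -/
theorem TrackRule.exists_program {T : Type} [Finite T] (hT : 2 ≤ Nat.card T) (t₀ : T)
    (ρ : TrackRule T) (c : ℕ) (hc : c ≤ 2) :
    ∃ P : Program, ∀ z : Cantor, ∃ r Y, ρ.IsRun r Y ∧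
      (∀ n : ℕ, r n = (z (c * n), z (c * n + 1))) ∧
      ∀ y, P.Yields z y ↔ (∃ α, Y α 0 t₀ = true) ∧ y = ofNat 1 := by
  obtain ⟨B, hB⟩ : ∃ B, B = Nat.card T := ⟨_, rfl⟩
  rw [← hB] at hT
  have : NeZero B := ⟨by omega⟩
  have hB0 : 0 < B := by omega
  -- The track `t₀` must sit on the scratch cell `0` of its block, where the machine looks for the
  -- flag.
  obtain ⟨e, he⟩ : ∃ e : T ≃ Fin B, e t₀ = 0 := by
    obtain ⟨e⟩ : Nonempty (T ≃ Fin B) := ⟨hB ▸ Finite.equivFin T⟩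
    exact ⟨e.trans (Equiv.swap (e t₀) 0), by simp⟩
  -- The scratch bits of a block are the tracks. The input bits are shifted to the left by `c` cells
  -- in each step; as `c ≤ 2 ≤ B`, they come from the block itself or its right neighbour. The
  -- remainder modulo `B` changes nothing and only bounds the index.
  let f : Rule B := fun b X0 P M N j =>
    (if h : (j : ℕ) + c < B then (M ⟨j + c, h⟩).1 else (N ⟨(j + c - B) % B, Nat.mod_lt _ hB0⟩).1,
      ρ b ((X0 0).1, (X0 ⟨1, by omega⟩).1) (fun t => (X0 (e t)).2) (fun t => (P (e t)).2)
        (fun t => (M (e t)).2) (fun t => (N (e t)).2) (e.symm j))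
  refine ⟨f.program, fun z => ?_⟩
  let X : ℕ → Blk B := fun i j => (z (i * B + j), false)
  have hX : Rule.flat X = fun c => (z c, false) := by
    funext c
    simp [Rule.flat, X, Nat.div_add_mod']
  -- Only finite stages are described: at limits the shifted stream has an uncontrolled limsup, so
  -- it must have been stored elsewhere by then.
  have hraw : ∀ (n : ℕ) i j, (f.run X n i j).1 = z (i * B + j + c * n) := fun n => by
    induction n with
    | zero => simp [Rule.run_zero, X]
    | succ n ih =>
      intro i j
      rw [Nat.cast_succ, Rule.run_succ]
      simp only [Rule.step, f]
      split_ifs with h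
      · rw [ih]; congr 1; simp only []; ring
      · rw [ih]; congr 1
        have : ((j : ℕ) + c - B) % B = j + c - B := Nat.mod_eq_of_lt (by omega)
        simp only [this]
        rw [add_mul, mul_add]
        omega
  refine ⟨fun α => ((f.run X α 0 0).1, (f.run X α 0 ⟨1, by omega⟩).1),
    fun α i t => (f.run X α i (e t)).2, ⟨fun i t => ?_, fun α i => ?_, fun l hl i t => ?_⟩,
    fun n => ?_, fun y => ?_⟩
  · simp [Rule.run_zero, X]
  · funext t
    simp [Rule.run_succ, Rule.step, f]
  · simp [f.run_limit X hl]
  · simp [hraw, add_comm]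
  · rw [f.yields_iff hX]; simp only [he]

/-! ### The universal automaton -/

/-- The tracks of the universal automaton: a flag for halting, two alternating ticks (both of them
are `1` exactly at limits), flags for the phases of the computation, the mark of the simulated
head, the stacks, a stack with the initial content, the simulated tapes, a signal that takes the
symbols under the simulated head to the first block, and the control state. -/
inductive Track (K G S : Type) : Type
  | flag
  | tick (v : Bool)
  | loaded
  | dead
  | seen
  | mark
  | stk (k : K) (g : G)
  | bak (g : G)
  | tape (j : Fin 3)
  | sig (s : Symbols)
  | ctl (c : S)

/-- What the control does with the stacks. -/
inductive StackOp (K G : Type) : Type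
  | keep
  | push (k : K) (g : G)
  | pop (k : K)

/-- What the control does with the simulated tapes and the simulated head. -/
inductive TapeOp : Type
  | keep
  | write (j : Fin 3) (v : Bool)
  | left
  | right
  | launch
  | halt
  deriving DecidableEq

/-- The effect of an operation on the simulated tapes when the simulated head is at `h`. -/
@[simp]
def TapeOp.tapes (T : Fin 3 → Cantor) (h : ℕ) : TapeOp → Fin 3 → Cantor
  | .write j v => Function.update T j (Function.update (T j) h v)
  | _ => T

/-- The effect of an operation on the position of the simulated head. -/
@[simp]
def TapeOp.head (h : ℕ) : TapeOp → ℕ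
  | .left => h - 1
  | .right => h + 1
  | _ => h

/-- A finite control with stacks: in each step it sees the tops of the stacks and the signal that
has arrived, if any. -/
structure Controller (K G S : Type) : Type where
  act : S → (K → Option G) → Option Symbols → S × StackOp K G × TapeOp
  /-- the control state when the input has been loaded -/
  first : S
  /-- the control state at limits -/
  next : S
  /-- the stack that is filled from the back-up -/
  main : K
  /-- the symbol for a bit `1` of the part of the input that is loaded on the stack -/
  one : G
  /-- the symbol that ends the part of the input that is loaded on the stack -/
  sep : G

namespace Track

variable {K G S : Type}

instance [Finite K] [Finite G] [Finite S] : Finite (Track K G S) :=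
  Finite.of_injective (β := Fin 5 ⊕ Bool ⊕ (K × G) ⊕ G ⊕ Fin 3 ⊕ Symbols ⊕ S)
    (fun
      | flag => .inl 0
      | loaded => .inl 1
      | dead => .inl 2
      | seen => .inl 3
      | mark => .inl 4
      | tick v => .inr (.inl v)
      | stk k g => .inr (.inr (.inl (k, g)))
      | bak g => .inr (.inr (.inr (.inl g)))
      | tape j => .inr (.inr (.inr (.inr (.inl j))))
      | sig s => .inr (.inr (.inr (.inr (.inr (.inl s)))))
      | ctl c => .inr (.inr (.inr (.inr (.inr (.inr c))))))
    (fun a b => by cases a <;> cases b <;> simp)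

theorem two_le_card [Finite K] [Finite G] [Finite S] : 2 ≤ Nat.card (Track K G S) := by
  have : Nontrivial (Track K G S) := ⟨flag, loaded, by simp⟩
  exact Finite.one_lt_card

end Track

open Classical in
/-- The argument at which `b` is `1`, if there is one. -/
noncomputable def oneHot {α : Type*} (b : α → Bool) : Option α :=
  if h : ∃ a, b a = true then some h.choose else none

theorem oneHot_eq {α : Type*} {b : α → Bool} {o : Option α} (h : ∀ a, b a = true ↔ o = some a) :
    oneHot b = o := by
  rcases o with _ | a
  · rw [oneHot, dif_neg]
    rintro ⟨a, ha⟩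
    simpa using (h a).1 ha
  · have h' : ∃ a, b a = true := ⟨a, (h a).2 rfl⟩
    rw [oneHot, dif_pos h', (h _).1 h'.choose_spec]

namespace Controller

variable {K G S : Type} [DecidableEq K] [DecidableEq G] [DecidableEq S]

/-- The block `b` of a dead configuration. -/
def deadRow (b : Bool) : Track K G S → Bool
  | .dead => b
  | _ => false

variable (A : Controller K G S)

/-- A block of a new simulation from the control state `s`, with the tapes as they are. -/
def startRow (s : S) (b : Bool) (M : Track K G S → Bool) : Track K G S → Bool
  | .tick v => b && !v
  | .loaded => b
  | .mark => b
  | .stk k g => decide (k = A.main) && M (.bak g)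
  | .bak g => M (.bak g)
  | .tape j => M (.tape j)
  | .ctl c => b && decide (c = s)
  | _ => false

/-- The new ticks. -/
def tickRow (b : Bool) (C : Track K G S → Bool) (v : Bool) : Bool :=
  b && (C (.tick false) == v)

/-- The new content of a block when the bits `e` and `x` are loaded. -/
def loadRow (b e x : Bool) (C P M : Track K G S → Bool) : Track K G S → Bool
  | .tick v => tickRow b C v
  | .seen => b && (C .seen || !e)
  | .mark => M .mark || b || P .mark
  | .bak g => M (.bak g) || ((!M .mark && (b || P .mark)) &&
      ((e && decide (g = A.one)) || (!e && !C .seen && decide (g = A.sep))))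
  | .tape j => M (.tape j) || ((!M .mark && (b || P .mark)) && (decide (j = 0) && x))
  | _ => false

/-- The new content of a block when the control goes to the state `s` and carries out the given
operations. -/
def runRow (s : S) (sp : StackOp K G) (tp : TapeOp) (b : Bool) (C P M N : Track K G S → Bool) :
    Track K G S → Bool
  | .flag => b && decide (tp = .halt)
  | .tick v => tickRow b C v
  | .loaded => b
  | .dead => false
  | .seen => false
  | .mark => match tp with
    | .left => N .mark || (b && M .mark)
    | .right => !b && P .mark
    | _ => M .mark
  | .stk k g => match sp with
    | .keep => M (.stk k g)
    | .push k' g' =>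
      if k = k' then (if b then decide (g' = g) else P (.stk k g)) else M (.stk k g)
    | .pop k' => if k = k' then N (.stk k g) else M (.stk k g)
  | .bak g => M (.bak g)
  | .tape j => match tp with
    | .write j' v => if M .mark && decide (j = j') then v else M (.tape j)
    | _ => M (.tape j)
  | .sig a => if tp = .launch then
      M .mark && decide ((M (.tape 0), M (.tape 1), M (.tape 2)) = a) else N (.sig a)
  | .ctl c => b && decide (c = s)

/-- What the control does, given the content of the first block. -/
noncomputable def decideOp (C : Track K G S → Bool) : Option (S × StackOp K G × TapeOp) :=
  (oneHot fun c => C (.ctl c)).map fun c =>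
    A.act c (fun k => oneHot fun g => C (.stk k g)) (oneHot fun a => C (.sig a))

/-- The rule of the universal automaton. If `bold`, then the bits of the stream are alternately
loaded on the stack and on the simulated input tape, and otherwise they are all loaded on the stack.
If `neg`, then halting with a `1` on the first cell of the simulated output tape does not count. -/
noncomputable def rule (bold neg : Bool) : TrackRule (Track K G S) := fun b r C P M N =>
  if C .dead then deadRow b
  else if C (.tick false) && C (.tick true) then
    if C .loaded then A.startRow A.next b M
    else if C .seen then A.startRow A.first b M
    -- All bits loaded before stage `ω` were ones, so the stream is not a numeral.
    else deadRow b
  else if C .loaded then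
    match A.decideOp C with
    | none => deadRow b
    | some (s, sp, tp) =>
      if decide (tp = .halt) && neg && C (.tape 2) then deadRow b
      else runRow s sp tp b C P M N
  -- A `1` after a `0`: the stream is not a numeral.
  else if r.1 && C .seen then deadRow b
  else A.loadRow b r.1 (bold && r.2) C P M

/-- A configuration of the simulation. -/
structure St (K G S : Type) : Type where
  ctl : S
  par : Bool
  stk : K → List G
  bak : List G
  tape : Fin 3 → Cantor
  head : ℕ
  sig : Option (ℕ × Symbols)

/-- The tracks that show a configuration of the simulation. -/
def St.enc (c : St K G S) (i : ℕ) : Track K G S → Bool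
  | .flag => false
  | .tick v => decide (i = 0) && (c.par == v)
  | .loaded => decide (i = 0)
  | .dead => false
  | .seen => false
  | .mark => decide (i = c.head)
  | .stk k g => decide ((c.stk k)[i]? = some g)
  | .bak g => decide (c.bak[i]? = some g)
  | .tape j => c.tape j i
  | .sig s => decide (c.sig = some (i, s))
  | .ctl s => decide (i = 0) && decide (s = c.ctl)

/-- The effect of an operation on the stacks. -/
def _root_.ITTM.StackOp.apply (T : K → List G) : StackOp K G → K → List G
  | .keep => T
  | .push k g => Function.update T k (g :: T k)
  | .pop k => Function.update T k (T k).tail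

/-- The next control state and the operations that are carried out. -/
def St.op (c : St K G S) : S × StackOp K G × TapeOp :=
  A.act c.ctl (fun k => (c.stk k).head?) (c.sig.bind fun a => if a.1 = 0 then some a.2 else none)

/-- One step of the simulation. -/
def St.next (c : St K G S) : St K G S where
  ctl := (c.op A).1
  par := !c.par
  stk := (c.op A).2.1.apply c.stk
  bak := c.bak
  tape := (c.op A).2.2.tapes c.tape c.head
  head := (c.op A).2.2.head c.head
  sig := if (c.op A).2.2 = .launch then
      some (c.head, c.tape 0 c.head, c.tape 1 c.head, c.tape 2 c.head)
    else c.sig.bind fun a => if a.1 = 0 then none else some (a.1 - 1, a.2)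

theorem decideOp_enc (c : St K G S) : A.decideOp (c.enc 0) = some (c.op A) := by
  have h1 : (oneHot fun s => c.enc 0 (.ctl s)) = some c.ctl :=
    oneHot_eq fun s => by simp [St.enc, eq_comm]
  have h2 : ∀ k, (oneHot fun g => c.enc 0 (.stk k g)) = (c.stk k).head? := fun k =>
    oneHot_eq fun g => by simp [St.enc, List.head?_eq_getElem?]
  have h3 : (oneHot fun a => c.enc 0 (.sig a)) =
      c.sig.bind fun a => if a.1 = 0 then some a.2 else none :=
    oneHot_eq fun a => by
      rcases h : c.sig with _ | ⟨i, s⟩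
      · simp [St.enc, h]
      · simp only [St.enc, h, decide_eq_true_eq, Option.some.injEq, Prod.mk.injEq, Option.bind_some]
        split_ifs with hi <;> simp [hi]
  simp [decideOp, h1, h2, h3, St.op]

variable {r : Ordinal.{0} → Bool × Bool} {Y : Ordinal.{0} → ℕ → Track K G S → Bool}
  {bold neg : Bool}

/-- Every operation is local once the first block has announced it: a push or pop shifts a stack by
one block, a head move shifts the mark, a write happens where the mark is, and the signal travels
one block to the left. The announcement needs no time, as every block sees the first one. -/
theorem run_next (hY : (A.rule bold neg).IsRun r Y) {α : Ordinal.{0}} {c : St K G S}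
    (hc : Y α = c.enc) (h : (c.op A).2.2 ≠ .halt) : Y (α + 1) = (c.next A).enc := by
  funext i
  rw [hY.succ, hc, rule]
  have h1 : c.enc 0 .dead = false := rfl
  have h2 : (c.enc 0 (.tick false) && c.enc 0 (.tick true)) = false := by
    cases h : c.par <;> simp [St.enc, h]
  have h3 : c.enc 0 .loaded = true := rfl
  simp only [h1, h2, h3, A.decideOp_enc, h, decide_false, Bool.false_and, if_true, if_false,
    Bool.false_eq_true]
  rcases hop : c.op A with ⟨s, sp, tp⟩
  rw [hop] at h
  funext t
  cases t with
  | flag => simpa [runRow, St.enc] using fun _ => h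
  | tick v =>
    cases hp : c.par <;> cases v <;> simp [runRow, tickRow, St.enc, St.next, hp]
  | loaded => rfl
  | dead => rfl
  | seen => rfl
  | mark =>
    rcases tp with _ | _ | _ | _ | _ | _
    · simp [runRow, St.enc, St.next, hop]
    · simp [runRow, St.enc, St.next, hop]
    · simp only [runRow, St.enc, St.next, hop, TapeOp.head]
      rw [Bool.eq_iff_iff]; simp; omega
    · simp only [runRow, St.enc, St.next, hop, TapeOp.head]
      rw [Bool.eq_iff_iff]; simp; omega
    · simp [runRow, St.enc, St.next, hop]
    · exact absurd rfl h
  | stk k g =>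
    rcases sp with _ | ⟨k', g'⟩ | k'
    · simp [runRow, St.enc, St.next, hop, StackOp.apply]
    · by_cases hk : k = k'
      · subst hk
        rcases i with _ | i <;> simp [runRow, St.enc, St.next, hop, StackOp.apply]
      · simp [runRow, St.enc, St.next, hop, StackOp.apply, hk]
    · by_cases hk : k = k'
      · subst hk
        simp [runRow, St.enc, St.next, hop, StackOp.apply]
      · simp [runRow, St.enc, St.next, hop, StackOp.apply, hk]
  | bak g => rfl
  | tape j =>
    rcases tp with _ | ⟨j', v⟩ | _ | _ | _ | _ <;> try simp [runRow, St.enc, St.next, hop]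
    by_cases hj : j = j'
    · subst hj
      by_cases hi : i = c.head <;> simp [hi]
    · simp [hj]
  | sig a =>
    by_cases hl : tp = .launch
    · subst hl
      simp only [runRow, St.enc, St.next, hop, if_true]
      rw [Bool.eq_iff_iff]
      simp only [Bool.and_eq_true, decide_eq_true_eq, Option.some.injEq, Prod.mk.injEq]
      constructor
      · rintro ⟨rfl, h⟩; exact ⟨rfl, of_decide_eq_true h⟩
      · rintro ⟨rfl, rfl⟩; exact ⟨rfl, decide_eq_true rfl⟩
    · simp only [runRow, St.enc, St.next, hop, hl, if_false]
      rw [Bool.eq_iff_iff]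
      rcases hs : c.sig with _ | ⟨_ | n, s⟩ <;> simp
  | ctl s' => simp [runRow, St.enc, St.next, hop]

theorem run_halt (hY : (A.rule bold neg).IsRun r Y) {α : Ordinal.{0}} {c : St K G S}
    (hc : Y α = c.enc) (h : (c.op A).2.2 = .halt) (hneg : (neg && c.tape 2 0) = false) :
    Y (α + 1) 0 .flag = true := by
  rw [hY.succ, hc, rule]
  have h1 : c.enc 0 .dead = false := rfl
  have h2 : (c.enc 0 (.tick false) && c.enc 0 (.tick true)) = false := by
    cases h : c.par <;> simp [St.enc, h]
  have h3 : c.enc 0 .loaded = true := rfl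
  have h4 : c.enc 0 (.tape 2) = c.tape 2 0 := rfl
  simp [h1, h2, h3, h4, A.decideOp_enc, h, hneg, runRow]

theorem run_neg (hY : (A.rule bold neg).IsRun r Y) {α : Ordinal.{0}} {c : St K G S}
    (hc : Y α = c.enc) (h : (c.op A).2.2 = .halt) (hneg : (neg && c.tape 2 0) = true) :
    Y (α + 1) = fun i => deadRow (decide (i = 0)) := by
  funext i
  rw [hY.succ, hc, rule]
  have h1 : c.enc 0 .dead = false := rfl
  have h2 : (c.enc 0 (.tick false) && c.enc 0 (.tick true)) = false := by
    cases h : c.par <;> simp [St.enc, h]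
  have h3 : c.enc 0 .loaded = true := rfl
  have h4 : c.enc 0 (.tape 2) = c.tape 2 0 := rfl
  simp [h1, h2, h3, h4, A.decideOp_enc, h, hneg]

/-- The dead configuration is a fixed point of the rule and, being constant, of limits too. Its flag
is down, so rejection is permanent. -/
theorem run_dead (hY : (A.rule bold neg).IsRun r Y) {α β : Ordinal.{0}}
    (hα : Y α = fun i => deadRow (decide (i = 0))) (hβ : α ≤ β) :
    Y β = fun i => deadRow (decide (i = 0)) := by
  induction β using Ordinal.limitRecOn with
  | zero => obtain rfl : α = 0 := le_antisymm hβ (bot_le); exact hα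
  | add_one β ih =>
    rcases hβ.eq_or_lt with rfl | hβ
    · exact hα
    · funext i
      rw [hY.succ, ih (lt_add_one_iff.1 hβ), rule]
      simp [deadRow]
  | limit l hl ih =>
    rcases hβ.eq_or_lt with rfl | hβ
    · exact hα
    · funext i t
      classical
      have := decide_recurs_of_eventually (b := fun β => Y β i t)
        (v := deadRow (decide (i = 0)) t) hβ fun γ h1 h2 => by rw [ih γ h2 h1]
      rw [← this, Bool.eq_iff_iff, hY.limit l hl, decide_eq_true_eq]

/-- Transfer of finite runs of the simulation. -/
theorem run_iterate (hY : (A.rule bold neg).IsRun r Y) {α : Ordinal.{0}} {c : St K G S}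
    (hc : Y α = c.enc) (n : ℕ) (h : ∀ m < n, (((St.next A)^[m] c).op A).2.2 ≠ .halt) :
    Y (α + n) = ((St.next A)^[n] c).enc := by
  induction n with
  | zero => simpa using hc
  | succ n ih =>
    rw [Nat.cast_succ, ← add_assoc, Function.iterate_succ_apply']
    exact A.run_next hY (ih fun m hm => h m (by omega)) (h n (by omega))

end Controller

/-! ### Loading the input during the first `ω` stages -/

namespace Controller

variable {K G S : Type} [DecidableEq K] [DecidableEq G] [DecidableEq S] (A : Controller K G S)

variable {r : Ordinal.{0} → Bool × Bool} {Y : Ordinal.{0} → ℕ → Track K G S → Bool}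
  {bold neg : Bool}

/-- A new simulation from the control state `s`, with the content `L` of the main stack. -/
def fresh (s : S) (L : List G) (T : Fin 3 → Cantor) : St K G S where
  ctl := s
  par := false
  stk := Function.update (fun _ => []) A.main L
  bak := L
  tape := T
  head := 0
  sig := none

/-- Only the back-up and the tapes have to be known. The other tracks may show anything, which is
what makes a restart at limits possible. -/
theorem startRow_eq {X : ℕ → Track K G S → Bool} {s : S} {L : List G} {T : Fin 3 → Cantor}
    (hb : ∀ i g, X i (.bak g) = decide (L[i]? = some g)) (ht : ∀ i j, X i (.tape j) = T j i)
    (i : ℕ) : A.startRow s (decide (i = 0)) (X i) = (A.fresh s L T).enc i := by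
  funext t
  cases t with
  | flag => rfl
  | tick v => cases v <;> simp [startRow, St.enc, fresh]
  | loaded => rfl
  | dead => rfl
  | seen => rfl
  | mark => rfl
  | stk k g =>
    by_cases hk : k = A.main
    · subst hk; simp [startRow, St.enc, fresh, hb]
    · simp [startRow, St.enc, fresh, hk]
  | bak g => exact hb i g
  | tape j => simp [startRow, St.enc, fresh, ht]
  | sig a => simp [startRow, St.enc, fresh]
  | ctl c => rfl

/-- The tracks when `t` of the bits `e` and `x` have been loaded. -/
def loadEnc (e x : ℕ → Bool) (t i : ℕ) : Track K G S → Bool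
  | .tick v => decide (i = 0) && (decide (t ≠ 0) && (decide (t % 2 = 0) == v))
  | .seen => decide (i = 0) && decide (∃ k < t, e k = false)
  | .mark => decide (i < t)
  | .bak g => decide (i < t) && ((e i && decide (g = A.one)) ||
      (!e i && decide (∀ j < i, e j = true) && decide (g = A.sep)))
  | .tape j => decide (i < t) && (decide (j = 0) && x i)
  | _ => false

section

variable {e x : ℕ → Bool} (hr : ∀ n : ℕ, (r n).1 = e n ∧ (bold && (r n).2) = x n)

include hr

/-- The mark grows by one block per stage and so carries the stage number; the newly marked block
stores the current bits. The hypothesis excludes a `1` after a `0` among the first `t` bits, hence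
an early death. -/
theorem run_load (hY : (A.rule bold neg).IsRun r Y) (t : ℕ)
    (h : ∀ k < t, e k = true → ∀ j < k, e j = true) : Y t = A.loadEnc e x t := by
  induction t with
  | zero =>
    funext i a
    rw [Nat.cast_zero, hY.zero]
    cases a <;> simp [loadEnc]
  | succ t ih =>
    have ih := ih fun k hk => h k (by omega)
    funext i
    rw [Nat.cast_succ, hY.succ, ih, rule]
    have h1 : A.loadEnc e x t 0 .dead = false := rfl
    have h2 : (A.loadEnc e x t 0 (.tick false) && A.loadEnc e x t 0 (.tick true)) = false := by
      by_cases ht : t % 2 = 0 <;> simp [loadEnc, ht]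
    have h3 : A.loadEnc e x t 0 .loaded = false := rfl
    have h4 : A.loadEnc e x t 0 .seen = decide (∃ k < t, e k = false) := by simp [loadEnc]
    have h5 : (e t && decide (∃ k < t, e k = false)) = false := by
      rw [Bool.eq_false_iff]
      simp only [ne_eq, Bool.and_eq_true, decide_eq_true_eq, not_and]
      rintro he ⟨k, hk, hk'⟩
      simp [h t (by omega) he k hk] at hk'
    -- Block `t` is the only unmarked block that is the first one or has a marked left neighbour.
    have here : (!decide (i < t) && (decide (i = 0) || decide (i - 1 < t))) = decide (i = t) := by
      rw [Bool.eq_iff_iff]; simp; omega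
    have lt_succ : decide (i < t + 1) = (decide (i < t) || decide (i = t)) := by
      rw [Bool.eq_iff_iff]; simp; omega
    simp only [h1, h2, h3, h4, h5, (hr t).1, (hr t).2, Bool.false_eq_true, if_false]
    funext a
    cases a with
    | tick v =>
      by_cases h0 : t = 0
      · subst h0; cases v <;> simp [loadRow, tickRow, loadEnc]
      · by_cases ht : t % 2 = 0
        · have : (t + 1) % 2 = 1 := by omega
          cases v <;> simp [loadRow, tickRow, loadEnc, h0, ht, this]
        · have : (t + 1) % 2 = 0 := by omega
          cases v <;> simp [loadRow, tickRow, loadEnc, h0, ht, this]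
    | seen =>
      by_cases hi : i = 0
      · simp only [loadRow, loadEnc, hi, decide_true, Bool.true_and]
        rw [Bool.eq_iff_iff]
        simp only [Bool.or_eq_true, decide_eq_true_eq, Bool.not_eq_true']
        constructor
        · rintro (⟨k, hk, hk'⟩ | h)
          · exact ⟨k, by omega, hk'⟩
          · exact ⟨t, by omega, h⟩
        · rintro ⟨k, hk, hk'⟩
          rcases Nat.lt_succ_iff_lt_or_eq.1 hk with hk | rfl
          · exact .inl ⟨k, hk, hk'⟩
          · exact .inr hk'
      · simp [loadRow, loadEnc, hi]
    | mark =>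
      simp only [loadRow, loadEnc]
      rw [Bool.eq_iff_iff]; simp; omega
    | bak g =>
      simp only [loadRow, loadEnc, here, lt_succ]
      by_cases hi : i = t
      · subst hi
        have : decide (∀ j < i, e j = true) = !decide (∃ k < i, e k = false) := by
          rw [Bool.eq_iff_iff]; simp
        simp [this]
      · simp [hi]
    | tape j =>
      simp only [loadRow, loadEnc, here, lt_succ]
      by_cases hi : i = t
      · subst hi; simp
      · simp [hi]
    | _ => rfl

/-- Up to the first `1` that follows a `0` the loading is normal and the flag is down; one stage
later the automaton is dead. -/
theorem run_load_violation (hY : (A.rule bold neg).IsRun r Y)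
    (h : ∃ t, e t = true ∧ ∃ j < t, e j = false) (α : Ordinal.{0}) : Y α 0 .flag = false := by
  classical
  obtain ⟨h1, h2⟩ := Nat.find_spec h
  have hlt : ∀ k < Nat.find h, e k = true → ∀ j < k, e j = true := fun k hk he j hj => by
    by_contra hc
    exact Nat.find_min h hk ⟨he, j, hj, by simpa using hc⟩
  have hdead : Y ((Nat.find h : ℕ) + 1) = fun i => deadRow (decide (i = 0)) := by
    funext i
    rw [hY.succ, A.run_load hr hY _ hlt, rule]
    set t := Nat.find h
    have h1' : A.loadEnc e x t 0 .dead = false := rfl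
    have h2' : (A.loadEnc e x t 0 (.tick false) && A.loadEnc e x t 0 (.tick true)) = false := by
      by_cases ht : t % 2 = 0 <;> simp [loadEnc, ht]
    have h3' : A.loadEnc e x t 0 .loaded = false := rfl
    have h4' : A.loadEnc e x t 0 .seen = true := by simpa [loadEnc] using h2
    simp [h1', h2', h3', h4', (hr t).1, h1]
  rcases le_or_gt (((Nat.find h : ℕ) : Ordinal.{0}) + 1) α with hα | hα
  · rw [A.run_dead hY hdead hα]; rfl
  · have hα := lt_add_one_iff.1 hα
    obtain ⟨n, rfl⟩ := Ordinal.lt_omega0.1 (hα.trans_lt (Ordinal.natCast_lt_omega0 _))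
    have hn : n ≤ Nat.find h := by exact_mod_cast hα
    rw [A.run_load hr hY n fun k hk => hlt k (by omega)]
    rfl

/-- The tracks at stage `ω`. -/
theorem run_load_omega0 (hY : (A.rule bold neg).IsRun r Y)
    (h : ∀ k, e k = true → ∀ j < k, e j = true) :
    Y Ordinal.omega0 0 .flag = false ∧ Y Ordinal.omega0 0 .dead = false ∧
      Y Ordinal.omega0 0 .loaded = false ∧ (∀ v, Y Ordinal.omega0 0 (.tick v) = true) ∧
      (Y Ordinal.omega0 0 .seen = true ↔ ∃ k, e k = false) ∧
      (∀ i g, Y Ordinal.omega0 i (.bak g) = ((e i && decide (g = A.one)) ||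
        (!e i && decide (∀ j < i, e j = true) && decide (g = A.sep)))) ∧
      ∀ i j, Y Ordinal.omega0 i (.tape j) = (decide (j = 0) && x i) := by
  classical
  have hY' : ∀ t : ℕ, Y t = A.loadEnc e x t := fun t => A.run_load hr hY t fun k _ => h k
  have ev : ∀ (i : ℕ) (a : Track K G S) (v : Bool) (N : ℕ),
      (∀ t ≥ N, A.loadEnc e x t i a = v) → Y Ordinal.omega0 i a = v := fun i a v N hN => by
    rw [← decide_recurs_of_eventually (b := fun β => Y β i a) (v := v)
      (Ordinal.natCast_lt_omega0 N), Bool.eq_iff_iff, hY.limit _ Ordinal.isSuccLimit_omega0,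
      decide_eq_true_eq]
    intro γ h1 h2
    obtain ⟨t, rfl⟩ := Ordinal.lt_omega0.1 h2
    rw [hY' t]
    exact hN t (by exact_mod_cast h1)
  refine ⟨ev _ _ _ 0 fun _ _ => rfl, ev _ _ _ 0 fun _ _ => rfl, ev _ _ _ 0 fun _ _ => rfl,
    fun v => ?_, ?_, fun i g => ev _ _ _ (i + 1) fun t ht => ?_,
    fun i j => ev _ _ _ (i + 1) fun t ht => ?_⟩
  · rw [hY.limit _ Ordinal.isSuccLimit_omega0]
    intro β hβ
    obtain ⟨t, rfl⟩ := Ordinal.lt_omega0.1 hβ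
    -- During loading one tick is up at odd stages and the other at positive even ones.
    refine ⟨((2 * t + (if v then 2 else 1) : ℕ) : Ordinal.{0}), Ordinal.natCast_lt_omega0 _,
      Nat.cast_le.2 (by omega), ?_⟩
    simp only [hY']
    cases v
    · have : (2 * t + 1) % 2 = 1 := by omega
      simp [loadEnc, this]
    · simp [loadEnc]
  · by_cases hk : ∃ k, e k = false
    · obtain ⟨k, hk⟩ := hk
      rw [ev 0 .seen true (k + 1)]
      · simpa using ⟨k, hk⟩
      · intro t ht
        simpa [loadEnc] using ⟨k, by omega, hk⟩
    · rw [ev 0 .seen false 0]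
      · simpa using hk
      · intro t _
        simp only [loadEnc, decide_true, Bool.true_and, decide_eq_false_iff_not]
        exact fun ⟨k, _, h⟩ => hk ⟨k, h⟩
  · have : i < t := by omega
    simp [loadEnc, this]
  · have : i < t := by omega
    simp [loadEnc, this]

theorem run_load_ones (hY : (A.rule bold neg).IsRun r Y)
    (h : ∀ k, e k = true) (α : Ordinal.{0}) : Y α 0 .flag = false := by
  obtain ⟨h1, h2, h3, h4, h5, -⟩ := A.run_load_omega0 hr hY fun _ _ j _ => h j
  have hdead : Y (Ordinal.omega0 + 1) = fun i => deadRow (decide (i = 0)) := by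
    funext i
    have h5 : Y Ordinal.omega0 0 .seen = false := by
      rw [Bool.eq_false_iff, ne_eq, h5]
      simp [h]
    rw [hY.succ, rule]
    simp [h2, h3, h4, h5]
  rcases le_or_gt (Ordinal.omega0 + 1) α with hα | hα
  · rw [A.run_dead hY hdead hα]; rfl
  · rcases (lt_add_one_iff.1 hα).eq_or_lt with rfl | hα
    · exact h1
    · obtain ⟨n, rfl⟩ := Ordinal.lt_omega0.1 hα
      rw [A.run_load hr hY n fun _ _ _ j _ => h j]
      rfl

/-- The `n` ones are stored in the blocks below `n`, the first zero leaves the separator in block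
`n`, and later zeros store nothing on the back-up, so that it holds a finite word. -/
theorem run_load_ofNat (hY : (A.rule bold neg).IsRun r Y) {n : ℕ} (h : e = ofNat n) :
    (∀ α ≤ Ordinal.omega0, Y α 0 .flag = false) ∧
      Y (Ordinal.omega0 + 1) = (A.fresh A.first (List.replicate n A.one ++ [A.sep])
        (fun j => if j = 0 then x else ofNat 0)).enc := by
  have hmono : ∀ k, e k = true → ∀ j < k, e j = true := by
    intro k hk j hj
    simp only [h, ofNat, decide_eq_true_eq] at hk ⊢
    omega
  obtain ⟨h1, h2, h3, h4, h5, h6, h7⟩ := A.run_load_omega0 hr hY hmono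
  refine ⟨fun α hα => ?_, ?_⟩
  · rcases hα.eq_or_lt with rfl | hα
    · exact h1
    · obtain ⟨t, rfl⟩ := Ordinal.lt_omega0.1 hα
      rw [A.run_load hr hY t fun k _ => hmono k]
      rfl
  · funext i
    have h5 : Y Ordinal.omega0 0 .seen = true := h5.2 ⟨n, by simp [h, ofNat]⟩
    rw [hY.succ, rule]
    simp only [h2, h3, h4, h5, Bool.and_self, if_true, if_false, Bool.false_eq_true]
    refine A.startRow_eq (fun i g => ?_) (fun i j => ?_) i
    · rw [h6]
      rcases lt_trichotomy i n with hi | rfl | hi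
      · simp [h, ofNat, hi, List.getElem?_append, eq_comm]
      · have : ∀ j < i, e j = true := by simp [h, ofNat]
        simp [h, ofNat, eq_comm]
      · have h8 : ¬ ∀ j < i, e j = true := fun H => by
          simpa [h, ofNat] using H n hi
        have h9 : ¬ i < n := by omega
        have h10 : e i = false := by simp [h, ofNat, h9]
        have h11 : (List.replicate n A.one ++ [A.sep])[i]? = none := by
          rw [List.getElem?_eq_none_iff]; simp; omega
        rw [h10, h11]
        simp only [Bool.false_and, Bool.false_or, Bool.not_false, Bool.true_and]
        rw [decide_eq_false h8]; simp
    · rw [h7]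
      by_cases hj : j = 0 <;> simp [hj, ofNat]

end

end Controller

/-! ### Simulation of a program through all ordinal stages -/

/-- There is a normal function with given finite increments. -/
theorem exists_isNormal (T₀ : Ordinal.{0}) (h : Ordinal.{0} → Ordinal.{0} → ℕ)
    (hpos : ∀ α T, 0 < h α T) :
    ∃ τ : Ordinal.{0} → Ordinal.{0}, IsNormal τ ∧ τ 0 = T₀ ∧
      ∀ α, τ (α + 1) = τ α + (h α (τ α) : ℕ) := by
  let τ : Ordinal.{0} → Ordinal.{0} := fun α => Ordinal.limitRecOn α T₀
    (fun α T => T + (h α T : ℕ)) fun l _ f => ⨆ β : Set.Iio l, f β β.2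
  have hs : ∀ α, τ (α + 1) = τ α + (h α (τ α) : ℕ) := fun α => Ordinal.limitRecOn_add_one ..
  have hl : ∀ l, IsSuccLimit l → τ l = ⨆ β : Set.Iio l, τ β := fun l hl =>
    Ordinal.limitRecOn_limit _ _ _ _ hl
  refine ⟨τ, IsNormal.of_succ_lt (fun α => ?_) fun {l} h => ?_, Ordinal.limitRecOn_zero .., hs⟩
  · rw [succ_eq_add_one, hs]
    exact lt_add_of_pos_right _ (by exact_mod_cast hpos _ _)
  · rw [hl l h, Set.image_eq_range]
    have : Nonempty (Set.Iio l) := ⟨⟨0, h.bot_lt⟩⟩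
    exact isLUB_ciSup (Ordinal.bddAbove_of_small)

namespace Program

/-- The three tapes of a configuration. -/
def Config.tapes {p : Program} (c : p.Config) : Fin 3 → Cantor := ![c.input, c.scratch, c.output]

/-- The program halts on the given input; if `neg`, then with a `0` on the first cell of the output
tape. -/
def Accepts (p : Program) (neg : Bool) (x : Cantor) : Prop :=
  ∃ α, p.HaltsAt x α ∧ (neg && (p.config x α).output 0) = false

open Classical in
theorem tapes_config_limit (p : Program) (x : Cantor) {l : Ordinal.{0}} (hl : IsSuccLimit l)
    (j : Fin 3) (i : ℕ) : (p.config x l).tapes j i =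
      decide (Recurs l fun β => (p.config x β).tapes j i) := by
  rw [p.config_limit x l hl]
  fin_cases j
  · exact limsupTape_apply l (fun β => (p.config x β).input) i
  · exact limsupTape_apply l (fun β => (p.config x β).scratch) i
  · exact limsupTape_apply l (fun β => (p.config x β).output) i

theorem config_limit_state (p : Program) (x : Cantor) {l : Ordinal.{0}} (hl : IsSuccLimit l) :
    (p.config x l).state = p.limit := by
  rw [p.config_limit x l hl]; rfl

theorem config_limit_head (p : Program) (x : Cantor) {l : Ordinal.{0}} (hl : IsSuccLimit l) :
    (p.config x l).head = 0 := by
  rw [p.config_limit x l hl]; rfl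

theorem halt_ne_start (p : Program) : p.start ≠ p.halt := by simp [start, halt]

theorem halt_ne_limit (p : Program) : p.limit ≠ p.halt := by simp [limit, halt]

/-- The halt state is reached at a successor stage. -/
theorem HaltsAt.exists_add_one {p : Program} {x : Cantor} {α : Ordinal.{0}} (h : p.HaltsAt x α) :
    ∃ β, α = β + 1 := by
  induction α using Ordinal.limitRecOn with
  | zero =>
    have := h.1
    rw [config_zero] at this
    exact absurd this p.halt_ne_start
  | add_one β => exact ⟨β, rfl⟩
  | limit l hl =>
    have := h.1
    rw [p.config_limit_state x hl] at this
    exact absurd this p.halt_ne_limit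

end Program

namespace Controller

variable {K G S : Type} [DecidableEq K] [DecidableEq G] [DecidableEq S] (A : Controller K G S)

/-- The invariant while the controller simulates the step from `c` to `c'`. -/
def StepInv {p : Program} (L : List G) (c c' : p.Config) (t : St K G S) : Prop :=
  (t.op A).2.2 ≠ .halt ∧ t.bak = L ∧
    ∀ j i, t.tape j i = c.tapes j i ∨ t.tape j i = c'.tapes j i

/-- The controller simulates the program `p` when `L` is on the back-up stack. -/
structure Simulates (p : Program) (L : List G) where
  /-- the configurations of the controller that represent a configuration of the program -/
  Ready : p.Config → St K G S → Prop
  first : ∀ c : p.Config, c.state = p.start → c.head = 0 →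
    ∃ n t, Reach (St.next A) (A.StepInv L c c) n (A.fresh A.first L c.tapes) t ∧ Ready c t
  next : ∀ c : p.Config, c.state = p.limit → c.head = 0 →
    ∃ n t, Reach (St.next A) (A.StepInv L c c) n (A.fresh A.next L c.tapes) t ∧ Ready c t
  tape : ∀ (c : p.Config) (t : St K G S), Ready c t → t.tape = c.tapes
  step : ∀ (c : p.Config) (t : St K G S), Ready c t → c.step.state ≠ p.halt →
    ∃ n t', Reach (St.next A) (A.StepInv L c c.step) (n + 1) t t' ∧ Ready c.step t'
  halt : ∀ (c : p.Config) (t : St K G S), Ready c t → c.step.state = p.halt →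
    ∃ n t', (∀ m < n, (((St.next A)^[m] t).op A).2.2 ≠ .halt) ∧ (St.next A)^[n] t = t' ∧
      (t'.op A).2.2 = .halt ∧ t'.tape = c.step.tapes

variable {r : Ordinal.{0} → Bool × Bool} {Y : Ordinal.{0} → ℕ → Track K G S → Bool}
  {bold neg : Bool}

/-- No assumption is made on the ticks at `T`, which may be a limit: one successor step makes them
complementary. By `run_tick_next` they alternate from then on, so each recurs below the next limit.
-/
theorem run_tick_not (hY : (A.rule bold neg).IsRun r Y) {T : Ordinal.{0}}
    (h1 : Y T 0 .dead = false) (h2 : Y T 0 .loaded = true) (h3 : Y (T + 1) 0 .dead = false) :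
    Y (T + 1) 0 (.tick true) = !Y (T + 1) 0 (.tick false) := by
  rw [hY.succ, rule] at h3 ⊢
  simp only [h1, h2, if_true, Bool.false_eq_true, if_false] at h3 ⊢
  split_ifs at h3 ⊢ with h4
  · simp [startRow]
  · rcases h5 : A.decideOp (Y T 0) with _ | ⟨s, sp, tp⟩
    · simp [h5, deadRow] at h3
    · simp only [h5] at h3 ⊢
      split_ifs at h3 ⊢ with h6
      · simp [deadRow] at h3
      · simp [runRow, tickRow]

theorem run_tick_next (hY : (A.rule bold neg).IsRun r Y) {T : Ordinal.{0}}
    (h1 : Y T 0 .dead = false) (h2 : Y T 0 .loaded = true) (h3 : Y (T + 1) 0 .dead = false)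
    (h4 : Y T 0 (.tick true) = !Y T 0 (.tick false)) (v : Bool) :
    Y (T + 1) 0 (.tick v) = (Y T 0 (.tick false) == v) := by
  rw [hY.succ, rule] at h3 ⊢
  simp only [h1, h2, h4, if_true, Bool.false_eq_true, if_false, Bool.and_not_self] at h3 ⊢
  rcases h5 : A.decideOp (Y T 0) with _ | ⟨s, sp, tp⟩
  · simp [h5, deadRow] at h3
  · simp only [h5] at h3 ⊢
    split_ifs at h3 ⊢ with h6
    · simp [deadRow] at h3
    · simp [runRow, tickRow]

/-- At limits both ticks are `1`. -/
theorem run_tick_limit (hY : (A.rule bold neg).IsRun r Y) {l T₀ : Ordinal.{0}}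
    (hl : IsSuccLimit l) (h0 : T₀ < l)
    (h : ∀ T, T₀ ≤ T → T < l → Y T 0 .dead = false ∧ Y T 0 .loaded = true) (v : Bool) :
    Y l 0 (.tick v) = true := by
  rw [hY.limit l hl]
  intro β hβ
  set T := max β T₀ with hT
  have hTl : T < l := max_lt hβ h0
  have hT1 : T + 1 < l := hl.add_one_lt hTl
  have hT2 : T + 1 + 1 < l := hl.add_one_lt hT1
  have hle : T ≤ T + 1 := (lt_add_one T).le
  have hle' : T + 1 ≤ T + 1 + 1 := (lt_add_one (T + 1)).le
  have g0 := h T (le_max_right _ _) hTl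
  have g1 := h (T + 1) ((le_max_right _ _).trans hle) hT1
  have g2 := h (T + 1 + 1) ((le_max_right _ _).trans (hle.trans hle')) hT2
  have a := A.run_tick_not hY g0.1 g0.2 g1.1
  have b := A.run_tick_next hY g1.1 g1.2 g2.1 a v
  -- Each tick is up at `T + 1` or at `T + 2`.
  by_cases hv : Y (T + 1) 0 (.tick v) = true
  · exact ⟨T + 1, hT1, (le_max_left _ _).trans hle, hv⟩
  · refine ⟨T + 1 + 1, hT2, (le_max_left _ _).trans (hle.trans hle'), ?_⟩
    simp only [b]
    cases v <;> simp_all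

section

variable (Y) (p : Program) (x : Cantor) (L : List G)

/-- The state of the automaton at stage `T`, which belongs to the simulation of the step from stage
`α` to stage `α'`. -/
structure TrackInv (α α' T : Ordinal.{0}) : Prop where
  flag : Y T 0 .flag = false
  dead : Y T 0 .dead = false
  loaded : Y T 0 .loaded = true
  bak : ∀ i g, Y T i (.bak g) = decide (L[i]? = some g)
  tape : ∀ j i, Y T i (.tape j) = (p.config x α).tapes j i ∨
    Y T i (.tape j) = (p.config x α').tapes j i

variable {p L}

/-- From stage `T` on, the automaton gets ready to simulate the program from stage `α` on. -/
def Starts (R : A.Simulates p L) (α T : Ordinal.{0}) : Prop :=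
  ∃ k : ℕ, (∀ m ≤ k, TrackInv Y p x L α α (T + (m : ℕ))) ∧
    ∃ t, Y (T + (k : ℕ)) = t.enc ∧ R.Ready (p.config x α) t

variable {Y x}

theorem StepInv.trackInv {A : Controller K G S} {α α' T : Ordinal.{0}} {t : St K G S}
    (h : A.StepInv L (p.config x α) (p.config x α') t) (ht : Y T = t.enc) :
    TrackInv Y p x L α α' T := by
  constructor
  · rw [ht]; rfl
  · rw [ht]; rfl
  · rw [ht]; rfl
  · intro i g; rw [ht, ← h.2.1]; rfl
  · intro j i; rw [ht]; exact h.2.2 j i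

theorem reach_transfer (hY : (A.rule bold neg).IsRun r Y) {α α' T : Ordinal.{0}} {n : ℕ}
    {t t' : St K G S} (h : Reach (St.next A) (A.StepInv L (p.config x α) (p.config x α')) n t t')
    (ht : Y T = t.enc) :
    Y (T + n) = t'.enc ∧ ∀ m ≤ n, TrackInv Y p x L α α' (T + (m : ℕ)) := by
  have : ∀ m ≤ n, Y (T + (m : ℕ)) = ((St.next A)^[m] t).enc := fun m hm =>
    A.run_iterate hY ht m fun k hk => (h.2 k (by omega)).1
  exact ⟨by rw [this n le_rfl, h.1], fun m hm => (h.2 m hm).trackInv (this m hm)⟩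

variable {A} {R : A.Simulates p L}

/-- The time for getting ready is charged to the step itself, so the next simulated stage begins in
a ready configuration. -/
theorem Starts.step (hY : (A.rule bold neg).IsRun r Y) {α T : Ordinal.{0}}
    (h : A.Starts Y x R α T) (hα : (p.config x (α + 1)).state ≠ p.halt) :
    ∃ n : ℕ, 0 < n ∧ (∀ m < n, TrackInv Y p x L α (α + 1) (T + (m : ℕ))) ∧
      A.Starts Y x R (α + 1) (T + (n : ℕ)) := by
  obtain ⟨k, h1, t, h2, h3⟩ := h
  rw [p.config_succ] at hα
  obtain ⟨n, t', h4, h5⟩ := R.step _ t h3 hα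
  rw [← p.config_succ] at h4 h5
  obtain ⟨h6, h7⟩ := A.reach_transfer hY h4 h2
  rw [add_assoc, ← Nat.cast_add] at h6
  refine ⟨k + (n + 1), by omega, fun m hm => ?_, 0, fun m hm => ?_, t', by simpa using h6, h5⟩
  · rcases Nat.lt_or_ge m k with hk | hk
    · have := h1 m hk.le
      exact ⟨this.flag, this.dead, this.loaded, this.bak, fun j i => .inl ((this.tape j i).elim id id)⟩
    · obtain ⟨d, rfl⟩ := Nat.exists_eq_add_of_le hk
      have := h7 d (by omega)
      rwa [add_assoc, ← Nat.cast_add] at this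
  · obtain rfl := Nat.le_zero.1 hm
    rw [Nat.cast_zero, add_zero]
    have h8 := h7 (n + 1) le_rfl
    rw [add_assoc, ← Nat.cast_add] at h8
    refine ⟨h8.flag, h8.dead, h8.loaded, h8.bak, fun j i => .inl ?_⟩
    rw [h6, ← R.tape _ _ h5]
    rfl

/-- The automaton gets ready at the beginning and at limits. -/
theorem starts_of_fresh (hY : (A.rule bold neg).IsRun r Y) {α T : Ordinal.{0}} {s : S}
    (hT : Y (T + 1) = (A.fresh s L (p.config x α).tapes).enc)
    (h : ∃ n t, Reach (St.next A) (A.StepInv L (p.config x α) (p.config x α)) n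
      (A.fresh s L (p.config x α).tapes) t ∧ R.Ready (p.config x α) t) :
    A.Starts Y x R α (T + 1) := by
  obtain ⟨n, t, h1, h2⟩ := h
  obtain ⟨h3, h4⟩ := A.reach_transfer hY h1 hT
  exact ⟨n, h4, t, h3, h2⟩

/-- The tapes at `τ l` are right by `recurs_normal_iff`; the flag, the death mark, the load mark and
the back-up are constant below `τ l`. Both ticks are up, so the rule starts a fresh simulation, and
no other track matters. -/
theorem Starts.of_limit (hY : (A.rule bold neg).IsRun r Y) {l : Ordinal.{0}}
    (hl : IsSuccLimit l) {τ : Ordinal.{0} → Ordinal.{0}} (hτ : IsNormal τ)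
    (h1 : ∀ β < l, TrackInv Y p x L β β (τ β))
    (h2 : ∀ β < l, ∀ T, τ β ≤ T → T < τ (β + 1) → TrackInv Y p x L β (β + 1) T) :
    A.Starts Y x R l (τ l) := by
  classical
  have inv : ∀ T, τ 0 ≤ T → T < τ l → ∃ β < l, TrackInv Y p x L β (β + 1) T := fun T h3 h4 => by
    obtain ⟨β, -, h5, h6, h7⟩ := exists_interval hτ h3 h4
    exact ⟨β, h5, h2 β h5 T h6 h7⟩
  have hl' : IsSuccLimit (τ l) := hτ.map_isSuccLimit hl
  have h0 : τ 0 < τ l := hτ.strictMono hl.bot_lt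
  have const : ∀ i (a : Track K G S) v, (∀ β T, TrackInv Y p x L β (β + 1) T → Y T i a = v) →
      Y (τ l) i a = v := fun i a v h => by
    rw [← decide_recurs_of_eventually (b := fun β => Y β i a) (v := v) h0 fun T h3 h4 =>
      let ⟨β, _, h5⟩ := inv T h3 h4; h β T h5,
      Bool.eq_iff_iff, hY.limit _ hl', decide_eq_true_eq]
  have hflag := const 0 .flag false fun _ _ h => h.flag
  have hdead := const 0 .dead false fun _ _ h => h.dead
  have hloaded := const 0 .loaded true fun _ _ h => h.loaded
  have hbak : ∀ i g, Y (τ l) i (.bak g) = decide (L[i]? = some g) := fun i g =>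
    const i (.bak g) _ fun _ _ h => h.bak i g
  have htape : ∀ j i, Y (τ l) i (.tape j) = (p.config x l).tapes j i := fun j i => by
    rw [p.tapes_config_limit x hl, Bool.eq_iff_iff, hY.limit _ hl', decide_eq_true_eq]
    exact recurs_normal_iff hτ hl (fun β hβ => ((h1 β hβ).tape j i).elim id id)
      fun β hβ T h3 h4 => (h2 β hβ T h3 h4).tape j i
  have htick := A.run_tick_limit hY hl' h0 fun T h3 h4 =>
    let ⟨β, _, h5⟩ := inv T h3 h4; ⟨h5.dead, h5.loaded⟩
  have hnext : Y (τ l + 1) = (A.fresh A.next L (p.config x l).tapes).enc := by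
    funext i
    rw [hY.succ, rule]
    simp only [hdead, htick, hloaded, Bool.and_self, if_true, if_false, Bool.false_eq_true]
    exact A.startRow_eq (fun i g => hbak i g) (fun i j => htape j i) i
  obtain ⟨k, h3, t, h4, h5⟩ := starts_of_fresh hY (R := R) hnext
    (R.next _ (p.config_limit_state x hl) (p.config_limit_head x hl))
  -- The extra stage is `τ l` itself. Allowing a delay in `Starts` lets `τ` be continuous although
  -- the fresh configuration appears only at `τ l + 1`.
  refine ⟨1 + k, fun m hm => ?_, t, ?_, h5⟩
  · rcases m with _ | m
    · rw [Nat.cast_zero, add_zero]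
      exact ⟨hflag, hdead, hloaded, hbak, fun j i => .inl (htape j i)⟩
    · have := h3 m (by omega)
      rwa [add_assoc, ← Nat.cast_one, ← Nat.cast_add, add_comm 1 m] at this
  · rwa [Nat.cast_add, Nat.cast_one, ← add_assoc]

theorem Starts.trackInv {α T : Ordinal.{0}} (h : A.Starts Y x R α T) :
    TrackInv Y p x L α α T := by
  obtain ⟨k, h1, -⟩ := h
  simpa using h1 0 (Nat.zero_le k)

/-- As long as the program has not halted, the automaton simulates it. -/
theorem exists_schedule (hY : (A.rule bold neg).IsRun r Y) (R : A.Simulates p L)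
    {T₀ : Ordinal.{0}}
    (h0 : Y (T₀ + 1) = (A.fresh A.first L (p.initial x).tapes).enc) :
    ∃ τ : Ordinal.{0} → Ordinal.{0}, IsNormal τ ∧ τ 0 = T₀ + 1 ∧
      ∀ α, (∀ β ≤ α, (p.config x β).state ≠ p.halt) → A.Starts Y x R α (τ α) ∧
        ∀ T, T₀ + 1 ≤ T → T ≤ τ α → Y T 0 .flag = false := by
  classical
  let P : Ordinal.{0} → Ordinal.{0} → ℕ → Prop := fun α T n =>
    0 < n ∧ (∀ m < n, TrackInv Y p x L α (α + 1) (T + (m : ℕ))) ∧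
      A.Starts Y x R (α + 1) (T + (n : ℕ))
  obtain ⟨τ, hτ, hτ0, hτs⟩ := exists_isNormal (T₀ + 1)
    -- The increment `1` is a filler for stages that the claim does not cover, such as those after
    -- halting.
    (fun α T => if h : ∃ n, P α T n then h.choose else 1) fun α T => by
      split_ifs with h
      · exact h.choose_spec.1
      · exact one_pos
  have hP : ∀ α, A.Starts Y x R α (τ α) → (p.config x (α + 1)).state ≠ p.halt →
      A.Starts Y x R (α + 1) (τ (α + 1)) ∧
        ∀ T, τ α ≤ T → T < τ (α + 1) → TrackInv Y p x L α (α + 1) T := fun α h1 h2 => by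
    have h3 : ∃ n, P α (τ α) n := h1.step hY h2
    have h4 := h3.choose_spec
    have h5 := hτs α
    rw [dif_pos h3] at h5
    rw [h5]
    refine ⟨h4.2.2, fun T h6 h7 => ?_⟩
    obtain ⟨n, h8, rfl⟩ := exists_nat_of_lt_add_nat h6 h7
    exact h4.2.1 n h8
  have starts : ∀ α, (∀ β ≤ α, (p.config x β).state ≠ p.halt) →
      A.Starts Y x R α (τ α) := fun α => by
    induction α using Ordinal.limitRecOn with
    | zero =>
      intro _
      rw [hτ0]
      refine starts_of_fresh hY (s := A.first) ?_ ?_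
      · rw [p.config_zero]; exact h0
      · rw [p.config_zero]; exact R.first _ rfl rfl
    | add_one α ih =>
      intro h
      exact (hP α (ih fun β hβ => h β (hβ.trans (lt_add_one α).le)) (h _ le_rfl)).1
    | limit l hl ih =>
      intro h
      have ih : ∀ β < l, A.Starts Y x R β (τ β) := fun β hβ =>
        ih β hβ fun γ hγ => h γ (hγ.trans hβ.le)
      exact .of_limit hY hl hτ (fun β hβ => (ih β hβ).trackInv)
        fun β hβ => (hP β (ih β hβ) (h _ (hl.add_one_lt hβ).le)).2
  refine ⟨τ, hτ, hτ0, fun α h => ⟨starts α h, fun T h1 h2 => ?_⟩⟩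
  rcases h2.eq_or_lt with rfl | h2
  · exact (starts α h).trackInv.flag
  · rw [← hτ0] at h1
    obtain ⟨β, -, h5, h6, h7⟩ := exists_interval hτ h1 h2
    exact ((hP β (starts β fun γ hγ => h γ (hγ.trans h5.le)) (h _ (add_one_le_iff.2 h5))).2
      T h6 h7).flag

/-- The automaton halts if and only if the simulated program does. -/
theorem flag_iff_accepts (hY : (A.rule bold neg).IsRun r Y) (R : A.Simulates p L)
    {T₀ : Ordinal.{0}} (hT₀ : ∀ T ≤ T₀, Y T 0 .flag = false)
    (h0 : Y (T₀ + 1) = (A.fresh A.first L (p.initial x).tapes).enc) :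
    (∃ T, Y T 0 .flag = true) ↔ p.Accepts neg x := by
  obtain ⟨τ, hτ, hτ0, hS⟩ := exists_schedule hY R h0
  have early : ∀ α, (∀ β ≤ α, (p.config x β).state ≠ p.halt) → ∀ T ≤ τ α,
      Y T 0 .flag = false := fun α h T hT => by
    rcases le_or_gt (T₀ + 1) T with h1 | h1
    · exact (hS α h).2 T h1 hT
    · exact hT₀ T (lt_add_one_iff.1 h1)
  by_cases H : p.Halts x
  · obtain ⟨α, hα⟩ := H
    obtain ⟨β, rfl⟩ := hα.exists_add_one
    have hβ : ∀ γ ≤ β, (p.config x γ).state ≠ p.halt := fun γ hγ =>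
      hα.2 γ (lt_add_one_iff.2 hγ)
    obtain ⟨k, h1, t, h2, h3⟩ := (hS β hβ).1
    have hstate := hα.1
    rw [p.config_succ] at hstate
    obtain ⟨n, t', h4, h5, h6, h7⟩ := R.halt _ t h3 hstate
    rw [← p.config_succ] at h7
    have h8 := A.run_iterate hY h2 n h4
    rw [h5] at h8
    have hout : t'.tape 2 0 = (p.config x (β + 1)).output 0 := by rw [h7]; rfl
    have hacc : p.Accepts neg x ↔ (neg && (p.config x (β + 1)).output 0) = false :=
      ⟨fun ⟨γ, h9, h10⟩ => hα.unique h9 ▸ h10, fun h => ⟨_, hα, h⟩⟩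
    rw [hacc, ← hout]
    constructor
    · rintro ⟨T, hT⟩
      by_contra hneg
      rw [Bool.not_eq_false] at hneg
      -- From here on the flag stays down. The stages before lie below `τ β`, among the `k` stages
      -- of getting ready, or among the `n` stages of the last simulated step, and the flag is down
      -- in all three cases.
      have hdead := A.run_neg hY h8 h6 hneg
      rcases le_or_gt (τ β + k + n + 1) T with h9 | h9
      · rw [A.run_dead hY hdead h9] at hT
        simp [deadRow] at hT
      · have h9 := lt_add_one_iff.1 h9
        rcases le_or_gt (τ β) T with h10 | h10
        · obtain ⟨m, hm, rfl⟩ := exists_nat_of_lt_add_nat (m := k + n + 1) h10 (by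
            rw [Nat.cast_add, Nat.cast_add, ← add_assoc, ← add_assoc, Nat.cast_one]
            exact lt_add_one_iff.2 h9)
          rcases Nat.lt_or_ge m k with hk | hk
          · rw [(h1 m hk.le).flag] at hT
            simp at hT
          · obtain ⟨d, rfl⟩ := Nat.exists_eq_add_of_le hk
            rw [Nat.cast_add, ← add_assoc,
              A.run_iterate hY h2 d fun i hi => h4 i (by omega)] at hT
            simp [St.enc] at hT
        · rw [early β hβ T h10.le] at hT
          simp at hT
    · intro hneg
      exact ⟨_, A.run_halt hY h8 h6 hneg⟩
  · have hne : ∀ α, (p.config x α).state ≠ p.halt := fun α h => by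
      obtain ⟨β, h1, h2⟩ := WellFounded.has_min (wellFounded_lt (α := Ordinal.{0}))
        {β | (p.config x β).state = p.halt} ⟨α, h⟩
      exact H ⟨β, h1, fun γ hγ hs => h2 γ hs hγ⟩
    refine ⟨fun ⟨T, hT⟩ => ?_, fun ⟨α, h, _⟩ => absurd ⟨α, h⟩ H⟩
    rw [early T (fun β _ => hne β) T hτ.strictMono.le_apply] at hT
    simp at hT

end

end Controller

end ITTM

/-! ### The universal control, a stack machine that evaluates a code -/

namespace ITTM

open Order Turing Turing.PartrecToTM2 Turing.ToPartrec

/-- The control states of the universal automaton: it writes a word on the main stack and then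
either sends the simulated symbols on their way or starts the code; it waits for the symbols; it
executes a statement; or it carries out one of the six operations that the result of the code
describes. -/
inductive Ctl : Type
  | words (w : List Γ') (b : Bool)
  | launch
  | wait
  | exec (q : TM2.Stmt (fun _ : K' => Γ') Λ' (Option Γ')) (v : Option Γ')
  | pop (j : Fin 6)

namespace Ctl

variable (U : Code)

/-- A binary digit. -/
def digit (b : Bool) : Γ' := bif b then .bit1 else .bit0

/-- The operation described by the bit `b` at the position `j`. -/
def tapeOp : Fin 6 → Bool → TapeOp
  | 0, b => .write 0 b
  | 1, b => .write 1 b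
  | 2, b => .write 2 b
  | 3, b => bif b then .left else .keep
  | 4, b => bif b then .right else .keep
  | 5, b => bif b then .halt else .keep

/-- The instructions of the control. -/
def act : Ctl → (K' → Option Γ') → Option Symbols → Ctl × StackOp K' Γ' × TapeOp
  | words (g :: w) b, _, _ => (words w b, .push .main g, .keep)
  | words [] true, _, _ => (exec (tr (trNormal U .halt)) none, .keep, .keep)
  | words [] false, _, _ => (launch, .keep, .keep)
  | launch, _, _ => (wait, .keep, .launch)
  | wait, _, none => (wait, .keep, .keep)
  | wait, _, some s => (words [digit s.1, digit s.2.1, digit s.2.2] true, .keep, .keep)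
  | exec (.push k f q) v, _, _ => (exec q v, .push k (f v), .keep)
  | exec (.peek k f q) v, T, _ => (exec q (f v (T k)), .keep, .keep)
  | exec (.pop k f q) v, T, _ => (exec q (f v (T k)), .pop k, .keep)
  | exec (.load f q) v, _, _ => (exec q (f v), .keep, .keep)
  | exec (.branch f q₁ q₂) v, _, _ => (exec (cond (f v) q₁ q₂) v, .keep, .keep)
  | exec (.goto f) v, _, _ => (exec (tr (f v)) v, .keep, .keep)
  | exec .halt _, _, _ => (pop 0, .keep, .keep)
  | pop j, T, _ => (if h : (j : ℕ) < 5 then pop ⟨j + 1, by omega⟩ else launch, .pop .main,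
      tapeOp j (T .main == some .bit1))

/-- The labels that are used. -/
def labels : Finset Λ' := codeSupp U .halt

theorem start_mem_labels : trNormal U .halt ∈ labels U :=
  codeSupp_self U .halt (trStmts₁_self _)

/-- The control states that are used. -/
def Used : Ctl → Prop
  | words w _ => w.length ≤ 3
  | exec q _ => ∃ l ∈ labels U, q ∈ TM2.stmts₁ (tr l)
  | _ => True

theorem used_exec_tr {l : Λ'} (h : l ∈ labels U) (v : Option Γ') : Used U (exec (tr l) v) :=
  ⟨l, h, TM2.stmts₁_self⟩

theorem Used.exec_of_mem {q q' : TM2.Stmt (fun _ : K' => Γ') Λ' (Option Γ')} {v v' : Option Γ'}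
    (h : Used U (exec q v)) (hq : q' ∈ TM2.stmts₁ q) : Used U (exec q' v') := by
  obtain ⟨l, h1, h2⟩ := h
  exact ⟨l, h1, TM2.stmts₁_trans h2 hq⟩

/-- The type of control states that are used. -/
abbrev State : Type := {c : Ctl // Used U c}

/-- `Ctl` is infinite, but the compiled code has finitely many labels, each with finitely many
substatements, and the words to be pushed have length at most three. -/
instance : Finite (State U) := by
  classical
  have : Finite {w : List Γ' // w.length ≤ 3} := (List.finite_length_le Γ' 3).to_subtype
  let F := (labels U).biUnion fun l => TM2.stmts₁ (tr l)
  let g : State U → ({w : List Γ' // w.length ≤ 3} × Bool) ⊕ Bool ⊕ (F × Option Γ') ⊕ Fin 6 := fun c =>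
    match c with
    | ⟨words w b, h⟩ => .inl (⟨w, h⟩, b)
    | ⟨launch, _⟩ => .inr (.inl true)
    | ⟨wait, _⟩ => .inr (.inl false)
    | ⟨exec q v, h⟩ => .inr (.inr (.inl (⟨q, Finset.mem_biUnion.2 h⟩, v)))
    | ⟨pop j, _⟩ => .inr (.inr (.inr j))
  refine Finite.of_injective g ?_
  rintro ⟨_ | _ | _ | _ | _, h1⟩ ⟨_ | _ | _ | _ | _, h2⟩ h <;> simp_all [g]
  exact congrArg Subtype.val h.1

open Classical in
/-- A control state that is used; the others do not matter. -/
noncomputable def toState (c : Ctl) : State U :=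
  if h : Used U c then ⟨c, h⟩ else ⟨launch, trivial⟩

theorem toState_val {c : Ctl} (h : Used U c) : (toState U c).1 = c := by
  rw [toState, dif_pos h]

/-- The control of the universal automaton. -/
noncomputable def ctrl : Controller K' Γ' (State U) where
  act s T a := ((act U s.1 T a).map (toState U) id)
  -- Pushing reverses a word. A state `q` is stored as the binary numeral of `q + 1`, lowest digit
  -- on top: `1` for the start state and, in the next field, `2` for the limit state.
  first := toState U (words [.cons, .bit1] false)
  next := toState U (words [.cons, .bit1, .bit0] false)
  main := .main
  one := .bit1
  sep := .cons

noncomputable instance : DecidableEq (State U) := Classical.decEq _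

theorem tapeOp_ne_halt {j : Fin 6} {b : Bool} (h : j ≠ 5 ∨ b = false) : tapeOp j b ≠ .halt := by
  fin_cases j <;> cases b <;> simp_all [tapeOp]

theorem act_ne_halt {c : Ctl} (h : c ≠ pop 5) (T : K' → Option Γ') (a : Option Symbols) :
    (act U c T a).2.2 ≠ .halt := by
  match c, a with
  | words (g :: w) b, _ => simp [act]
  | words [] true, _ => simp [act]
  | words [] false, _ => simp [act]
  | launch, _ => simp [act]
  | wait, none => simp [act]
  | wait, some s => simp [act]
  | exec (.push k f q) v, _ => simp [act]
  | exec (.peek k f q) v, _ => simp [act]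
  | exec (.pop k f q) v, _ => simp [act]
  | exec (.load f q) v, _ => simp [act]
  | exec (.branch f q₁ q₂) v, _ => simp [act]
  | exec (.goto f) v, _ => simp [act]
  | exec .halt _, _ => simp [act]
  | pop j, _ => exact tapeOp_ne_halt (.inl fun e => h (e ▸ rfl))

/-- A configuration of the simulation with the universal control. -/
noncomputable def conf (L : List Γ') (T : Fin 3 → Cantor) (h : ℕ) (c : Ctl) (par : Bool)
    (stk : K' → List Γ') (sig : Option (ℕ × Symbols)) : Controller.St K' Γ' (State U) :=
  ⟨toState U c, par, stk, L, T, h, sig⟩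

/-- The signal that arrives. -/
def arrived (sig : Option (ℕ × Symbols)) : Option Symbols :=
  sig.bind fun a => if a.1 = 0 then some a.2 else none

theorem op_conf {L : List Γ'} {T : Fin 3 → Cantor} {h : ℕ} {c : Ctl} (hc : Used U c) {par : Bool}
    {stk : K' → List Γ'} {sig : Option (ℕ × Symbols)} :
    (conf U L T h c par stk sig).op (ctrl U) =
      ((act U c (fun k => (stk k).head?) (arrived sig)).map (toState U) id) := by
  simp only [Controller.St.op, conf, ctrl, toState_val U hc, arrived]

theorem next_conf {L : List Γ'} {T T' : Fin 3 → Cantor} {h h' : ℕ} {c c' : Ctl} (hc : Used U c)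
    {par : Bool} {stk : K' → List Γ'} {sig : Option (ℕ × Symbols)} {sp : StackOp K' Γ'}
    {tp : TapeOp} (ha : act U c (fun k => (stk k).head?) (arrived sig) = (c', sp, tp))
    (hT : tp.tapes T h = T') (hh : tp.head h = h') (htp : tp ≠ .launch) :
    (conf U L T h c par stk sig).next (ctrl U) = conf U L T' h' c' (!par) (sp.apply stk)
      (sig.bind fun a => if a.1 = 0 then none else some (a.1 - 1, a.2)) := by
  have := op_conf U (L := L) (T := T) (h := h) (par := par) hc (stk := stk) (sig := sig)
  rw [ha] at this
  subst hT hh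
  simp only [Controller.St.next, this, Prod.map, id, htp, if_false]
  rfl

theorem next_launch {L : List Γ'} {T : Fin 3 → Cantor} {h : ℕ} {par : Bool}
    {stk : K' → List Γ'} {sig : Option (ℕ × Symbols)} :
    (conf U L T h launch par stk sig).next (ctrl U) =
      conf U L T h wait (!par) stk (some (h, T 0 h, T 1 h, T 2 h)) := by
  have := op_conf U (L := L) (T := T) (h := h) (par := par) (c := launch) trivial (stk := stk)
    (sig := sig)
  simp only [Controller.St.next, this, Prod.map, id, act, if_true]
  rfl

section

variable {U} {p : Program} {L : List Γ'} {a a' : p.Config}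

/-- Only the last of the six pops can issue the halting operation, and a control state outside
`Used` is replaced by `launch`, which does not halt. Everywhere else the invariant concerns only the
tapes. -/
theorem stepInv_conf {c : Ctl} (hc : c ≠ pop 5) {T : Fin 3 → Cantor}
    (hT : ∀ j i, T j i = a.tapes j i ∨ T j i = a'.tapes j i) (h : ℕ) (par : Bool)
    (stk : K' → List Γ') (sig : Option (ℕ × Symbols)) :
    (ctrl U).StepInv L a a' (conf U L T h c par stk sig) := by
  refine ⟨?_, rfl, hT⟩
  by_cases hu : Used U c
  · rw [op_conf U hu]
    exact act_ne_halt U hc _ _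
  · have : toState U c = toState U launch := by
      rw [toState, dif_neg hu, toState, dif_pos (c := Used U launch) trivial]
    have : conf U L T h c par stk sig = conf U L T h launch par stk sig := by
      rw [conf, this]; rfl
    rw [this, op_conf U (c := launch) trivial]
    simp [act]

/-- The controller gets from one configuration to another one while it simulates the step from `a`
to `a'`. -/
def Leads (U : Code) (L : List Γ') (a a' : p.Config) (T : Fin 3 → Cantor) (h : ℕ) (c : Ctl)
    (stk : K' → List Γ') (sig : Option (ℕ × Symbols)) (T' : Fin 3 → Cantor) (h' : ℕ) (c' : Ctl)
    (stk' : K' → List Γ') (sig' : Option (ℕ × Symbols)) : Prop :=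
  ∀ par, ∃ n par', Reach (Controller.St.next (ctrl U)) ((ctrl U).StepInv L a a') n
    (conf U L T h c par stk sig) (conf U L T' h' c' par' stk' sig')

variable {T T' T'' : Fin 3 → Cantor} {h h' h'' : ℕ} {c c' c'' : Ctl}
  {stk stk' stk'' : K' → List Γ'} {sig sig' sig'' : Option (ℕ × Symbols)}

theorem Leads.trans (h1 : Leads U L a a' T h c stk sig T' h' c' stk' sig')
    (h2 : Leads U L a a' T' h' c' stk' sig' T'' h'' c'' stk'' sig'') :
    Leads U L a a' T h c stk sig T'' h'' c'' stk'' sig'' := fun par => by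
  obtain ⟨n, par', h3⟩ := h1 par
  obtain ⟨m, par'', h4⟩ := h2 par'
  exact ⟨n + m, par'', h3.trans h4⟩

theorem Leads.refl (hc : c ≠ pop 5) (hT : ∀ j i, T j i = a.tapes j i ∨ T j i = a'.tapes j i) :
    Leads U L a a' T h c stk sig T h c stk sig := fun par =>
  ⟨0, par, .refl (stepInv_conf hc hT h par stk sig)⟩

theorem Leads.single {sp : StackOp K' Γ'} {tp : TapeOp} (hu : Used U c) (hc : c ≠ pop 5)
    (hc' : c' ≠ pop 5)
    (hI : ∀ j i, T j i = a.tapes j i ∨ T j i = a'.tapes j i)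
    (hI' : ∀ j i, T' j i = a.tapes j i ∨ T' j i = a'.tapes j i)
    (ha : act U c (fun k => (stk k).head?) (arrived sig) = (c', sp, tp))
    (hT : tp.tapes T h = T') (hh : tp.head h = h') (htp : tp ≠ .launch) :
    Leads U L a a' T h c stk sig T' h' c' (sp.apply stk)
      (sig.bind fun a => if a.1 = 0 then none else some (a.1 - 1, a.2)) := fun par =>
  ⟨1, !par, .single (next_conf U hu ha hT hh htp) (stepInv_conf hc hI _ _ _ _)
    (stepInv_conf hc' hI' _ _ _ _)⟩

/-- A step that changes nothing but the control state and the stacks. -/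
theorem Leads.keep {sp : StackOp K' Γ'} (hu : Used U c) (hc : c ≠ pop 5)
    (hc' : c' ≠ pop 5) (hI : ∀ j i, T j i = a.tapes j i ∨ T j i = a'.tapes j i)
    (ha : act U c (fun k => (stk k).head?) none = (c', sp, .keep)) :
    Leads U L a a' T h c stk none T h c' (sp.apply stk) none :=
  .single (sig := none) hu hc hc' hI hI ha rfl rfl (by simp)

theorem leads_words (hI : ∀ j i, T j i = a.tapes j i ∨ T j i = a'.tapes j i) (b : Bool)
    (w : List Γ') (hw : w.length ≤ 3) (m s₁ s₂ s₃ : List Γ') :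
    Leads U L a a' T h (words w b) (K'.elim m s₁ s₂ s₃) none T h
      (bif b then exec (tr (trNormal U .halt)) none else launch)
      (K'.elim (w.reverse ++ m) s₁ s₂ s₃) none := by
  induction w generalizing m with
  | nil =>
    cases b
    · exact .keep (c := words [] false) (c' := launch) (sp := .keep) hw (by simp) (by simp) hI rfl
    · exact .keep (c := words [] true) (c' := exec (tr (trNormal U .halt)) none) (sp := .keep) hw
        (by simp) (by simp) hI rfl
  | cons g w ih =>
    rw [List.length_cons] at hw
    refine .trans (.keep (sp := .push .main g) (c' := words w b) hw (by simp) (by simp) hI rfl) ?_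
    have := ih (by omega) (g :: m)
    simpa [StackOp.apply] using this

/-- Waiting costs one step per block between the simulated head and the first block, so the delay is
unbounded but always finite. -/
theorem leads_wait (hI : ∀ j i, T j i = a.tapes j i ∨ T j i = a'.tapes j i) (k : ℕ) (s : Symbols) :
    Leads U L a a' T h wait stk (some (k, s)) T h
      (words [digit s.1, digit s.2.1, digit s.2.2] true) stk none := by
  induction k with
  | zero =>
    exact .single (sig := some (0, s)) (sp := .keep) (tp := .keep) trivial (by simp) (by simp)
      hI hI rfl rfl rfl (by simp)
  | succ k ih =>
    refine .trans (.single (sig := some (k + 1, s)) (c' := wait) (sp := .keep) (tp := .keep)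
      trivial (by simp) (by simp) hI hI rfl rfl rfl (by simp)) ?_
    exact ih

/-- The control state that belongs to a configuration of the code. -/
def ofCfg (b : TM2.Cfg (fun _ : K' => Γ') Λ' (Option Γ')) : Ctl := b.l.elim (pop 0) fun l => exec (tr l) b.var

/-- The stack machine executes a whole statement at once, the control one constructor of it per
step; hence the induction on the statement. -/
theorem leads_stepAux (hI : ∀ j i, T j i = a.tapes j i ∨ T j i = a'.tapes j i)
    (q : TM2.Stmt (fun _ : K' => Γ') Λ' (Option Γ')) (v : Option Γ') (hq : Used U (exec q v)) :
    Leads U L a a' T h (exec q v) stk none T h (ofCfg (TM2.stepAux q v stk))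
      (TM2.stepAux q v stk).stk none := by
  induction q generalizing v stk with
  | push k f q ih =>
    exact .trans (.keep hq (by simp) (by simp) hI rfl) (ih (stk := Function.update stk k _) v
      (hq.exec_of_mem U (by simp [TM2.stmts₁, TM2.stmts₁_self])))
  | peek k f q ih =>
    exact .trans (.keep hq (by simp) (by simp) hI rfl) (ih (stk := stk) _
      (hq.exec_of_mem U (by simp [TM2.stmts₁, TM2.stmts₁_self])))
  | pop k f q ih =>
    exact .trans (.keep hq (by simp) (by simp) hI rfl) (ih (stk := Function.update stk k _) _
      (hq.exec_of_mem U (by simp [TM2.stmts₁, TM2.stmts₁_self])))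
  | load f q ih =>
    exact .trans (.keep hq (by simp) (by simp) hI rfl) (ih (stk := stk) _
      (hq.exec_of_mem U (by simp [TM2.stmts₁, TM2.stmts₁_self])))
  | branch f q₁ q₂ ih₁ ih₂ =>
    refine .trans (.keep hq (by simp) (by simp) hI rfl) ?_
    rw [TM2.stepAux]
    cases f v
    · exact ih₂ (stk := stk) _ (hq.exec_of_mem U (by simp [TM2.stmts₁, TM2.stmts₁_self]))
    · exact ih₁ (stk := stk) _ (hq.exec_of_mem U (by simp [TM2.stmts₁, TM2.stmts₁_self]))
  | goto f => exact .keep hq (by simp) (by simp) hI rfl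
  | halt => exact .keep hq (by simp) (by simp) hI rfl

theorem leads_reaches (hI : ∀ j i, T j i = a.tapes j i ∨ T j i = a'.tapes j i)
    {b b' : TM2.Cfg (fun _ : K' => Γ') Λ' (Option Γ')} (hb : b.l ∈ Finset.insertNone (labels U))
    (hr : StateTransition.Reaches (TM2.step tr) b b') :
    Leads U L a a' T h (ofCfg b) b.stk none T h (ofCfg b') b'.stk none ∧
      b'.l ∈ Finset.insertNone (labels U) := by
  induction hr with
  | refl => exact ⟨.refl (by rcases b with ⟨_ | _, _, _⟩ <;> simp [ofCfg]) hI, hb⟩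
  | @tail d e _ h1 ih =>
    obtain ⟨h2, h3⟩ := ih
    refine ⟨h2.trans ?_, @TM2.step_supports _ _ _ _ ⟨trNormal U .halt⟩ _ tr _
      (tr_supports U .halt) _ _ h1 h3⟩
    rcases d with ⟨_ | l, v, S⟩
    · exact nomatch (show (none : Option (TM2.Cfg (fun _ : K' => Γ') Λ' (Option Γ'))) = some e from h1)
    · have h3 : l ∈ labels U := by simpa using h3
      simp only [TM2.step, Option.mem_def, Option.some.injEq] at h1
      subst h1
      exact leads_stepAux hI (tr l) v (used_exec_tr U h3 v)

/-- Correctness of the compilation (`tr_eval`) supplies a halting run of the stack machine, and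
`leads_reaches` transfers it. -/
theorem leads_eval (hI : ∀ j i, T j i = a.tapes j i ∨ T j i = a'.tapes j i) {v w : List ℕ}
    (hv : w ∈ U.eval v) :
    Leads U L a a' T h (exec (tr (trNormal U .halt)) none) (K'.elim (trList v) [] [] []) none
      T h (pop 0) (K'.elim (trList w) [] [] []) none := by
  have h1 : PartrecToTM2.halt w ∈ StateTransition.eval (TM2.step tr) (PartrecToTM2.init U v) := by
    rw [PartrecToTM2.tr_eval]
    exact Part.mem_map _ hv
  have h2 := (StateTransition.mem_eval.1 h1).1
  exact (leads_reaches hI (b := PartrecToTM2.init U v)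
    (Finset.some_mem_insertNone.2 (start_mem_labels U)) h2).1

end

end Ctl

end ITTM

/-! ### Binary numerals and the simulation of a single step -/

namespace ITTM

open Order Turing Turing.PartrecToTM2 Turing.ToPartrec

/-- The number whose binary expansion, from the lowest digit on, is `l` followed by that of `m`. -/
def bitsNat : List Bool → ℕ → ℕ
  | [], m => m
  | b :: l, m => 2 * bitsNat l m + b.toNat

theorem bitsNat_pos {m : ℕ} (hm : 0 < m) : ∀ l, 0 < bitsNat l m
  | [] => hm
  | b :: l => by have := bitsNat_pos hm l; simp only [bitsNat]; omega

/-- Positivity is needed because the numeral of `0` is the empty word, not the digit `0`. -/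
theorem trNat_two_mul_add (n : ℕ) (b : Bool) (h : 0 < 2 * n + b.toNat) :
    trNat (2 * n + b.toNat) = Ctl.digit b :: trNat n := by
  cases b
  · have hn : n ≠ 0 := by simp at h; omega
    have hc : ((2 * n + false.toNat : ℕ) : Num) = Num.bit0 (n : Num) := by
      rw [← Num.bit0_of_bit0]; push_cast; simp [two_mul]
    rw [trNat, hc, trNat]
    rcases hm : (n : Num) with _ | k
    · exfalso
      apply hn
      have : ((n : Num) : ℕ) = 0 := by rw [hm]; rfl
      simpa using this
    · rfl
  · have hc : ((2 * n + true.toNat : ℕ) : Num) = Num.bit1 (n : Num) := by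
      rw [← Num.bit1_of_bit1]; push_cast; simp [two_mul]
    rw [trNat, hc, trNat]
    rcases hm : (n : Num) with _ | k <;> rfl

/-- A positive upper part keeps the digits of `l` from being dropped as leading zeros. This is why
states enter `situation` and `instruction` as `q + 1`. -/
theorem trNat_bitsNat {m : ℕ} (hm : 0 < m) (l : List Bool) :
    trNat (bitsNat l m) = l.map Ctl.digit ++ trNat m := by
  induction l with
  | nil => rfl
  | cons b l ih =>
    have := bitsNat_pos hm (b :: l)
    rw [bitsNat] at this
    rw [bitsNat, trNat_two_mul_add _ _ this, ih]
    rfl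

/-- The loaded unary numeral `n`, read in binary, is `2 ^ n - 1`. The code is given this number as
its index, so no conversion on the stack is needed. -/
theorem trNat_two_pow_sub_one (n : ℕ) : trNat (2 ^ n - 1) = List.replicate n Γ'.bit1 := by
  induction n with
  | zero => simp
  | succ n ih =>
    have h : 2 ^ (n + 1) - 1 = 2 * (2 ^ n - 1) + true.toNat := by
      have := Nat.one_le_two_pow (n := n)
      simp only [pow_succ, Bool.toNat_true]; omega
    rw [h, trNat_two_mul_add _ _ (by simp), ih]
    rfl

/-- The number that describes the state `q` and the symbols `s`. -/
def situation (q : ℕ) (s : Symbols) : ℕ := bitsNat [s.2.2, s.2.1, s.1] (q + 1)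

/-- The number that describes an instruction. -/
def instruction (q : ℕ) (w : Symbols) (m : ℕ) : ℕ :=
  bitsNat [w.1, w.2.1, w.2.2, decide (m = 0), decide (m = 2), decide (q = 2)] (q + 1)

/-- The code `U` computes the instructions of the program `p` when it is given the number `M`. -/
def ComputesInstr (U : Code) (p : Program) (M : ℕ) : Prop :=
  ∀ (q : p.State) (s : Symbols),
    [instruction (p.instr q s).1 (p.instr q s).2.1 (p.instr q s).2.2.code, M] ∈
      U.eval [situation q s, M]

namespace Ctl

variable {U : Code} {p : Program} {L : List Γ'} {a a' : p.Config}

theorem digit_beq (b : Bool) : ((digit b : Γ') == Γ'.bit1) = b := by cases b <;> rfl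

/-- The bound keeps the run away from `pop 5`, which may halt and therefore cannot occur in `Leads`.
-/
theorem leads_pop {T T' : Fin 3 → Cantor} {h h' : ℕ} {j : Fin 6} (hj : (j : ℕ) < 4) (b : Bool)
    (m : List Γ') (hI : ∀ j i, T j i = a.tapes j i ∨ T j i = a'.tapes j i)
    (hI' : ∀ j i, T' j i = a.tapes j i ∨ T' j i = a'.tapes j i)
    (hT : (tapeOp j b).tapes T h = T') (hh : (tapeOp j b).head h = h') :
    Leads U L a a' T h (pop j) (K'.elim (digit b :: m) [] [] []) none
      T' h' (pop ⟨j + 1, by omega⟩) (K'.elim m [] [] []) none := by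
  have hj5 : (j : ℕ) < 5 := by omega
  have := Leads.single (U := U) (L := L) (a := a) (a' := a') (T := T) (T' := T') (h := h)
    (h' := h') (c := pop j) (c' := pop ⟨j + 1, by omega⟩) (sig := none) (sp := .pop .main)
    (tp := tapeOp j b) (stk := K'.elim (digit b :: m) [] [] []) trivial
    (by simp only [ne_eq, pop.injEq, Fin.ext_iff]; change ¬ (j : ℕ) = 5; omega)
    (by simp only [ne_eq, pop.injEq, Fin.ext_iff]; change ¬ (j : ℕ) + 1 = 5; omega) hI hI'
    (by simp [act, hj5, digit_beq])
    hT hh (by fin_cases j <;> cases b <;> simp [tapeOp])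
  simpa [StackOp.apply] using this

/-- The configurations that represent a configuration of the program. -/
def IsReady (U : Code) {p : Program} (M : ℕ) (c : p.Config)
    (t : Controller.St K' Γ' (State U)) : Prop :=
  ∃ par, t = conf U (trList [M]) c.tapes c.head launch par
    (K'.elim (trList [(c.state : ℕ) + 1, M]) [] [] []) none

/-- The simulation of a step, except for its very end. -/
theorem exists_reach_pop {M : ℕ} (hU : ComputesInstr U p M) (c : p.Config)
    {t : Controller.St K' Γ' (State U)} (ht : IsReady U M c t) :
    ∃ n par h, (bif decide ((p.instr c.state c.read).2.2.code = 2) then h + 1 else h) =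
        c.step.head ∧
      Reach (Controller.St.next (ctrl U)) ((ctrl U).StepInv (trList [M]) c c.step) n t
        (conf U (trList [M]) c.step.tapes h (pop 4) par
          (K'.elim (digit (decide ((p.instr c.state c.read).2.2.code = 2)) ::
            digit (decide (((p.instr c.state c.read).1 : ℕ) = 2)) ::
              trList [(c.step.state : ℕ) + 1, M]) [] [] []) none) := by
  obtain ⟨par, rfl⟩ := ht
  have hI : ∀ j i, c.tapes j i = c.tapes j i ∨ c.tapes j i = c.step.tapes j i :=
    fun _ _ => .inl rfl
  set o := p.instr c.state c.read with ho
  set h₁ := (tapeOp 3 (decide (o.2.2.code = 0))).head c.head with hh₁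
  -- Pushing the three symbols on the numeral of the state already gives the argument of the code,
  -- with no arithmetic.
  have hsit : trList [situation c.state c.read, M] =
      [digit c.read.1, digit c.read.2.1, digit c.read.2.2].reverse ++
        trList [(c.state : ℕ) + 1, M] := by
    simp [situation, trNat_bitsNat]
  -- In the same way, six pops from the result leave exactly the stack for the next step.
  have hins : trList [instruction o.1 o.2.1 o.2.2.code, M] =
      digit o.2.1.1 :: digit o.2.1.2.1 :: digit o.2.1.2.2 :: digit (decide (o.2.2.code = 0)) ::
        digit (decide (o.2.2.code = 2)) :: digit (decide ((o.1 : ℕ) = 2)) ::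
          trList [(c.step.state : ℕ) + 1, M] := by
    simp [instruction, trNat_bitsNat, Program.Config.step, ← ho]
  -- The tapes are written one at a time; in between, every bit is still an old or a new one, as
  -- `StepInv` demands.
  let T₁ : Fin 3 → Cantor := Function.update c.tapes 0 (c.step.tapes 0)
  let T₂ : Fin 3 → Cantor := Function.update T₁ 1 (c.step.tapes 1)
  have hT₁ : ∀ j i, T₁ j i = c.tapes j i ∨ T₁ j i = c.step.tapes j i := by
    intro j i
    fin_cases j <;> simp [T₁]
  have hT₂ : ∀ j i, T₂ j i = c.tapes j i ∨ T₂ j i = c.step.tapes j i := by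
    intro j i
    fin_cases j <;> simp [T₁, T₂]
  have hT₃ : Function.update T₂ 2 (c.step.tapes 2) = c.step.tapes := by
    funext j
    fin_cases j <;> simp [T₁, T₂]
  have hI' : ∀ j i, c.step.tapes j i = c.tapes j i ∨ c.step.tapes j i = c.step.tapes j i :=
    fun _ _ => .inr rfl
  have l1 := leads_wait (U := U) (L := trList [M]) (h := c.head)
    (stk := K'.elim (trList [(c.state : ℕ) + 1, M]) [] [] []) hI c.head c.read
  have l2 := leads_words (U := U) (L := trList [M]) (h := c.head) hI true
    [digit c.read.1, digit c.read.2.1, digit c.read.2.2] le_rfl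
    (trList [(c.state : ℕ) + 1, M]) [] [] []
  rw [← hsit] at l2
  have l3 := leads_eval (L := trList [M]) (h := c.head) hI (hU c.state c.read)
  rw [← ho, hins] at l3
  have l4 := leads_pop (U := U) (L := trList [M]) (h := c.head) (j := 0) (by simp) o.2.1.1
    (digit o.2.1.2.1 :: digit o.2.1.2.2 :: digit (decide (o.2.2.code = 0)) ::
      digit (decide (o.2.2.code = 2)) :: digit (decide ((o.1 : ℕ) = 2)) ::
        trList [(c.step.state : ℕ) + 1, M]) hI hT₁ rfl rfl
  have l5 := leads_pop (U := U) (L := trList [M]) (h := c.head) (j := 1) (by simp) o.2.1.2.1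
    (digit o.2.1.2.2 :: digit (decide (o.2.2.code = 0)) ::
      digit (decide (o.2.2.code = 2)) :: digit (decide ((o.1 : ℕ) = 2)) ::
        trList [(c.step.state : ℕ) + 1, M]) hT₁ hT₂ rfl rfl
  have l6 := leads_pop (U := U) (L := trList [M]) (h := c.head) (j := 2) (by simp) o.2.1.2.2
    (digit (decide (o.2.2.code = 0)) ::
      digit (decide (o.2.2.code = 2)) :: digit (decide ((o.1 : ℕ) = 2)) ::
        trList [(c.step.state : ℕ) + 1, M]) hT₂ hI' hT₃ rfl
  have l7 := leads_pop (U := U) (L := trList [M]) (h := c.head) (j := 3) (by simp)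
    (decide (o.2.2.code = 0))
    (digit (decide (o.2.2.code = 2)) :: digit (decide ((o.1 : ℕ) = 2)) ::
        trList [(c.step.state : ℕ) + 1, M]) hI' hI' (by
          cases decide (o.2.2.code = 0) <;> rfl) hh₁.symm
  obtain ⟨n, par', hr⟩ := (l1.trans (l2.trans (l3.trans (l4.trans (l5.trans (l6.trans l7)))))) (!par)
  refine ⟨n + 1, par', h₁, ?_, .head (next_launch U) (stepInv_conf (by simp) hI _ _ _ _) hr⟩
  have : c.step.head = o.2.2.apply c.head := rfl
  rw [this, hh₁]
  cases o.2.2 <;> simp [Move.code, Move.apply, tapeOp]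

theorem fresh_eq {M : ℕ} {w : List Γ'} {T : Fin 3 → Cantor} :
    (ctrl U).fresh (toState U (words w false)) (trList [M]) T =
      conf U (trList [M]) T 0 (words w false) false (K'.elim (trList [M]) [] [] []) none := by
  have : (Function.update (fun _ => []) K'.main (trList [M]) : K' → List Γ') =
      K'.elim (trList [M]) [] [] [] := by
    funext k; cases k <;> rfl
  simp only [Controller.fresh, conf, ← this]
  rfl

theorem exists_reach_fresh {M : ℕ} {w : List Γ'} (c : p.Config) (hc : c.head = 0)
    (hw : w.length ≤ 3) (h : w.reverse ++ trList [M] = trList [(c.state : ℕ) + 1, M]) :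
    ∃ n t, Reach (Controller.St.next (ctrl U)) ((ctrl U).StepInv (trList [M]) c c) n
      ((ctrl U).fresh (toState U (words w false)) (trList [M]) c.tapes) t ∧ IsReady U M c t := by
  obtain ⟨n, par, hr⟩ := leads_words (U := U) (L := trList [M]) (a := c) (a' := c) (h := 0)
    (fun _ _ => .inl rfl) false w hw (trList [M]) [] [] [] false
  rw [fresh_eq]
  refine ⟨n, _, hr, par, ?_⟩
  rw [h, hc]
  rfl

/-- The universal control simulates every program whose instructions the code computes. -/
def simulates {M : ℕ} (hU : ComputesInstr U p M) : (ctrl U).Simulates p (trList [M]) where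
  Ready := IsReady U M
  first c h1 h2 := by
    refine exists_reach_fresh c h2 (by simp) ?_
    have : trNat 1 = [Γ'.bit1] := trNat_two_pow_sub_one 1
    simp [h1, Program.start, this]
  next c h1 h2 := by
    refine exists_reach_fresh c h2 (by simp) ?_
    have h3 : trNat 1 = [Γ'.bit1] := trNat_two_pow_sub_one 1
    have : trNat 2 = [Γ'.bit0, Γ'.bit1] := by
      have := trNat_two_mul_add 1 false (by simp)
      rwa [h3] at this
    simp [h1, Program.limit, this]
  tape := by rintro c _ ⟨par, rfl⟩; rfl
  step c t ht hc := by
    obtain ⟨n, par, h, hh, hr⟩ := exists_reach_pop hU c ht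
    have hf : decide (((p.instr c.state c.read).1 : ℕ) = 2) = false := by
      rw [decide_eq_false_iff_not]
      exact fun e => hc (Fin.ext e)
    rw [hf] at hr
    set b := decide ((p.instr c.state c.read).2.2.code = 2) with hb
    have hI : ∀ j i, c.step.tapes j i = c.tapes j i ∨ c.step.tapes j i = c.step.tapes j i :=
      fun _ _ => .inr rfl
    have s1 : (conf U (trList [M]) c.step.tapes h (pop 4) par
        (K'.elim (digit b :: digit false :: trList [(c.step.state : ℕ) + 1, M]) [] [] [])
          none).next (ctrl U) = conf U (trList [M]) c.step.tapes c.step.head (pop 5) (!par)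
        (K'.elim (digit false :: trList [(c.step.state : ℕ) + 1, M]) [] [] []) none := by
      rw [next_conf U (c := pop 4) (c' := pop 5) (sp := .pop .main) (tp := tapeOp 4 b) trivial
        (by simp [act, digit_beq]) (T' := c.step.tapes) (by cases b <;> rfl) (h' := c.step.head)
        (by rw [← hh]; cases b <;> rfl) (by cases b <;> simp [tapeOp])]
      simp [StackOp.apply]
    have s2 : (conf U (trList [M]) c.step.tapes c.step.head (pop 5) (!par)
        (K'.elim (digit false :: trList [(c.step.state : ℕ) + 1, M]) [] [] [])
          none).next (ctrl U) = conf U (trList [M]) c.step.tapes c.step.head launch (!!par)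
        (K'.elim (trList [(c.step.state : ℕ) + 1, M]) [] [] []) none := by
      rw [next_conf U (L := trList [M]) (T := c.step.tapes) (h := c.step.head) (par := !par)
        (stk := K'.elim (digit false :: trList [(c.step.state : ℕ) + 1, M]) [] [] [])
        (sig := none) (c := pop 5) (c' := launch) (sp := .pop .main) (tp := tapeOp 5 false)
        trivial (by simp [act, digit_beq]) (T' := c.step.tapes) rfl (h' := c.step.head) rfl
        (by simp [tapeOp])]
      simp [StackOp.apply]
    -- The last two pops are treated by hand. Here `pop 5` finds the digit `0` and so does not halt.
    refine ⟨n + 1, _, hr.trans (.head s1 hr.last (.single s2 ⟨?_, rfl, hI⟩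
      (stepInv_conf (by simp) hI _ _ _ _))), _, rfl⟩
    rw [op_conf U (c := pop 5) trivial]
    simp [act, digit_beq, tapeOp]
  halt c t ht hc := by
    obtain ⟨n, par, h, hh, hr⟩ := exists_reach_pop hU c ht
    have hf : decide (((p.instr c.state c.read).1 : ℕ) = 2) = true := by
      rw [decide_eq_true_eq]
      exact congrArg Fin.val hc
    rw [hf] at hr
    set b := decide ((p.instr c.state c.read).2.2.code = 2) with hb
    have s1 : (conf U (trList [M]) c.step.tapes h (pop 4) par
        (K'.elim (digit b :: digit true :: trList [(c.step.state : ℕ) + 1, M]) [] [] [])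
          none).next (ctrl U) = conf U (trList [M]) c.step.tapes c.step.head (pop 5) (!par)
        (K'.elim (digit true :: trList [(c.step.state : ℕ) + 1, M]) [] [] []) none := by
      rw [next_conf U (c := pop 4) (c' := pop 5) (sp := .pop .main) (tp := tapeOp 4 b) trivial
        (by simp [act, digit_beq]) (T' := c.step.tapes) (by cases b <;> rfl) (h' := c.step.head)
        (by rw [← hh]; cases b <;> rfl) (by cases b <;> simp [tapeOp])]
      simp [StackOp.apply]
    refine ⟨n + 1, _, fun m hm => (hr.2 m (by omega)).1,
      by rw [Function.iterate_succ_apply', hr.1, s1], ?_, rfl⟩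
    rw [op_conf U (c := pop 5) trivial]
    simp [act, digit_beq, tapeOp]

end Ctl

end ITTM

/-! ### Universal machines for sequences of programs -/

namespace ITTM

open Order Turing.PartrecToTM2 Turing.ToPartrec

instance : Finite K' :=
  Finite.of_injective (β := Bool × Bool)
    (fun k => K'.rec (true, true) (true, false) (false, true) (false, false) k)
    fun a b => by cases a <;> cases b <;> simp

/-- The cases are the three outcomes of loading: a simulation, death just after stage `ω`, death at
a finite stage. -/
theorem Cantor.trichotomy (e : Cantor) : (∃ n, e = ofNat n) ∨ (∀ k, e k = true) ∨
    ∃ t, e t = true ∧ ∃ j < t, e j = false := by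
  by_cases h1 : ∀ k, e k = true
  · exact .inr (.inl h1)
  simp only [not_forall, Bool.not_eq_true] at h1
  by_cases h2 : ∃ t, e t = true ∧ ∃ j < t, e j = false
  · exact .inr (.inr h2)
  push Not at h2
  refine .inl ⟨Nat.find h1, ?_⟩
  funext i
  rcases lt_or_ge i (Nat.find h1) with h | h
  · simpa [ofNat, h] using Nat.find_min h1 h
  · have : ¬ i < Nat.find h1 := not_lt.2 h
    simp only [ofNat, this, decide_false]
    rcases h.eq_or_lt with h | h
    · rw [← h]; exact Nat.find_spec h1
    · by_contra hi
      exact h2 i (by simpa using hi) _ h (Nat.find_spec h1)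

theorem ofNat_injective : Function.Injective ofNat := by
  intro m n h
  by_contra hne
  rcases Nat.lt_or_gt_of_ne hne with hl | hl
  · have := congrFun h m
    simp [ofNat, hl] at this
  · have := congrFun h n
    simp [ofNat, hl] at this

/-- There are universal machines, for every sequence of programs whose instructions are computed by
one code. -/
theorem exists_universal {U : Code} {p : ℕ → Program} (hU : ∀ n, ComputesInstr U (p n) (2 ^ n - 1))
    (bold neg : Bool) : ∃ P : Program, ∀ z y, P.Yields z y ↔
      (∃ n, (fun i => z ((if bold then 2 else 1) * i)) = ofNat n ∧
        (p n).Accepts neg fun i => bold && z (2 * i + 1)) ∧ y = ofNat 1 := by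
  obtain ⟨P, hP⟩ := ((Ctl.ctrl U).rule bold neg).exists_program Track.two_le_card .flag
    (if bold then 2 else 1) (by split_ifs <;> omega)
  refine ⟨P, fun z y => ?_⟩
  obtain ⟨r, Y, hY, hr, hy⟩ := hP z
  rw [hy, and_congr_left_iff]
  rintro -
  set e : Cantor := fun i => z ((if bold then 2 else 1) * i) with he
  set x : Cantor := fun i => bold && z (2 * i + 1) with hx
  have hr' : ∀ n : ℕ, (r n).1 = e n ∧ (bold && (r n).2) = x n := fun n => by
    rw [hr]
    cases bold <;> simp [he, hx]
  rcases e.trichotomy with ⟨n, hn⟩ | h | h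
  · have key := Controller.run_load_ofNat (Ctl.ctrl U) hr' hY hn
    have hL : List.replicate n (Ctl.ctrl U).one ++ [(Ctl.ctrl U).sep] = trList [2 ^ n - 1] := by
      simp [trNat_two_pow_sub_one, Ctl.ctrl]
    have hT : (fun j : Fin 3 => if j = 0 then x else ofNat 0) = ((p n).initial x).tapes := by
      funext j; fin_cases j <;> rfl
    rw [hL, hT] at key
    rw [Controller.flag_iff_accepts hY (Ctl.simulates (hU n)) key.1 key.2]
    refine ⟨fun h => ⟨n, hn, h⟩, fun ⟨m, hm, h⟩ => ?_⟩
    rwa [ofNat_injective (hn.symm.trans hm)]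
  · refine iff_of_false (fun ⟨α, hα⟩ => ?_) fun ⟨n, hn, _⟩ => ?_
    · rw [Controller.run_load_ones (Ctl.ctrl U) hr' hY h α] at hα
      simp at hα
    · have := h n
      rw [hn] at this
      simp [ofNat] at this
  · refine iff_of_false (fun ⟨α, hα⟩ => ?_) fun ⟨n, hn, _⟩ => ?_
    · rw [Controller.run_load_violation (Ctl.ctrl U) hr' hY h α] at hα
      simp at hα
    · obtain ⟨t, h1, j, h2, h3⟩ := h
      rw [hn] at h1 h3
      simp only [ofNat, decide_eq_true_eq, decide_eq_false_iff_not] at h1 h3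
      omega

end ITTM

/-! ### Instruction tables and their computability -/

namespace ITTM

open Turing.ToPartrec

/-- Tables of instructions. -/
abbrev Table : Type := List (List (ℕ × Symbols × ℕ))

namespace Table

/-- The table belongs to a program. -/
def IsValid (T : Table) : Prop :=
  3 ≤ T.length ∧ ∀ r ∈ T, r.length = 8 ∧ ∀ e ∈ r, e.1 < T.length ∧ e.2.2 < 3

/-- An entry of the table. -/
def lookup (T : Table) (i j : ℕ) : ℕ × Symbols × ℕ :=
  (T.getD i []).getD j (0, (false, false, false), 1)

open Classical in
/-- An entry of the table, if it is valid; otherwise, an instruction to do nothing. -/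
noncomputable def entry (T : Table) (i j : ℕ) : ℕ × Symbols × ℕ :=
  if T.IsValid then T.lookup i j else (0, (false, false, false), 1)

/-- The position of the instruction for the given symbols in a row of a table. -/
def index (s : Symbols) : ℕ := 4 * s.1.toNat + 2 * s.2.1.toNat + s.2.2.toNat

end Table

/-- The head movement with the given number. -/
def Move.ofCode : ℕ → Move
  | 0 => .left
  | 1 => .stay
  | _ => .right

theorem Move.code_ofCode {n : ℕ} (h : n < 3) : (Move.ofCode n).code = n := by
  interval_cases n <;> rfl

namespace Program

theorem table_injective : Function.Injective table := fun _ _ h =>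
  code_injective (congrArg Encodable.encode h)

theorem length_table (p : Program) : p.table.length = p.extra + 3 := by simp [table]

theorem isValid_table (p : Program) : Table.IsValid p.table := by
  refine ⟨by simp [table], fun r hr => ?_⟩
  obtain ⟨q, rfl⟩ := (List.mem_ofFn' _ _).1 hr
  refine ⟨rfl, fun e he => ?_⟩
  obtain ⟨s, -, rfl⟩ := List.mem_map.1 he
  refine ⟨by simp [length_table], ?_⟩
  change (p.instr q s).2.2.code < 3
  cases (p.instr q s).2.2 <;> simp [Move.code]

theorem lookup_table (p : Program) (q : p.State) (s : Symbols) :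
    Table.lookup p.table q (Table.index s) =
      (((p.instr q s).1 : ℕ), (p.instr q s).2.1, (p.instr q s).2.2.code) := by
  have : p.table.getD q [] = p.row q := by
    rw [List.getD_eq_getElem _ _ (by rw [length_table]; exact q.2)]
    exact List.getElem_ofFn ..
  rw [Table.lookup, this]
  rcases s with ⟨_ | _, _ | _, _ | _⟩ <;> rfl

/-- A program that never halts. -/
def idle : Program := ⟨0, fun _ _ => (0, (false, false, false), .stay)⟩

open Classical in
/-- The program with the given table. -/
noncomputable def ofTable (T : Table) : Program :=
  if h : ∃ p : Program, p.table = T then h.choose else idle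

theorem ofTable_table (p : Program) : ofTable p.table = p := by
  have h : ∃ q : Program, q.table = p.table := ⟨p, rfl⟩
  rw [ofTable, dif_pos h]
  exact table_injective h.choose_spec

end Program

/-- With `isValid_table`, the range of `table` is the primitive recursive set of valid tables; the
program is read off from the entries. -/
theorem Table.IsValid.exists_program {T : Table} (h : T.IsValid) :
    ∃ p : Program, p.table = T := by
  obtain ⟨k, hk⟩ := Nat.exists_eq_add_of_le h.1
  rw [add_comm] at hk
  have he : ∀ (q : Fin (k + 3)) s,
      (T.lookup q (index s)).1 < k + 3 ∧ (T.lookup q (index s)).2.2 < 3 := fun q s => by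
    have h0 : (q : ℕ) < T.length := by omega
    have h1 := (h.2 _ (List.getElem_mem h0)).1
    have h2 : index s < T[(q : ℕ)].length := by
      rw [h1]; rcases s with ⟨_ | _, _ | _, _ | _⟩ <;> simp [index]
    rw [lookup, List.getD_eq_getElem _ _ h0, List.getD_eq_getElem _ _ h2]
    simpa only [hk] using (h.2 _ (List.getElem_mem h0)).2 _ (List.getElem_mem h2)
  refine ⟨⟨k, fun q s => (⟨(T.lookup q (index s)).1, (he q s).1⟩, (T.lookup q (index s)).2.1,
    .ofCode (T.lookup q (index s)).2.2)⟩, ?_⟩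
  refine List.ext_getElem (by simp [Program.table, hk]) fun i h1 h2 => ?_
  have h3 : T[i].length = 8 := (h.2 _ (List.getElem_mem h2)).1
  simp only [Program.table, List.getElem_ofFn, Program.row,
    Move.code_ofCode (he ⟨i, by omega⟩ _).2]
  refine List.ext_getElem (by simp [h3]) fun j h5 h6 => ?_
  rw [h3] at h6
  interval_cases j <;> simp [lookup, index, h3, h2]

/-- Invalid tables need no exception: the default entry is the one instruction of `idle`. -/
theorem Program.entry_ofTable (T : Table) (q : (ofTable T).State) (s : Symbols) :
    T.entry q (Table.index s) = ((((ofTable T).instr q s).1 : ℕ), ((ofTable T).instr q s).2.1,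
      ((ofTable T).instr q s).2.2.code) := by
  by_cases h : T.IsValid
  · obtain ⟨p, rfl⟩ := h.exists_program
    rw [Table.entry, if_pos p.isValid_table]
    revert q
    rw [ofTable_table]
    exact fun q => p.lookup_table q s
  · have : ¬ ∃ p : Program, p.table = T := fun ⟨p, hp⟩ => h (hp ▸ p.isValid_table)
    have hi : ofTable T = idle := dif_neg this
    rw [Table.entry, if_neg h]
    revert q
    rw [hi]
    exact fun _ => rfl

section

open Primrec

theorem primrecPred_isValid : PrimrecPred Table.IsValid := by
  have h1 : PrimrecPred fun T : Table => 3 ≤ T.length :=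
    Primrec.nat_le.comp (const 3) list_length
  have h2 : PrimrecRel fun (e : ℕ × Symbols × ℕ) (n : ℕ) => e.1 < n ∧ e.2.2 < 3 :=
    (Primrec.nat_lt.comp (fst.comp fst) snd).and
      (Primrec.nat_lt.comp (snd.comp (snd.comp fst)) (const 3))
  have h3 : PrimrecRel fun (r : List (ℕ × Symbols × ℕ)) (n : ℕ) =>
      r.length = 8 ∧ ∀ e ∈ r, e.1 < n ∧ e.2.2 < 3 :=
    (Primrec.eq.comp (list_length.comp fst) (const 8)).and h2.forall_mem_list
  have h4 : PrimrecPred fun T : Table =>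
      ∀ r ∈ T, r.length = 8 ∧ ∀ e ∈ r, e.1 < T.length ∧ e.2.2 < 3 :=
    h3.forall_mem_list.comp Primrec.id list_length
  exact h1.and h4

theorem primrec_entry : Primrec fun a : Table × ℕ × ℕ => a.1.entry a.2.1 a.2.2 := by
  classical
  refine Primrec.ite (primrecPred_isValid.comp fst) ?_ (const _)
  exact (list_getD _).comp ((list_getD []).comp fst (fst.comp snd)) (snd.comp snd)

theorem primrec_instruction : Primrec fun e : ℕ × Symbols × ℕ => instruction e.1 e.2.1 e.2.2 := by
  have hb : ∀ {f : ℕ × Symbols × ℕ → Bool} {g : ℕ × Symbols × ℕ → ℕ}, Primrec f → Primrec g →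
      Primrec fun e => 2 * g e + (f e).toNat := fun hf hg =>
    nat_add.comp (nat_mul.comp (const 2) hg) ((dom_bool Bool.toNat).comp hf)
  have h1 : Primrec fun e : ℕ × Symbols × ℕ => decide (e.1 = 2) :=
    (Primrec.eq.comp fst (const 2)).decide
  have h2 : ∀ k, Primrec fun e : ℕ × Symbols × ℕ => decide (e.2.2 = k) := fun k =>
    (Primrec.eq.comp (snd.comp snd) (const k)).decide
  have h3 : ∀ f : Symbols → Bool, Primrec fun e : ℕ × Symbols × ℕ => f e.2.1 := fun f =>
    (dom_finite f).comp (fst.comp snd)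
  exact hb (h3 fun s => s.1) (hb (h3 fun s => s.2.1) (hb (h3 fun s => s.2.2)
    (hb (h2 0) (hb (h2 2) (hb h1 (succ.comp fst))))))

/-- This recovers `n` from the index `2 ^ n - 1` that the code is given. -/
theorem primrec_log_two : Primrec fun M : ℕ => Nat.findGreatest (fun k => 2 ^ k ≤ M + 1) (M + 1) := by
  have hp : Primrec fun k : ℕ => 2 ^ k :=
    (nat_rec₁ 1 (nat_mul.comp (const 2) snd).to₂).of_eq fun k => by
      induction k with
      | zero => rfl
      | succ k ih => simp only [pow_succ, mul_comm _ 2, ← ih]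
  exact nat_findGreatest succ (Primrec.nat_le.comp (hp.comp snd) (succ.comp fst))

theorem findGreatest_two_pow (n : ℕ) :
    Nat.findGreatest (fun k => 2 ^ k ≤ 2 ^ n - 1 + 1) (2 ^ n - 1 + 1) = n := by
  rw [Nat.sub_add_cancel Nat.one_le_two_pow, Nat.findGreatest_eq_iff]
  refine ⟨Nat.lt_two_pow_self.le, fun _ => le_rfl, fun k hk _ h => ?_⟩
  exact absurd ((Nat.pow_le_pow_iff_right (by norm_num)).1 h) (by omega)

end

theorem index_situation (q : ℕ) (s : Symbols) : situation q s % 8 = Table.index s := by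
  rcases s with ⟨_ | _, _ | _, _ | _⟩ <;> simp [situation, bitsNat, Table.index] <;> omega

theorem pred_situation (q : ℕ) (s : Symbols) : situation q s / 8 - 1 = q := by
  rcases s with ⟨_ | _, _ | _, _ | _⟩ <;> simp [situation, bitsNat] <;> omega

/-- The instructions of a computable sequence of tables are computed by a code. -/
theorem exists_computesInstr {G : ℕ → Table} (hG : Computable G) :
    ∃ U : Code, ∀ n, ComputesInstr U (.ofTable (G n)) (2 ^ n - 1) := by
  let F : ℕ → ℕ → ℕ := fun a M =>
    let e := (G (Nat.findGreatest (fun k => 2 ^ k ≤ M + 1) (M + 1))).entry (a / 8 - 1) (a % 8)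
    instruction e.1 e.2.1 e.2.2
  have hF : Computable fun v : List.Vector ℕ 2 => F (v.get 0) (v.get 1) := by
    have h0 : Computable fun v : List.Vector ℕ 2 => v.get 0 :=
      (Primrec.vector_get.comp .id (.const 0)).to_comp
    have h1 : Computable fun v : List.Vector ℕ 2 => v.get 1 :=
      (Primrec.vector_get.comp .id (.const 1)).to_comp
    have h2 : Primrec fun a : ℕ => a / 8 - 1 :=
      Primrec.nat_sub.comp (Primrec.nat_div.comp .id (.const 8)) (.const 1)
    have h3 : Primrec fun a : ℕ => a % 8 := Primrec.nat_mod.comp .id (.const 8)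
    exact primrec_instruction.to_comp.comp (primrec_entry.to_comp.comp
      ((hG.comp (primrec_log_two.to_comp.comp h1)).pair
        ((h2.to_comp.comp h0).pair (h3.to_comp.comp h0))))
  obtain ⟨c, hc⟩ := Code.exists_code (Nat.Partrec'.of_part hF.partrec)
  -- The code returns the index along with the result, since it is needed again in the next step.
  refine ⟨.cons c .tail, fun n q s => ?_⟩
  have key := hc ⟨[situation q s, 2 ^ n - 1], rfl⟩
  have hval : F (situation q s) (2 ^ n - 1) = instruction ((Program.ofTable (G n)).instr q s).1
      ((Program.ofTable (G n)).instr q s).2.1 ((Program.ofTable (G n)).instr q s).2.2.code := by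
    simp only [F, index_situation, pred_situation, findGreatest_two_pow,
      Program.entry_ofTable (G n) q s]
  rw [Code.cons_eval, Code.tail_eval]
  change _ ∈ (c.eval [situation q s, 2 ^ n - 1] >>= _)
  rw [show c.eval [situation q s, 2 ^ n - 1] = _ from key, ← hval]
  refine Part.mem_bind_iff.2 ⟨[F (situation q s) (2 ^ n - 1)], Part.mem_map _ (Part.mem_some _), ?_⟩
  exact Part.mem_bind_iff.2 ⟨[2 ^ n - 1], Part.mem_some _, Part.mem_some _⟩

end ITTM

/-! ### Hard-wiring a finite word as input -/

namespace ITTM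

open Order

/-- A finite word, followed by zeros. -/
def word (L : List Bool) : Cantor := fun i => L.getD i false

theorem word_map_range (n : ℕ) : word ((List.range n).map fun _ => true) = ofNat n := by
  funext i
  by_cases h : i < n <;> simp [word, ofNat, h, List.getD]

namespace Table

/-- The symbols in the order of the instructions in a row. -/
def allSymbols : List Symbols :=
  [(false, false, false), (false, false, true), (false, true, false), (false, true, true),
    (true, false, false), (true, false, true), (true, true, false), (true, true, true)]

/-- The number of the copy of a state when `N` is the copy of the start state. -/
def copyState (N q : ℕ) : ℕ := if q = 0 then N else q

/-- The instruction at the state `q`, with the symbols `s`, of the program that writes the word `L`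
on the input tape and then does what the table `T` says. From the start state, it goes to the
largest state and then counts down; on the way, it moves to the right end of the word, and then
to the left while it writes. -/
def prefixEntry (L : List Bool) (T : Table) (q : ℕ) (s : Symbols) : ℕ × Symbols × ℕ :=
  if q = 0 then (T.length + 2 * L.length + 1, s, 1)
  else if q ≤ T.length then
    (copyState T.length (T.lookup (if q = T.length then 0 else q) (index s)).1,
      (T.lookup (if q = T.length then 0 else q) (index s)).2)
  else (q - 1, (L.getD (q - T.length - 1) false, s.2),
    if q - T.length - 1 ≤ L.length then 0 else 2)

/-- The table of the program that writes the word `L` on the input tape and then does what the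
table `T` says. -/
def prefixed (L : List Bool) (T : Table) : Table :=
  (List.range (T.length + 2 * L.length + 2)).map fun q => allSymbols.map fun s => prefixEntry L T q s

section

open Primrec

theorem primrec_prefixed : Primrec₂ prefixed := by
  have hI : Primrec index := dom_finite index
  have hl : Primrec fun a : ((List Bool × Table) × ℕ) × Symbols => a.1.1.1.length :=
    list_length.comp (fst.comp (fst.comp fst))
  have hT : Primrec fun a : ((List Bool × Table) × ℕ) × Symbols => a.1.1.2.length :=
    list_length.comp (snd.comp (fst.comp fst))
  have hq : Primrec fun a : ((List Bool × Table) × ℕ) × Symbols => a.1.2 := snd.comp fst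
  have hk : Primrec fun a : ((List Bool × Table) × ℕ) × Symbols => a.1.2 - a.1.1.2.length - 1 :=
    nat_sub.comp (nat_sub.comp hq hT) (const 1)
  have hL : Primrec fun a : ((List Bool × Table) × ℕ) × Symbols =>
      a.1.1.2.lookup (if a.1.2 = a.1.1.2.length then 0 else a.1.2) (index a.2) :=
    (list_getD _).comp ((list_getD []).comp (snd.comp (fst.comp fst))
      (Primrec.ite (Primrec.eq.comp hq hT) (const 0) hq)) (hI.comp snd)
  have hn : Primrec fun a : ((List Bool × Table) × ℕ) × Symbols =>
      a.1.1.2.length + 2 * a.1.1.1.length + 1 :=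
    nat_add.comp (nat_add.comp hT (nat_mul.comp (const 2) hl)) (const 1)
  have hE : Primrec fun a : ((List Bool × Table) × ℕ) × Symbols =>
      prefixEntry a.1.1.1 a.1.1.2 a.1.2 a.2 := by
    refine Primrec.ite (Primrec.eq.comp hq (const 0)) (hn.pair (snd.pair (const 1)))
      (Primrec.ite (Primrec.nat_le.comp hq hT) ?_ ?_)
    · exact (Primrec.ite (Primrec.eq.comp (fst.comp hL) (const 0)) hT (fst.comp hL)).pair
        (snd.comp hL)
    · exact (nat_sub.comp hq (const 1)).pair
        ((((list_getD false).comp (fst.comp (fst.comp fst)) hk).pair (snd.comp snd)).pair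
          (Primrec.ite (Primrec.nat_le.comp hk hl) (const 0) (const 2)))
  have hR : Primrec fun a : (List Bool × Table) × ℕ =>
      allSymbols.map fun s => prefixEntry a.1.1 a.1.2 a.2 s :=
    list_map (const _) hE
  exact list_map (list_range.comp (nat_add.comp (nat_add.comp (list_length.comp snd)
    (nat_mul.comp (const 2) (list_length.comp fst))) (const 2))) hR

end

end Table

namespace Program

open Table

theorem isValid_prefixed (L : List Bool) (p : Program) : Table.IsValid (prefixed L p.table) := by
  have hN := p.length_table
  have hlen : (prefixed L p.table).length = p.extra + 3 + 2 * L.length + 2 := by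
    simp [prefixed, hN]
  refine ⟨by omega, fun r hr => ?_⟩
  obtain ⟨q, hq, rfl⟩ := List.mem_map.1 hr
  rw [List.mem_range, hN] at hq
  refine ⟨rfl, fun e he => ?_⟩
  obtain ⟨s, -, rfl⟩ := List.mem_map.1 he
  rw [hlen, prefixEntry, hN]
  split_ifs with h1 h2 h3 <;> simp only []
  · omega
  · have h4 : lookup p.table 0 (index s) = _ := lookup_table p p.start s
    rw [h4]
    refine ⟨?_, by cases (p.instr p.start s).2.2 <;> simp [Move.code]⟩
    have := (p.instr p.start s).1.2
    simp only [copyState]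
    split_ifs <;> omega
  · have := p.lookup_table ⟨q, by omega⟩ s
    simp only [] at this
    rw [this]
    refine ⟨?_, by cases (p.instr ⟨q, by omega⟩ s).2.2 <;> simp [Move.code]⟩
    have := (p.instr ⟨q, by omega⟩ s).1.2
    simp only [copyState]
    split_ifs <;> omega
  · omega
  · omega

/-- The configuration `c'` is a copy of `c`. -/
structure Config.Copies {p P : Program} (c : p.Config) (c' : P.Config) : Prop where
  state : (c'.state : ℕ) = copyState (p.extra + 3) c.state
  head : c'.head = c.head
  input : c'.input = c.input
  scratch : c'.scratch = c.scratch
  output : c'.output = c.output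

theorem Move.code_injective : Function.Injective Move.code := by
  intro a b
  cases a <;> cases b <;> simp [Move.code]

section

variable {L : List Bool} {p P : Program}

theorem instr_of_prefixed (hP : P.table = prefixed L p.table) (q : P.State) (s : Symbols) :
    (((P.instr q s).1 : ℕ), (P.instr q s).2.1, (P.instr q s).2.2.code) =
      prefixEntry L p.table q s := by
  rw [← P.lookup_table, hP]
  have hq : (q : ℕ) < p.table.length + 2 * L.length + 2 := by
    have h1 := q.2
    have h2 : P.table.length = _ := P.length_table
    rw [hP] at h2
    simp only [prefixed, List.length_map, List.length_range] at h2
    omega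
  have : (prefixed L p.table).getD q [] = allSymbols.map fun s => prefixEntry L p.table q s := by
    rw [List.getD_eq_getElem _ _ (by simpa [prefixed] using hq)]
    simp [prefixed]
  rw [Table.lookup, this]
  rcases s with ⟨_ | _, _ | _, _ | _⟩ <;> rfl

theorem Config.Copies.step (hP : P.table = prefixed L p.table) {c : p.Config} {c' : P.Config}
    (h : c.Copies c') :
    c.step.Copies c'.step := by
  have hr : c'.read = c.read := by
    simp only [Config.read, h.head, h.input, h.scratch, h.output]
  have hN := p.length_table
  have key := instr_of_prefixed hP c'.state c.read
  have hc := c.state.2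
  have hs : ((if copyState (p.extra + 3) c.state = p.extra + 3 then 0
      else copyState (p.extra + 3) c.state) : ℕ) = c.state := by
    simp only [copyState]; split_ifs <;> omega
  have h0 : copyState (p.extra + 3) c.state ≠ 0 := by
    simp only [copyState]; split_ifs <;> omega
  have h1 : copyState (p.extra + 3) c.state ≤ p.extra + 3 := by
    simp only [copyState]; split_ifs <;> omega
  rw [prefixEntry, hN, h.state, if_neg h0, if_pos h1, hs, lookup_table] at key
  simp only [Prod.mk.injEq] at key
  obtain ⟨k1, k2, k3⟩ := key
  have k3 := Move.code_injective k3
  constructor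
  · simp only [Config.step, hr]; exact k1
  · simp only [Config.step, hr, h.head, k3]
  · simp only [Config.step, hr, h.head, h.input, k2]
  · simp only [Config.step, hr, h.head, h.scratch, k2]
  · simp only [Config.step, hr, h.head, h.output, k2]

/-- A finite delay `k` is harmless at limits, as `α ↦ k + α` is normal. Only the start state is
renumbered; the limit state keeps its number, so the copy survives limits. -/
theorem copies_config (hP : P.table = prefixed L p.table) {x z : Cantor} {k : ℕ}
    (h0 : (p.initial x).Copies (P.config z k))
    (α : Ordinal.{0}) : (p.config x α).Copies (P.config z (k + α)) := by
  induction α using Ordinal.limitRecOn with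
  | zero => rwa [add_zero, config_zero]
  | add_one α ih =>
    rw [← add_assoc, config_succ, config_succ]
    exact Config.Copies.step hP ih
  | limit l hl ih =>
    have hn : IsNormal ((k : Ordinal.{0}) + ·) := Ordinal.isNormal_add_right _
    have hl' : IsSuccLimit ((k : Ordinal.{0}) + l) := hn.map_isSuccLimit hl
    have ht : ∀ j i, (P.config z (k + l)).tapes j i = (p.config x l).tapes j i := fun j i => by
      rw [tapes_config_limit _ _ hl', tapes_config_limit _ _ hl, decide_eq_decide]
      have ih' : ∀ α < l, (P.config z (k + α)).tapes j i = (p.config x α).tapes j i :=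
        fun α hα => by
          simp only [Config.tapes, (ih α hα).input, (ih α hα).scratch, (ih α hα).output]
      refine recurs_normal_iff hn hl ih' fun α hα T h1 h2 => .inl ?_
      rw [← add_assoc, lt_add_one_iff] at h2
      rw [← le_antisymm h1 h2, ih' α hα]
    constructor
    · rw [config_limit_state _ _ hl', config_limit_state _ _ hl]; rfl
    · rw [config_limit_head _ _ hl', config_limit_head _ _ hl]
    · exact funext (ht 0)
    · exact funext (ht 1)
    · exact funext (ht 2)

/-- A program with the prefixed table halts like the given one. -/
theorem haltsAt_iff_of_copies (hP : P.table = prefixed L p.table) {x z : Cantor} {k : ℕ}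
    (h0 : (p.initial x).Copies (P.config z k))
    (hk : ∀ m < k, (P.config z (m : ℕ)).state ≠ P.halt) (Q : Cantor → Prop) :
    (∃ α, P.HaltsAt z α ∧ Q (P.config z α).output) ↔
      ∃ α, p.HaltsAt x α ∧ Q (p.config x α).output := by
  have hc := copies_config hP h0
  have hs : ∀ α, (P.config z (k + α)).state = P.halt ↔ (p.config x α).state = p.halt := fun α => by
    rw [Fin.ext_iff, Fin.ext_iff, (hc α).state]
    change copyState _ _ = 2 ↔ _ = 2
    simp only [copyState]; split_ifs <;> omega
  have hlt : ∀ β : Ordinal.{0}, β < k → (P.config z β).state ≠ P.halt := fun β hβ => by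
    obtain ⟨m, rfl⟩ := Ordinal.lt_omega0.1 (hβ.trans (Ordinal.natCast_lt_omega0 k))
    exact hk m (by exact_mod_cast hβ)
  have hh : ∀ α, P.HaltsAt z (k + α) ↔ p.HaltsAt x α := fun α => by
    refine and_congr (hs α) ⟨fun h β hβ => ?_, fun h β hβ => ?_⟩
    · rw [ne_eq, ← hs]
      exact h _ ((add_lt_add_iff_left _).2 hβ)
    · rcases lt_or_ge β k with h1 | h1
      · exact hlt β h1
      · obtain ⟨γ, rfl⟩ := exists_add_of_le h1
        rw [ne_eq, hs]
        exact h _ ((add_lt_add_iff_left _).1 hβ)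
  constructor
  · rintro ⟨α, h1, h2⟩
    rcases lt_or_ge α k with h3 | h3
    · exact absurd h1.1 (hlt α h3)
    · obtain ⟨γ, rfl⟩ := exists_add_of_le h3
      exact ⟨γ, (hh γ).1 h1, (hc γ).output ▸ h2⟩
  · rintro ⟨α, h1, h2⟩
    exact ⟨k + α, (hh α).2 h1, (hc α).output.symm ▸ h2⟩

theorem step_of_prefixed (hP : P.table = prefixed L p.table) (c : P.Config) :
    (c.step.state : ℕ) = (prefixEntry L p.table c.state c.read).1 ∧
      (∀ m : Move, (prefixEntry L p.table c.state c.read).2.2 = m.code →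
        c.step.head = m.apply c.head) ∧
      c.step.input = Function.update c.input c.head (prefixEntry L p.table c.state c.read).2.1.1 ∧
      c.step.scratch =
        Function.update c.scratch c.head (prefixEntry L p.table c.state c.read).2.1.2.1 ∧
      c.step.output =
        Function.update c.output c.head (prefixEntry L p.table c.state c.read).2.1.2.2 := by
  rw [← instr_of_prefixed hP]
  exact ⟨rfl, fun m hm => by rw [← Move.code_injective hm]; rfl, rfl, rfl, rfl⟩

/-- The head moves to the right end of the word. -/
theorem config_seek (hP : P.table = prefixed L p.table) (m : ℕ) (hm : m ≤ L.length) :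
    ((P.config (ofNat 0) (m + 1 : ℕ)).state : ℕ) = p.extra + 3 + (2 * L.length + 1 - m) ∧
      (P.config (ofNat 0) (m + 1 : ℕ)).head = m ∧
      (P.config (ofNat 0) (m + 1 : ℕ)).input = ofNat 0 ∧
      (P.config (ofNat 0) (m + 1 : ℕ)).scratch = ofNat 0 ∧
      (P.config (ofNat 0) (m + 1 : ℕ)).output = ofNat 0 := by
  have hN := p.length_table
  induction m with
  | zero =>
    have h := step_of_prefixed hP (P.initial (ofNat 0))
    have h0 : ((P.initial (ofNat 0)).state : ℕ) = 0 := rfl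
    have hh : (P.initial (ofNat 0)).head = 0 := rfl
    rw [h0, prefixEntry, if_pos rfl, hN, hh] at h
    obtain ⟨h1, h2, h3, h4, h5⟩ := h
    rw [zero_add, Nat.cast_one, ← zero_add 1, config_succ, config_zero]
    refine ⟨by rw [h1]; simp only []; omega, h2 .stay rfl, ?_, ?_, ?_⟩
    · rw [h3]; exact Function.update_eq_self 0 _
    · rw [h4]; exact Function.update_eq_self 0 _
    · rw [h5]; exact Function.update_eq_self 0 _
  | succ m ih =>
    obtain ⟨i1, i2, i3, i4, i5⟩ := ih (by omega)
    rw [Nat.cast_succ (m + 1), config_succ]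
    set c := P.config (ofNat 0) (m + 1 : ℕ)
    have h := step_of_prefixed hP c
    have e1 : ¬ (c.state : ℕ) = 0 := by omega
    have e2 : ¬ (c.state : ℕ) ≤ p.extra + 3 := by omega
    have e3 : ¬ (c.state : ℕ) - (p.extra + 3) - 1 ≤ L.length := by omega
    -- On the way to the right the counter exceeds the length of `L`, so the default `false` is
    -- written and the blank tape is unchanged.
    have e4 : L.getD ((c.state : ℕ) - (p.extra + 3) - 1) false = false :=
      List.getD_eq_default _ _ (by omega)
    rw [prefixEntry, hN, if_neg e1, if_neg e2, if_neg e3, e4] at h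
    obtain ⟨h1, h2, h3, h4, h5⟩ := h
    refine ⟨by rw [h1]; simp only []; omega, by rw [h2 .right rfl, i2]; rfl, ?_, ?_, ?_⟩
    · rw [h3, i3]; exact Function.update_eq_self c.head (ofNat 0)
    · rw [h4, ← i4]; exact Function.update_eq_self c.head _
    · rw [h5, ← i5]; exact Function.update_eq_self c.head _

/-- The word is written on the way back. -/
theorem config_write (hP : P.table = prefixed L p.table) (k : ℕ) (hk : k ≤ L.length + 1) :
    ((P.config (ofNat 0) (L.length + 1 + k : ℕ)).state : ℕ) =
        p.extra + 3 + (L.length + 1 - k) ∧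
      (P.config (ofNat 0) (L.length + 1 + k : ℕ)).head = L.length - k ∧
      (P.config (ofNat 0) (L.length + 1 + k : ℕ)).input =
        (fun i => decide (L.length + 1 ≤ i + k) && L.getD i false) ∧
      (P.config (ofNat 0) (L.length + 1 + k : ℕ)).scratch = ofNat 0 ∧
      (P.config (ofNat 0) (L.length + 1 + k : ℕ)).output = ofNat 0 := by
  have hN := p.length_table
  induction k with
  | zero =>
    obtain ⟨i1, i2, i3, i4, i5⟩ := config_seek hP L.length le_rfl
    rw [add_zero]
    refine ⟨by rw [i1]; omega, i2, ?_, i4, i5⟩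
    rw [i3]
    funext i
    by_cases h : L.length + 1 ≤ i + 0
    · rw [List.getD_eq_default _ _ (by omega)]; simp [ofNat]
    · rw [decide_eq_false h]; simp [ofNat]
  | succ k ih =>
    obtain ⟨i1, i2, i3, i4, i5⟩ := ih (by omega)
    rw [← add_assoc, Nat.cast_succ, config_succ]
    set c := P.config (ofNat 0) (L.length + 1 + k : ℕ)
    have h := step_of_prefixed hP c
    have e1 : ¬ (c.state : ℕ) = 0 := by omega
    have e2 : ¬ (c.state : ℕ) ≤ p.extra + 3 := by omega
    -- On the way back the counter equals the head position, so each cell receives its own letter.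
    -- The first cell written is the one after the word. At cell `0` the left move is void, and the
    -- head is in place when the copied start state is reached.
    have e3 : (c.state : ℕ) - (p.extra + 3) - 1 = L.length - k := by omega
    rw [prefixEntry, hN, if_neg e1, if_neg e2, e3, if_pos (Nat.sub_le _ _)] at h
    obtain ⟨h1, h2, h3, h4, h5⟩ := h
    refine ⟨by rw [h1]; simp only []; omega, ?_, ?_, ?_, ?_⟩
    · rw [h2 .left rfl, i2]; simp only [Move.apply]; omega
    · rw [h3, i2, i3]
      funext i
      rcases eq_or_ne i (L.length - k) with rfl | hi
      · have : L.length + 1 ≤ L.length - k + (k + 1) := by omega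
        simp [this]
      · have : L.length + 1 ≤ i + (k + 1) ↔ L.length + 1 ≤ i + k := by omega
        rw [Function.update_of_ne hi]
        simp only [this]
    · rw [h4, ← i4]; exact Function.update_eq_self c.head _
    · rw [h5, ← i5]; exact Function.update_eq_self c.head _

end

/-- For every word, the program with the prefixed table behaves on the input `0` like the given one
on the word. -/
theorem exists_prefixed (L : List Bool) (p : Program) : ∃ P : Program,
    P.table = prefixed L p.table ∧ ∀ Q : Cantor → Prop,
      (∃ α, P.HaltsAt (ofNat 0) α ∧ Q (P.config (ofNat 0) α).output) ↔
        ∃ α, p.HaltsAt (word L) α ∧ Q (p.config (word L) α).output := by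
  obtain ⟨P, hP⟩ := (p.isValid_prefixed L).exists_program
  refine ⟨P, hP, haltsAt_iff_of_copies hP (k := L.length + 1 + (L.length + 1)) ?_ fun m hm => ?_⟩
  · obtain ⟨h1, h2, h3, h4, h5⟩ := config_write hP (L.length + 1) le_rfl
    refine ⟨by rw [h1, Nat.sub_self]; rfl, by rw [h2]; simp [initial], ?_, h4, h5⟩
    rw [h3]
    funext i
    simp [initial, word]
  · rw [ne_eq, Fin.ext_iff]
    change ¬ _ = 2
    rcases m with _ | m
    · rw [Nat.cast_zero, config_zero]
      exact two_ne_zero.symm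
    · rcases le_or_gt m L.length with h | h
      · have := (config_seek hP m h).1
        omega
      · obtain ⟨k, rfl⟩ := Nat.exists_eq_add_of_lt h
        have := (config_write hP (k + 1) (by omega)).1
        rw [← add_assoc, add_right_comm L.length 1 k] at this
        omega

end Program

/-! ### The diagonal argument -/

/-- A set is not decidable if the halting problem for the input `0` is reducible to it by a
primitive recursive function. -/
theorem not_isDecidable {A : Set Cantor} {w : ℕ → List Bool} (hw : Primrec w)
    (hA : ∀ p : Program, word (w p.code) ∈ A ↔ p.Halts (ofNat 0)) : ¬ IsDecidable A := by
  rintro ⟨d, hd⟩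
  let v : ℕ → List Bool := fun n => (List.range n).map fun _ => true
  have hv : ∀ n, word (v n) = ofNat n := word_map_range
  have hv' : Primrec v := Primrec.list_map Primrec.list_range (Primrec.const _).to₂
  -- For a Gödel number `n`, this is the number of the program that, on input `0`, runs program `n`
  -- on the numeral `n`.
  let s : ℕ → ℕ := fun n =>
    Encodable.encode (Table.prefixed (v n) ((Encodable.decode (α := Table) n).getD []))
  have hs : Primrec s := Primrec.encode.comp (Table.primrec_prefixed.comp hv'
    (Primrec.option_getD.comp Primrec.decode (Primrec.const [])))
  -- The program that, on input `0`, asks `d` about the image of `s n` under the reduction.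
  let G : ℕ → Table := fun n => Table.prefixed (w (s n)) d.table
  have hG : Primrec G := Table.primrec_prefixed.comp (hw.comp hs) (Primrec.const _)
  obtain ⟨U, hU⟩ := exists_computesInstr hG.to_comp
  -- The second flag negates: `P` halts on the numeral `n` only if `d` answers `0`.
  obtain ⟨P, hP⟩ := exists_universal hU false true
  -- The diagonal program: it runs `P` on its own number, so its code is `s P.code`.
  obtain ⟨W, hW, hWP⟩ := P.exists_prefixed (v P.code)
  have hWs : s P.code = W.code := by
    have : Encodable.decode (α := Table) P.code = some P.table := Encodable.encodek _
    simp only [s, this, Option.getD_some, ← hW]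
    rfl
  obtain ⟨D, hD, hDd⟩ := d.exists_prefixed (w W.code)
  have h1 : W.Halts (ofNat 0) ↔ P.Halts (ofNat P.code) := by
    rw [← hv P.code]
    simpa [Program.Halts] using hWP fun _ => True
  have h2 : P.Halts (ofNat P.code) ↔ D.Accepts true (ofNat 0) := by
    have hDG : Program.ofTable (G P.code) = D := by
      simp only [G, hWs, ← hD, Program.ofTable_table]
    have : P.Halts (ofNat P.code) ↔ ∃ y, P.Yields (ofNat P.code) y :=
      ⟨fun ⟨α, h⟩ => ⟨_, α, h, rfl⟩, fun ⟨_, α, h, _⟩ => ⟨α, h⟩⟩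
    rw [this]
    simp only [hP, exists_and_left, exists_eq, and_true, Bool.false_eq_true, if_false, one_mul,
      Bool.false_and]
    have h0 : (fun _ => false : Cantor) = ofNat 0 := by funext i; simp [ofNat]
    refine ⟨fun ⟨n, h1, h2⟩ => ?_, fun h => ⟨P.code, rfl, ?_⟩⟩
    · rw [← ofNat_injective h1, hDG, h0] at h2
      exact h2
    · rw [hDG, h0]
      exact h
  have h3 : D.Accepts true (ofNat 0) ↔ d.Accepts true (word (w W.code)) :=
    hDd fun y => (true && y 0) = false
  have h4 : d.Accepts true (word (w W.code)) ↔ word (w W.code) ∉ A := by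
    have key : d.Accepts true (word (w W.code)) ↔
        ∃ y, d.Yields (word (w W.code)) y ∧ y 0 = false :=
      ⟨fun ⟨α, h1, h2⟩ => ⟨_, ⟨α, h1, rfl⟩, by simpa using h2⟩,
        fun ⟨y, ⟨α, h1, h2⟩, h3⟩ => ⟨α, h1, by rw [h2, h3]; rfl⟩⟩
    simp only [key, ← hd, PFun.coe_val, Part.mem_some_iff, exists_eq_left, characteristic]
    split_ifs with h <;> simp [h, ofNat]
  rw [h2, h3, h4, hA] at h1
  exact iff_not_self h1

end ITTM

/-! ### The two halting problems -/

namespace ITTM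

/-- One code computes the instructions of all programs, with respect to the Gödel numbering. -/
theorem exists_computesInstr_decode : ∃ U, ∀ n, ComputesInstr U
    (.ofTable ((Encodable.decode₂ Table n).getD [])) (2 ^ n - 1) :=
  exists_computesInstr (Primrec.option_getD.comp Primrec.decode₂ (Primrec.const [])).to_comp

theorem Program.accepts_false (p : Program) (x : Cantor) : p.Accepts false x ↔ p.Halts x := by
  simp [Accepts, Halts]

theorem Program.not_halts_idle (x : Cantor) : ¬ idle.Halts x := by
  rintro ⟨α, h⟩
  obtain ⟨β, rfl⟩ := h.exists_add_one
  have := h.1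
  rw [config_succ] at this
  exact idle.halt_ne_start this

/-- The program of a Gödel number halts only if the number is valid. -/
theorem Program.halts_ofTable_decode (n : ℕ) (x : Cantor) :
    (ofTable ((Encodable.decode₂ Table n).getD [])).Halts x ↔
      ∃ p : Program, p.code = n ∧ p.Halts x := by
  constructor
  · rcases ht : Encodable.decode₂ Table n with _ | T
    · intro h
      -- The default for undecodable numbers is the empty table, which belongs to no program because
      -- every table has at least three rows; so the simulated program is `idle`.
      have : ¬ ∃ p : Program, p.table = [] := fun ⟨p, hp⟩ => by
        have := p.length_table
        rw [hp] at this
        simp at this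
      rw [Option.getD_none, ofTable, dif_neg this] at h
      exact absurd h (not_halts_idle x)
    · intro h
      rw [Option.getD_some] at h
      by_cases hp : ∃ p : Program, p.table = T
      · obtain ⟨p, rfl⟩ := hp
        rw [ofTable_table] at h
        exact ⟨p, Encodable.mem_decode₂.1 ht, h⟩
      · rw [ofTable, dif_neg hp] at h
        exact absurd h (not_halts_idle x)
  · rintro ⟨p, rfl, h⟩
    rw [code, Encodable.encodek₂, Option.getD_some, ofTable_table]
    exact h

theorem isSemiDecidable_lightHalting : IsSemiDecidable lightHalting := by
  obtain ⟨U, hU⟩ := exists_computesInstr_decode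
  obtain ⟨P, hP⟩ := exists_universal hU false false
  refine ⟨P, fun z y => ?_⟩
  have h0 : (fun _ => false : Cantor) = ofNat 0 := by funext i; simp [ofNat]
  simp only [hP, Program.accepts_false, Program.halts_ofTable_decode, Bool.false_eq_true, if_false,
    one_mul, Bool.false_and, h0]
  change (∃ _ : z ∈ lightHalting, ofNat 1 = y) ↔ _
  rw [exists_prop, eq_comm]
  refine and_congr_left fun _ => ⟨fun ⟨p, h1, h2⟩ => ⟨_, h1, p, rfl, h2⟩, ?_⟩
  rintro ⟨_, h1, p, rfl, h2⟩
  exact ⟨p, h1, h2⟩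

theorem isSemiDecidable_boldHalting : IsSemiDecidable boldHalting := by
  obtain ⟨U, hU⟩ := exists_computesInstr_decode
  obtain ⟨P, hP⟩ := exists_universal hU true false
  refine ⟨P, fun z y => ?_⟩
  simp only [hP, Program.accepts_false, Program.halts_ofTable_decode, if_true, Bool.true_and]
  change (∃ _ : z ∈ boldHalting, ofNat 1 = y) ↔ _
  rw [exists_prop, eq_comm]
  refine and_congr_left fun _ => ⟨?_, ?_⟩
  · rintro ⟨p, x, rfl, h⟩
    refine ⟨p.code, ?_, p, rfl, ?_⟩
    · funext i
      simp [pair]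
    · have : (fun i => pair (ofNat p.code) x (2 * i + 1)) = x := by
        funext i
        have h2 : (2 * i + 1) / 2 = i := by omega
        simp [pair, h2]
      rwa [this]
  · rintro ⟨_, h1, p, rfl, h2⟩
    refine ⟨p, _, ?_, h2⟩
    rw [← h1]
    funext i
    rcases Nat.even_or_odd' i with ⟨k, rfl | rfl⟩
    · simp [pair]
    · have h3 : (2 * k + 1) / 2 = k := by omega
      simp [pair, h3]

theorem not_isDecidable_lightHalting : ¬ IsDecidable lightHalting := by
  refine not_isDecidable (w := fun n => (List.range n).map fun _ => true)
    (Primrec.list_map Primrec.list_range (Primrec.const _).to₂) fun p => ?_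
  rw [word_map_range]
  refine ⟨fun ⟨q, h1, h2⟩ => ?_, fun h => ⟨p, rfl, h⟩⟩
  rwa [Program.code_injective (ofNat_injective h1)]

theorem not_isDecidable_boldHalting : ¬ IsDecidable boldHalting := by
  -- The pair of the numeral `n` and the real `0` is a finite word: ones at the even places below `2
  -- * n`.
  refine not_isDecidable (w := fun n => (List.range (2 * n)).map fun i => decide (i % 2 = 0))
    (Primrec.list_map (Primrec.list_range.comp (Primrec.nat_mul.comp (.const 2) .id))
      (Primrec.eq.comp (Primrec.nat_mod.comp .snd (.const 2)) (.const 0)).decide) fun p => ?_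
  have hw : word ((List.range (2 * p.code)).map fun i => decide (i % 2 = 0)) =
      pair (ofNat p.code) (ofNat 0) := by
    funext i
    by_cases h : i < 2 * p.code
    · have h' : i / 2 < p.code := by omega
      by_cases h2 : i % 2 = 0 <;> simp [word, pair, ofNat, h, h', h2, List.getD]
    · have h' : ¬ i / 2 < p.code := by omega
      by_cases h2 : i % 2 = 0 <;> simp [word, pair, ofNat, h, h', h2, List.getD]
  rw [hw]
  refine ⟨fun ⟨q, x, h1, h2⟩ => ?_, fun h => ⟨p, _, rfl, h⟩⟩
  have he : ofNat p.code = ofNat q.code := by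
    funext i
    simpa [pair] using congrFun h1 (2 * i)
  have hx : ofNat 0 = x := by
    funext i
    have h3 : (2 * i + 1) / 2 = i := by omega
    simpa [pair, h3] using congrFun h1 (2 * i + 1)
  rw [Program.code_injective (ofNat_injective he), hx]
  exact h2

end ITTM

theorem mainTheorem5 :
    (ITTM.IsSemiDecidable ITTM.lightHalting ∧ ¬ ITTM.IsDecidable ITTM.lightHalting) ∧
    (ITTM.IsSemiDecidable ITTM.boldHalting ∧ ¬ ITTM.IsDecidable ITTM.boldHalting) := by
  exact ⟨⟨ITTM.isSemiDecidable_lightHalting, ITTM.not_isDecidable_lightHalting⟩,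
    ITTM.isSemiDecidable_boldHalting, ITTM.not_isDecidable_boldHalting⟩
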